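/- Let $n\ge 0$ be an integer and let $\mathfrak g_N$ be $\mathfrak o_{2n+1}$, $\mathfrak{sp}_{2n}$ or $\mathfrak o_{2n}$ (types $B_n$, $C_n$, $D_n$), with $N=2n+1,2n,2n$ respectively. For $1\le i\le N$ put $i'=N+1-i$. Put $\varepsilon_i=1$ in the orthogonal case; in the symplectic case put $\varepsilon_i=1$ for $i\le n$ and $\varepsilon_i=-1$ for $i>n$. Let $e_{ij}$ be the matrix units, let $e_{ij}^{t}=\varepsilon_i\varepsilon_j e_{j'i'}$, and let $(\bar 1,\dots,\bar N)$ be $(n-\frac12,\dots,\frac12,0,-\frac12,\dots,-n+\frac12)$ in type $B$, $(n,\dots,1,-1,\dots,-n)$ in type $C$, $(n-1,\dots,1,0,0,-1,\dots,-n+1)$ in type $D$. Let $\kappa=\frac N2+1$ in the symplectic case and $\kappa=\frac N2-1$ in the orthogonal case, and $\xi=q^{-2\kappa}$. Define $$R^+(x,q)=q^{-1}(x-1)(x-\xi)R-(q^{-2}-1)(x-\xi)P+\xi(q^{-2}-1)(x-1)Q,$$ where $P=\sum_{i,j}e_{ij}\otimes e_{ji}$, $Q=\sum_{i,j}q^{\bar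 i-\bar j}\varepsilon_i\varepsilon_j\,e_{i'j'}\otimes e_{ij}$ and $$R=q\sum_{i\ne i'}e_{ii}\otimes e_{ii}+\sum_{i\ne j,j'}e_{ii}\otimes e_{jj}+q^{-1}\sum_{i\ne i'}e_{ii}\otimes e_{i'i'}+(q-q^{-1})\sum_{i<j}e_{ij}\otimes e_{ji}-(q-q^{-1})\sum_{i>j}q^{\bar i-\bar j}\varepsilon_i\varepsilon_j\,e_{i'j'}\otimes e_{ij}+\sum_{i=i'}e_{ii}\otimes e_{ii}.$$ There is a unique series $g(u,h)\in\mathbb C((u))[[h]]$ with $g(u,0)=(1-e^{-u})^{-2}$ and $$g(u,h)\,g(u+\kappa h,h)=\frac1{(1-e^{-u-h})(1-e^{-u+h})(1-e^{-u-\kappa h})(1-e^{-u+\kappa h})},$$ where $a(u+\kappa h,h)$ stands for the Taylor expansion in powers of $h$ and the right-hand side for the inverse in $\mathbb C((u))[[h]]$. With this $g$, put $$\widehat R(u)=e^{(1+2\kappa)h/2}\,g(u,h)\,R^+(e^{-u},e^{h/2})\in \mathrm{End}(\mathbb C^N)^{\otimes 2}((u))[[h]]$$ (where $q^{1/2}=e^{h/4}$).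 Let $A_{rs}$ denote $A\in\mathrm{End}(\mathbb C^N)^{\otimes 2}$ acting on the tensor factors $r$ and $s$ (its first factor on $r$, its second on $s$). Then: 1. (Yang–Baxter equation) $\widehat R_{12}(u)\widehat R_{13}(u+v)\widehat R_{23}(v)=\widehat R_{23}(v)\widehat R_{13}(u+v)\widehat R_{12}(u)$ in $\mathrm{End}(\mathbb C^N)^{\otimes 3}((u))((v))[[h]]$, where $\widehat R(u+v)$ is expanded in nonnegative powers of $v$. 2. (Crossing symmetry) $\widehat R(u)\,M_1\,\widehat R(u+\kappa h)^{t_1}M_1^{-1}=1$, where $M=\mathrm{diag}(e^{\bar 1h/2},\dots,e^{\bar Nh/2})$ and $M_1$, $t_1$ indicate that $M$ and the transposition $t$ are applied on the first tensor factor. 3. (Unitarity) $\widehat R_{12}(u)\widehat R_{21}(-u)=1$. -/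

import Mathlib

open scoped Kronecker

noncomputable section

namespace TrigR

/-! ### Combinatorial data of types `B`, `C`, `D` -/

/-- The three types: `o_{2n+1}`, `sp_{2n}`, `o_{2n}`. -/
inductive LieType
  | B
  | C
  | D

/-- The size `N` of the matrices in rank `n`. -/
def dim : LieType → ℕ → ℕ
  | .B, n => 2 * n + 1
  | .C, n => 2 * n
  | .D, n => 2 * n

/-- The sign `ε_i` (the index `i` runs through `0, …, N - 1`). -/
def eps : (X : LieType) → (n : ℕ) → Fin (dim X n) → ℤ
  | .B, _, _ => 1
  | .C, n, i => if i.val < n then 1 else -1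
  | .D, _, _ => 1

/-- Twice the entry of the `N`-tuple `(1̄, …, N̄)`; the index `i` runs through `0, …, N - 1`.
The tuples are `(n - 1/2, …, 1/2, 0, -1/2, …, -n + 1/2)`, `(n, …, 1, -1, …, -n)` and
`(n - 1, …, 1, 0, 0, -1, …, -n + 1)` in types `B`, `C`, `D`. -/
def twoBar : (X : LieType) → (n : ℕ) → Fin (dim X n) → ℤ
  | .B, n, i =>
      if i.val < n then 2 * n - 1 - 2 * i.val
      else if i.val = n then 0
      else 2 * n + 1 - 2 * i.val
  | .C, n, i => if i.val < n then 2 * n - 2 * i.val else 2 * n - 2 - 2 * i.val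
  | .D, n, i => if i.val < n then 2 * n - 2 - 2 * i.val else 2 * n - 2 * i.val

/-- The exponent of `q` in `ξ`: `2 - N` in the orthogonal case, `-2 - N` in the symplectic case. -/
def xiExp : LieType → ℕ → ℤ
  | .B, n => 2 - (dim .B n : ℤ)
  | .C, n => -2 - (dim .C n : ℤ)
  | .D, n => 2 - (dim .D n : ℤ)

/-- `κ = N/2 + 1` in the symplectic case and `κ = N/2 - 1` in the orthogonal case. -/
def kappa : LieType → ℕ → ℂ
  | .B, n => (dim .B n : ℂ) / 2 - 1
  | .C, n => (dim .C n : ℂ) / 2 + 1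
  | .D, n => (dim .D n : ℂ) / 2 - 1

/-! ### The R-matrix over a commutative ring, as a function of `x` and of a unit `t = q^{1/2}`

`End(ℂ^N)^{⊗ 2}` with coefficients in `S` is the ring of matrices over `S` whose rows and columns
are indexed by pairs, through the Kronecker product. -/

section Ring

variable {S : Type*} [CommRing S]

/-- The ring `End(ℂ^N) ⊗ End(ℂ^N) ⊗ S`. -/
abbrev End2 (N : ℕ) (S : Type*) := Matrix (Fin N × Fin N) (Fin N × Fin N) S

/-- `e_{ij} ⊗ e_{kl}`. -/
def unit2 (S : Type*) [CommRing S] {N : ℕ} (i j k l : Fin N) : End2 N S :=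
  Matrix.single i j (1 : S) ⊗ₖ Matrix.single k l (1 : S)

/-- `q = t ^ 2`. -/
def qOf (t : Sˣ) : Sˣ := t ^ 2

/-- `ξ` as a power of `q`. -/
def xi (X : LieType) (n : ℕ) (t : Sˣ) : Sˣ := qOf t ^ xiExp X n

/-- The coefficient `q^{ī - j̄} ε_i ε_j`. -/
def wt (X : LieType) (n : ℕ) (t : Sˣ) (i j : Fin (dim X n)) : S :=
  ((t ^ (twoBar X n i - twoBar X n j) : Sˣ) : S) * ((eps X n i * eps X n j : ℤ) : S)

/-- The permutation operator `P`. -/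
def opP (X : LieType) (n : ℕ) (S : Type*) [CommRing S] : End2 (dim X n) S :=
  ∑ i, ∑ j, unit2 S i j j i

/-- The operator `Q`; the index `i' = N + 1 - i` is `i.rev`. -/
def opQ (X : LieType) (n : ℕ) (t : Sˣ) : End2 (dim X n) S :=
  ∑ i, ∑ j, wt X n t i j • unit2 S i.rev j.rev i j

/-- The operator `R`. The last sum is over the indices with `i = i'`: it has one term, the middle
index, if `N` is odd, and it is empty if `N` is even. -/
def opR (X : LieType) (n : ℕ) (t : Sˣ) : End2 (dim X n) S :=
  let q : S := (qOf t : Sˣ)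
  let q' : S := ((qOf t)⁻¹ : Sˣ)
  (∑ i, if i ≠ i.rev then q • unit2 S i i i i else 0)
    + (∑ i, ∑ j, if i ≠ j ∧ i ≠ j.rev then unit2 S i i j j else 0)
    + (∑ i, if i ≠ i.rev then q' • unit2 S i i i.rev i.rev else 0)
    + (∑ i, ∑ j, if i < j then (q - q') • unit2 S i j j i else 0)
    - (∑ i, ∑ j, if j < i then ((q - q') * wt X n t i j) • unit2 S i.rev j.rev i j else 0)
    + (∑ i, if i = i.rev then unit2 S i i i i else 0)

/-- `R⁺(x, q) = q⁻¹ (x - 1)(x - ξ) R - (q⁻² - 1)(x - ξ) P + ξ (q⁻² - 1)(x - 1) Q`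
with `q = t ^ 2`. -/
def Rplus (X : LieType) (n : ℕ) (x : S) (t : Sˣ) : End2 (dim X n) S :=
  let q' : S := ((qOf t)⁻¹ : Sˣ)
  let ξ : S := (xi X n t : Sˣ)
  (q' * (x - 1) * (x - ξ)) • opR X n t
    - ((q' ^ 2 - 1) * (x - ξ)) • opP X n S
    + (ξ * (q' ^ 2 - 1) * (x - 1)) • opQ X n t

/-- `D₁ = D ⊗ 1` for the diagonal matrix `D = diag(q^{1̄}, …, q^{N̄})`. -/
def diagD1 (X : LieType) (n : ℕ) (t : Sˣ) : End2 (dim X n) S :=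
  Matrix.diagonal (fun i => ((t ^ twoBar X n i : Sˣ) : S)) ⊗ₖ
    (1 : Matrix (Fin (dim X n)) (Fin (dim X n)) S)

/-- The transposition `e_{ij} ↦ ε_i ε_j e_{j' i'}` applied to the first tensor factor, written in
terms of matrix entries. -/
def transpose1 (X : LieType) (n : ℕ) (A : End2 (dim X n) S) : End2 (dim X n) S :=
  Matrix.of fun a b =>
    ((eps X n a.1.rev * eps X n b.1.rev : ℤ) : S) * A (b.1.rev, a.2) (a.1.rev, b.2)

/-- The tensor notation `A_{rs}` in `End(ℂ^N)^{⊗ m}`, whose elements are matrices indexed by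
`m`-tuples: the first factor of `A` acts on position `r`, the second one on position `s`, and
the identity acts on all other positions. -/
def legs {N m : ℕ} (r s : Fin m) (A : End2 N S) : Matrix (Fin m → Fin N) (Fin m → Fin N) S :=
  Matrix.of fun a b =>
    if ∀ p, p ≠ r → p ≠ s → a p = b p then A (a r, a s) (b r, b s) else 0

end Ring

/-! ### The rings `ℂ((u))[[h]]` and `ℂ((u))((v))[[h]]` -/

/-- `ℂ((u))`. -/
abbrev Lu := LaurentSeries ℂ

/-- `ℂ((u))[[h]]`. -/
abbrev Luh := PowerSeries Lu

/-- `ℂ((u))((v))`. -/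
abbrev Luv := LaurentSeries Lu

/-- `ℂ((u))((v))[[h]]`. -/
abbrev Luvh := PowerSeries Luv

/-- `e^{-u}` in `ℂ((u))`. -/
def expNegU : Lu := HahnSeries.ofPowerSeries ℤ ℂ (PowerSeries.rescale (-1 : ℂ) (PowerSeries.exp ℂ))

/-- `e^{-u}` in `ℂ((u))[[h]]`. -/
def expNegU' : Luh := PowerSeries.C expNegU

/-- `e^{c h}` in `ℂ((u))[[h]]`. -/
def expH (c : ℂ) : Luh :=
  PowerSeries.map (HahnSeries.C : ℂ →+* Lu) (PowerSeries.rescale c (PowerSeries.exp ℂ))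

theorem expH_mul_expH_neg (c : ℂ) : expH c * expH (-c) = 1 := by
  unfold expH
  rw [← map_mul, PowerSeries.exp_mul_exp_eq_exp_add, add_neg_cancel, PowerSeries.rescale_zero]
  simp

/-- The unit `e^{h/4}`, which is substituted for `q^{1/2}`. -/
def expQuarter : Luhˣ where
  val := expH (1 / 4)
  inv := expH (-(1 / 4))
  val_inv := expH_mul_expH_neg _
  inv_val := by rw [mul_comm]; exact expH_mul_expH_neg _

/-- The substitution `u ↦ u + c h` in `ℂ((u))[[h]]`, by the formal Taylor theorem:
`∑ a_l(u) h^l ↦ ∑_k (∑_{m + l = k} (c^m / m!) (d/du)^m a_l(u)) h^k`. The Hasse derivative is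
`(1 / m!) (d/du)^m`. -/
def shiftH (c : ℂ) (a : Luh) : Luh :=
  PowerSeries.mk fun k =>
    ∑ p ∈ Finset.HasAntidiagonal.antidiagonal k,
      c ^ p.1 • LaurentSeries.hasseDeriv ℂ p.1 (PowerSeries.coeff p.2 a)

/-- Application of a map to all the coefficients of a power series in `h`. -/
def mapCoeff {A B : Type*} [Semiring A] [Semiring B] (φ : A → B) (a : PowerSeries A) :
    PowerSeries B :=
  PowerSeries.mk fun k => φ (PowerSeries.coeff k a)

/-- The substitution `u ↦ -u` in `ℂ((u))`. -/
def negU (f : Lu) : Lu where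
  coeff k := (-1 : ℂ) ^ k * f.coeff k
  isPWO_support' := f.isPWO_support.mono fun k hk => by
    simp only [Function.mem_support, HahnSeries.mem_support] at hk ⊢
    exact right_ne_zero_of_mul hk

/-- `f(u) ↦ f(u)`, as a map `ℂ((u)) → ℂ((u))((v))`. -/
def atU (f : Lu) : Luv := HahnSeries.C f

/-- `f(u) ↦ f(v)`, as a map `ℂ((u)) → ℂ((u))((v))`. -/
def atV (f : Lu) : Luv := HahnSeries.map f (HahnSeries.C : ℂ →+* Lu)

/-- `f(u) ↦ f(u + v)`, expanded in nonnegative powers of `v`, as a map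
`ℂ((u)) → ℂ((u))((v))`: `f(u + v) = ∑_m (1 / m!) f^{(m)}(u) v^m`. -/
def atUV (f : Lu) : Luv :=
  HahnSeries.ofPowerSeries ℤ Lu (PowerSeries.mk fun m => LaurentSeries.hasseDeriv ℂ m f)

/-! ### The normalizing series and the additive R-matrix -/

/-- `g(u, 0) = (1 - e^{-u})^{-2}` and `g(u, h) g(u + κ h, h)` is the inverse of
`(1 - e^{-u-h})(1 - e^{-u+h})(1 - e^{-u-κh})(1 - e^{-u+κh})`. The inverse in `ℂ((u))[[h]]` is a
true one: the constant term `(1 - e^{-u})^4` of this product is nonzero. -/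
def IsNormalizing (κ : ℂ) (g : Luh) : Prop :=
  PowerSeries.constantCoeff g = ((1 - expNegU) ^ 2)⁻¹ ∧
  g * shiftH κ g =
    ((1 - expNegU' * expH (-1)) * (1 - expNegU' * expH 1) *
      (1 - expNegU' * expH (-κ)) * (1 - expNegU' * expH κ))⁻¹

/-- `e^{(1 + 2κ)h/2} g(u, h) R⁺(e^{-u}, e^{h/2})`. -/
def Rhat (X : LieType) (n : ℕ) (g : Luh) : End2 (dim X n) Luh :=
  (expH ((1 + 2 * kappa X n) / 2) * g) • Rplus X n expNegU' expQuarter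

end TrigR

end

open scoped Kronecker

noncomputable section

namespace TrigR

/-! The proof separates matrix identities for `Rplus` from one scalar identity for `g`.

An entry of `Rplus` is a sum of a diagonal, an exchange and an annihilation-creation term, one for
each way of pairing two row and two column indices. Unitarity up to a scalar is checked by weight.
Rows of nonzero weight give blocks of size at most two, as in type A. The weight-zero block needs
the sums of `q^{2k̄}` over `k > i`, which are geometric apart from a defect at the middle of the
tuple. `Datum` records their closed forms, and types B, C, D enter the field computations only
through it. Crossing is entrywise: transposing a factor interchanges exchange with
annihilation-creation.

The Yang–Baxter equation has too many kinds of entries for a direct check, so symmetry is used. Let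
`Y(x, y)` be the difference of the two sides. Unitarity relates `Y` with permuted tensor factors to
`Y` at other parameters, sandwiched between R-matrices; crossing relates `Y` to its transpose in one
factor. The sandwich mixes entries, but modulo `h` every R-matrix is the scalar `(x - 1)^2`. If `Y`
vanishes modulo `h^m` at all generic parameters, then modulo `h^{m+1}` the sandwich only multiplies
by an invertible scalar, and the symmetries act on single entries. Entries outside the support
vanish; the others belong to the 15 perfect matchings of six indices (Brauer diagrams). Symmetry
moves each of them to one of five families (`EntrySet`) that vanish exactly, by computation or by
mirror symmetry. Induction on `m` (`dvd_yb_succ`) gives `Y = 0`.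

The series `g` is built and shown unique by `h`-adic approximation. The same uniqueness argument
evaluates `g(u) g(-u)` (`mul_map_negU`), so that unitarity and crossing acquire scalar 1
(`normalization_eq_one`). In the Yang–Baxter equation the scalars commute out, and `e^{-u}`,
`e^{-v}` are generic in `ℂ((u))((v))`. -/

/-- The data that determine the R-matrix over a field. -/
structure Datum (F : Type*) [Field F] (N : ℕ) where
  q : F
  ξ : F
  ε : F
  η : F
  β : Fin N → F
  q_ne : q ≠ 0
  ξ_ne : ξ ≠ 0
  ε_eq : ε = 1 ∧ η = q⁻¹ ∨ ε = -1 ∧ η = q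
  β_ne : ∀ i, β i ≠ 0
  β_rev : ∀ i, β i.rev = ε / β i
  mid : ∀ i, i = i.rev → β i = 1 ∧ ε = 1 ∧ η = q⁻¹
  sum_gt : ∀ i, (q - q⁻¹) * ∑ k, (if i < k then β k ^ 2 else 0) =
    β i ^ 2 / q - ξ * η + (if i < i.rev then ε * (q - q⁻¹) else 0) +
      (if i = i.rev then 1 - q⁻¹ else 0)
  sum_all : ∀ _ : Fin N, (q - q⁻¹) * ∑ k, β k ^ 2 = (ξ * η)⁻¹ - ξ * η + ε * (q - q⁻¹)

/-! ### The weight-zero block over a field. -/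

namespace Datum

variable {F : Type*} [Field F] {N : ℕ} (d : Datum F N)

/-- Diagonal coefficient. -/
def dg (x : F) (a b : Fin N) : F :=
  d.q⁻¹ * (x - 1) * (x - d.ξ) *
    (if a = b then (if a = a.rev then 1 else d.q) else if b = a.rev then d.q⁻¹ else 1)

/-- Exchange coefficient. -/
def ex (x : F) (a b : Fin N) : F :=
  (x - d.ξ) * (1 - d.q⁻¹ ^ 2) * (if a < b then x else 1)

/-- Annihilation-creation coefficient. -/
def ac (x : F) (b c : Fin N) : F :=
  (1 - d.q⁻¹ ^ 2) * (x - 1) * (d.β b / d.β c) * (if c < b then x else d.ξ)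

/-- The R-matrix. -/
def R (x : F) : Matrix (Fin N × Fin N) (Fin N × Fin N) F :=
  Matrix.of fun a b =>
    (if a.1 = b.1 ∧ a.2 = b.2 then d.dg x a.1 a.2 else 0)
    + (if a.1 = b.2 ∧ a.2 = b.1 then d.ex x a.1 a.2 else 0)
    - (if a.2 = a.1.rev ∧ b.2 = b.1.rev then d.ac x a.2 b.2 else 0)

/-- The scalar in the unitarity relation. -/
def f (x x' : F) : F := (x - d.q⁻¹ ^ 2) * (x - d.ξ) * (x' - d.q⁻¹ ^ 2) * (x' - d.ξ)

theorem R_apply (x : F) (a b c e : Fin N) : d.R x (a, b) (c, e) =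
    (if a = c ∧ b = e then d.dg x a b else 0) + (if a = e ∧ b = c then d.ex x a b else 0)
    - (if b = a.rev ∧ e = c.rev then d.ac x b e else 0) := rfl

/-- Coefficients of the R-matrix on vectors of weight zero. -/
def z (x : F) (e c : Fin N) : F := d.R x (e, e.rev) (c, c.rev)

theorem R_row_rev (x : F) (a c e : Fin N) :
    d.R x (a, a.rev) (c, e) = if e = c.rev then d.z x a c else 0 := by
  simp only [z, R_apply]
  grind [Fin.rev_rev]

/-- Twice truncated sum. -/
theorem sum_two (e c : Fin N) (u v u' v' : F) :
    (d.q - d.q⁻¹) * ∑ k, d.β k ^ 2 * (if e < k then u else v) * (if c < k then u' else v') =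
     v * v' * ((d.q - d.q⁻¹) * ∑ k, d.β k ^ 2)
     + (u - v) * v' * ((d.q - d.q⁻¹) * ∑ k, (if e < k then d.β k ^ 2 else 0))
     + v * (u' - v') * ((d.q - d.q⁻¹) * ∑ k, (if c < k then d.β k ^ 2 else 0))
     + (u - v) * (u' - v') *
        ((d.q - d.q⁻¹) * ∑ k, (if max e c < k then d.β k ^ 2 else 0)) := by
  simp only [Finset.mul_sum, ← Finset.sum_add_distrib]
  refine Finset.sum_congr rfl fun k _ => ?_
  by_cases h1 : e < k <;> by_cases h2 : c < k <;> simp [h1, h2] <;> ring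

/-- As a function of the column index `k`, the last term is `β k` times a step function. A product
of two rows therefore sums to truncated sums of `β k ^ 2`. -/
theorem z_left (x : F) (e k : Fin N) : d.z x e k =
    (if k = e then d.dg x e e.rev else 0) + (if k = e.rev then d.ex x e e.rev else 0)
    - (1 - d.q⁻¹ ^ 2) * (x - 1) / d.β e * d.β k * (if e < k then x else d.ξ) := by
  rw [z, R_apply, ac, d.β_rev, d.β_rev]
  have h1 : (k.rev < e.rev) ↔ e < k := Fin.rev_lt_rev
  have h2 : (e = k ∧ e.rev = k.rev) ↔ k = e := by grind
  have h3 : (e = k.rev ∧ e.rev = k) ↔ k = e.rev := by grind [Fin.rev_rev]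
  have h4 : d.ε ≠ 0 := by rcases d.ε_eq with ⟨h, -⟩ | ⟨h, -⟩ <;> simp [h]
  have := d.β_ne e
  have := d.β_ne k
  simp only [h1, h2, h3, and_self, if_true]
  congr 1
  field_simp

theorem z_right (x : F) (k c : Fin N) : d.z x k.rev c.rev =
    (if k = c then d.dg x c c.rev else 0) + (if k = c.rev then d.ex x c c.rev else 0)
    - (1 - d.q⁻¹ ^ 2) * (x - 1) / d.β c * d.β k * (if c < k then x else d.ξ) := by
  rw [z, R_apply, ac, dg, dg, ex, ex]
  simp only [Fin.rev_rev]
  have h1 : ∀ a b : Fin N, (a.rev = b) ↔ a = b.rev := by grind [Fin.rev_rev]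
  have h3 : (k = c.rev ∧ k.rev = c) ↔ k = c.rev := by grind [Fin.rev_rev]
  by_cases hk : k = c
  · subst hk; simp; grind
  · by_cases hk2 : k = c.rev
    · subst hk2; simp [hk]; grind
    · simp [hk, hk2, h1]; grind

theorem z_rev (x : F) (k c : Fin N) : d.z x k.rev c.rev = d.z x c k := by
  rw [z_right, z_left]

end Datum

namespace Datum
variable {F : Type*} [Field F] {N : ℕ} (d : Datum F N)

theorem sum_ite_mul_ite (e e' c c' : Fin N) (A B A' B' : F) (g g' : Fin N → F) :
    ∑ k, ((if k = e then A else 0) + (if k = e' then B else 0) - g k) *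
      ((if k = c then A' else 0) + (if k = c' then B' else 0) - g' k) =
    (if e = c then A * A' else 0) + (if e = c' then A * B' else 0)
    + (if e' = c then B * A' else 0) + (if e' = c' then B * B' else 0)
    - A * g' e - B * g' e' - g c * A' - g c' * B' + ∑ k, g k * g' k := by
  have : ∀ k, ((if k = e then A else 0) + (if k = e' then B else 0) - g k) *
      ((if k = c then A' else 0) + (if k = c' then B' else 0) - g' k) =
      (if k = e then A * ((if k = c then A' else 0) + (if k = c' then B' else 0) - g' k) else 0)
      + (if k = e' then B * ((if k = c then A' else 0) + (if k = c' then B' else 0) - g' k) else 0)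
      - (if k = c then g k * A' else 0) - (if k = c' then g k * B' else 0) + g k * g' k := by
    intro k; split_ifs <;> ring
  simp only [this, Finset.sum_add_distrib, Finset.sum_sub_distrib, Finset.sum_ite_eq',
    Finset.mem_univ, if_true]
  split_ifs <;> ring

/-- Only one term is a genuine sum over `k`: that of `β k ^ 2` times two step functions. `sum_two`
splits it into tails, and `sum_gt`, `sum_all` evaluate these. Comparisons with mirror indices become
arithmetic of values, ready for case splits around the middle. -/
theorem sum_z_mul_z_eq {x : F} (hx0 : x ≠ 0) (e c : Fin N) :
    ∑ k, d.z x e k * d.z x⁻¹ c k =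
    (if e = c then d.dg x e e.rev * d.dg x⁻¹ c c.rev else 0) +
    (if e.val + c.val + 1 = N then d.dg x e e.rev * d.ex x⁻¹ c c.rev else 0) +
    (if e.val + c.val + 1 = N then d.ex x e e.rev * d.dg x⁻¹ c c.rev else 0) +
    (if e = c then d.ex x e e.rev * d.ex x⁻¹ c c.rev else 0) -
    d.dg x e e.rev * ((1 - d.q⁻¹ ^ 2) * (x⁻¹ - 1) / d.β c * d.β e * if c < e then x⁻¹ else d.ξ) -
    d.ex x e e.rev * ((1 - d.q⁻¹ ^ 2) * (x⁻¹ - 1) / d.β c * (d.ε / d.β e) *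
      if e.val + c.val + 1 < N then x⁻¹ else d.ξ) -
    (1 - d.q⁻¹ ^ 2) * (x - 1) / d.β e * d.β c * (if e < c then x else d.ξ) * d.dg x⁻¹ c c.rev -
    (1 - d.q⁻¹ ^ 2) * (x - 1) / d.β e * (d.ε / d.β c) *
      (if e.val + c.val + 1 < N then x else d.ξ) * d.ex x⁻¹ c c.rev +
    d.q⁻¹ * (1 - d.q⁻¹ ^ 2) * (x - 1) * (x⁻¹ - 1) / (d.β e * d.β c) *
    (d.ξ * d.ξ * ((d.ξ * d.η)⁻¹ - d.ξ * d.η + d.ε * (d.q - d.q⁻¹)) +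
     (x - d.ξ) * d.ξ * (d.β e ^ 2 / d.q - d.ξ * d.η +
        (if e.val + e.val + 1 < N then d.ε * (d.q - d.q⁻¹) else 0) +
        (if e.val + e.val + 1 = N then 1 - d.q⁻¹ else 0)) +
     d.ξ * (x⁻¹ - d.ξ) * (d.β c ^ 2 / d.q - d.ξ * d.η +
        (if c.val + c.val + 1 < N then d.ε * (d.q - d.q⁻¹) else 0) +
        (if c.val + c.val + 1 = N then 1 - d.q⁻¹ else 0)) +
     (x - d.ξ) * (x⁻¹ - d.ξ) * (d.β (max e c) ^ 2 / d.q - d.ξ * d.η +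
        (if (max e c).val + (max e c).val + 1 < N then d.ε * (d.q - d.q⁻¹) else 0) +
        (if (max e c).val + (max e c).val + 1 = N then 1 - d.q⁻¹ else 0))) := by
  simp only [z_left]
  rw [sum_ite_mul_ite]
  have hs := d.sum_two e c x d.ξ x⁻¹ d.ξ
  rw [d.sum_all e, d.sum_gt, d.sum_gt, d.sum_gt] at hs
  have hs' : ∑ k, (1 - d.q⁻¹ ^ 2) * (x - 1) / d.β e * d.β k * (if e < k then x else d.ξ) *
      ((1 - d.q⁻¹ ^ 2) * (x⁻¹ - 1) / d.β c * d.β k * (if c < k then x⁻¹ else d.ξ)) =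
      d.q⁻¹ * (1 - d.q⁻¹ ^ 2) * (x - 1) * (x⁻¹ - 1) / (d.β e * d.β c) *
      ((d.q - d.q⁻¹) * ∑ k, d.β k ^ 2 * (if e < k then x else d.ξ) *
        (if c < k then x⁻¹ else d.ξ)) := by
    have hq := d.q_ne
    have h1 := d.β_ne e
    have h2 := d.β_ne c
    simp only [Finset.mul_sum]
    refine Finset.sum_congr rfl fun k _ => ?_
    field_simp
  have l1 : ∀ e c : Fin N, (e < c.rev) ↔ e.val + c.val + 1 < N := by
    intro e c; simp only [Fin.lt_def, Fin.val_rev]; omega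
  have l2 : ∀ e c : Fin N, (e = c.rev) ↔ e.val + c.val + 1 = N := by
    intro e c; simp only [Fin.ext_iff, Fin.val_rev]; omega
  have l3 : (e.rev = c) ↔ e.val + c.val + 1 = N := by
    simp only [Fin.ext_iff, Fin.val_rev]; omega
  have l4 : c.val + e.val + 1 = e.val + c.val + 1 := by omega
  rw [hs', hs, d.β_rev e, d.β_rev c]
  simp only [Fin.rev_inj]
  simp only [l1, l2, l3, l4]

theorem sum_z_mul_z_self {x : F} (hx0 : x ≠ 0) (e : Fin N) :
    ∑ k, d.z x e k * d.z x⁻¹ e k = d.f x x⁻¹ := by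
  have hq := d.q_ne
  have hξ := d.ξ_ne
  have h1 := d.β_ne e
  have l2 : (e = e.rev) ↔ e.val + e.val + 1 = N := by
    simp only [Fin.ext_iff, Fin.val_rev]; omega
  have l3 : (e < e.rev) ↔ e.val + e.val + 1 < N := by
    simp only [Fin.lt_def, Fin.val_rev]; omega
  rw [sum_z_mul_z_eq d hx0]
  simp only [dg, ex, f, l2, l3, max_self, lt_irrefl, if_true, if_false]
  -- The index lies before, at or after the middle; at the middle `mid` fixes `β`, `ε` and `η`.
  rcases lt_trichotomy (e.val + e.val + 1) N with h | h | h
  · simp only [h, h.ne, if_true, if_false]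
    rcases d.ε_eq with ⟨he, hη⟩ | ⟨he, hη⟩ <;> rw [he, hη] <;> field_simp <;> ring
  · obtain ⟨hb, he, hη⟩ := d.mid e (l2.2 h)
    simp only [h, lt_irrefl, if_true, if_false]
    rw [hb, he, hη]; field_simp; ring
  · simp only [h.ne', h.not_gt, if_false]
    rcases d.ε_eq with ⟨he, hη⟩ | ⟨he, hη⟩ <;> rw [he, hη] <;> field_simp <;> ring

theorem sum_z_mul_z_of_lt {x : F} (hx0 : x ≠ 0) {e c : Fin N} (hec : e < c) :
    ∑ k, d.z x e k * d.z x⁻¹ c k = 0 := by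
  have hq := d.q_ne
  have hξ := d.ξ_ne
  have h1 := d.β_ne e
  have h2 := d.β_ne c
  have l1 : ∀ e : Fin N, (e = e.rev) ↔ e.val + e.val + 1 = N := by
    intro e; simp only [Fin.ext_iff, Fin.val_rev]; omega
  have l3 : ∀ e : Fin N, (e < e.rev) ↔ e.val + e.val + 1 < N := by
    intro e; simp only [Fin.lt_def, Fin.val_rev]; omega
  have hv : e.val < c.val := hec
  rw [sum_z_mul_z_eq d hx0, max_eq_right hec.le]
  simp only [dg, ex, l1, l3, hec, hec.ne, hec.not_gt, if_true, if_false]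
  rcases lt_trichotomy (e.val + e.val + 1) N with h | h | h
  · rcases lt_trichotomy (e.val + c.val + 1) N with h' | h' | h'
    · rcases lt_trichotomy (c.val + c.val + 1) N with h'' | h'' | h''
      · simp only [h, h.ne, h', h'.ne, h'', h''.ne, if_true, if_false]
        rcases d.ε_eq with ⟨he, hη⟩ | ⟨he, hη⟩ <;> rw [he, hη] <;> field_simp <;> ring
      · obtain ⟨hb, he, hη⟩ := d.mid c ((l1 c).2 h'')
        simp only [h, h.ne, h', h'.ne, h'', lt_irrefl, if_true, if_false]
        rw [hb, he, hη]; field_simp; ring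
      · simp only [h, h.ne, h', h'.ne, h''.not_gt, h''.ne', if_true, if_false]
        rcases d.ε_eq with ⟨he, hη⟩ | ⟨he, hη⟩ <;> rw [he, hη] <;> field_simp <;> ring
    -- Here `c` is the mirror of `e`: the products of a diagonal and an exchange term survive, and
    -- `β c = ε / β e`.
    · have h'' : N < c.val + c.val + 1 := by omega
      have hc : d.β c = d.ε / d.β e := by
        rw [← d.β_rev, show c = e.rev from Fin.ext (by rw [Fin.val_rev]; omega)]
      simp only [h, h.ne, h', lt_irrefl, h''.not_gt, h''.ne', if_true, if_false]
      rcases d.ε_eq with ⟨he, hη⟩ | ⟨he, hη⟩ <;> rw [hc, he, hη] <;> field_simp <;> ring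
    · have h'' : N < c.val + c.val + 1 := by omega
      simp only [h, h.ne, h'.not_gt, h'.ne', h''.not_gt, h''.ne', if_true, if_false]
      rcases d.ε_eq with ⟨he, hη⟩ | ⟨he, hη⟩ <;> rw [he, hη] <;> field_simp <;> ring
  · have h' : N < e.val + c.val + 1 := by omega
    have h'' : N < c.val + c.val + 1 := by omega
    obtain ⟨hb, he, hη⟩ := d.mid e ((l1 e).2 h)
    simp only [h, lt_irrefl, h'.not_gt, h'.ne', h''.not_gt, h''.ne', if_true, if_false]
    rw [hb, he, hη]; field_simp; ring
  · have h' : N < e.val + c.val + 1 := by omega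
    have h'' : N < c.val + c.val + 1 := by omega
    simp only [h.not_gt, h.ne', h'.not_gt, h'.ne', h''.not_gt, h''.ne', if_false]
    rcases d.ε_eq with ⟨he, hη⟩ | ⟨he, hη⟩ <;> rw [he, hη] <;> field_simp <;> ring

theorem sum_z_mul_z {x : F} (hx : x ≠ 0) (e c : Fin N) :
    ∑ k, d.z x e k * d.z x⁻¹ c k = if e = c then d.f x x⁻¹ else 0 := by
  rcases lt_trichotomy e c with h | rfl | h
  · rw [d.sum_z_mul_z_of_lt hx h, if_neg h.ne]
  · rw [d.sum_z_mul_z_self hx, if_pos rfl]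
  -- The sum is symmetric under exchanging the two rows together with `x ↔ x⁻¹`.
  · rw [if_neg h.ne', ← d.sum_z_mul_z_of_lt (inv_ne_zero hx) h, inv_inv]
    exact Finset.sum_congr rfl fun k _ => mul_comm _ _

end Datum

/-! ### Unitarity and crossing symmetry over a field. -/

namespace Datum
variable {F : Type*} [Field F] {N : ℕ} (d : Datum F N)

/-- Diagonal coefficient on a pair of indices that are not mirror images. -/
def vp (x : F) (a b : Fin N) : F :=
  (x - d.ξ) * if a = b then x - d.q⁻¹ ^ 2 else d.q⁻¹ * (x - 1)

/-- Exchange coefficient on a pair of indices that are not mirror images. -/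
def vs (x : F) (a b : Fin N) : F :=
  (x - d.ξ) * if a = b then 0 else (1 - d.q⁻¹ ^ 2) * if a < b then x else 1

/-- Off the mirror pairs there is no annihilation-creation term. For `a = b` the diagonal and
exchange entries fall on the same place; `vp` then absorbs both and `vs` is zero. -/
theorem R_row {x : F} {a b : Fin N} (h : b ≠ a.rev) (c e : Fin N) :
    d.R x (a, b) (c, e) =
      (if c = a ∧ e = b then d.vp x a b else 0) + (if c = b ∧ e = a then d.vs x a b else 0) := by
  have hq := d.q_ne
  rw [R_apply, vp, vs, dg, ex]
  by_cases hab : a = b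
  · subst hab
    by_cases hc : a = c ∧ a = e
    · obtain ⟨rfl, rfl⟩ := hc
      simp only [and_self, if_true, h, if_false, lt_irrefl]
      field_simp
      ring
    · have h1 : ¬ (c = a ∧ e = a) := fun h => hc ⟨h.1.symm, h.2.symm⟩
      have h2 : ¬ (a = e ∧ a = c) := fun h => hc ⟨h.2, h.1⟩
      simp only [h1, h2, hc, if_false, h, false_and]
      simp
  · have h1 : (a = c ∧ b = e) ↔ (c = a ∧ e = b) := by grind
    have h2 : (a = e ∧ b = c) ↔ (c = b ∧ e = a) := by grind
    simp only [h1, h2, hab, h, if_false, false_and]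
    split_ifs <;> ring

theorem R_col {x : F} {c e : Fin N} (h : e ≠ c.rev) (a b : Fin N) :
    d.R x (a, b) (c, e) =
      (if a = c ∧ b = e then d.vp x c e else 0) + (if a = e ∧ b = c then d.vs x e c else 0) := by
  by_cases hb : b = a.rev
  · subst hb
    have h1 : ¬ (a = c ∧ a.rev = e) := by grind
    have h2 : ¬ (a = e ∧ a.rev = c) := by grind [Fin.rev_rev]
    rw [R_row_rev, if_neg h, if_neg h1, if_neg h2, add_zero]
  · rw [d.R_row hb]
    grind

theorem sum_R_mul {x : F} {a b : Fin N} (h : b ≠ a.rev) (G : Fin N → Fin N → F) :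
    ∑ k, ∑ l, d.R x (a, b) (k, l) * G k l = d.vp x a b * G a b + d.vs x a b * G b a := by
  simp only [d.R_row h, ite_and, add_mul, ite_mul, zero_mul, Finset.sum_add_distrib,
    Finset.sum_ite_eq', Finset.sum_ite_irrel, Finset.sum_const_zero, Finset.mem_univ, if_true]

/-- Weight zero rows form the block treated in `sum_z_mul_z`, after `z_rev` undoes the swap. Every
other row involves only `(a, b)` and `(b, a)`. -/
theorem R_mul_R_swap {x : F} (hx : x ≠ 0) :
    d.R x * (d.R x⁻¹).submatrix Prod.swap Prod.swap = d.f x x⁻¹ • 1 := by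
  have hq := d.q_ne
  have hξ := d.ξ_ne
  ext ⟨a, b⟩ ⟨c, e⟩
  rw [Matrix.mul_apply, Fintype.sum_prod_type]
  simp only [Matrix.submatrix_apply, Prod.swap_prod_mk, Matrix.smul_apply, smul_eq_mul,
    Matrix.one_apply, Prod.mk.injEq]
  by_cases hb : b = a.rev
  · subst hb
    simp only [R_row_rev, ite_mul, zero_mul, Finset.sum_ite_eq', Finset.mem_univ, if_true]
    have h : ∀ k : Fin N, d.R x⁻¹ (k.rev, k) (e, c) =
        if e = c.rev then d.z x⁻¹ c k else 0 := by
      intro k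
      have h1 := d.R_row_rev x⁻¹ k.rev e c
      rw [Fin.rev_rev] at h1
      rw [h1]
      by_cases he : e = c.rev
      · subst he; simp [z_rev]
      · rw [if_neg he, if_neg]; rintro rfl; simp at he
    simp only [h, mul_ite, mul_zero]
    by_cases he : e = c.rev
    · subst he
      simp only [if_true, d.sum_z_mul_z hx]
      by_cases hac : a = c
      · subst hac; simp
      · simp [hac]
    · simp only [he, if_false, Finset.sum_const_zero]
      rw [if_neg]
      rintro ⟨rfl, rfl⟩
      exact he rfl
  · have hb' : a ≠ b.rev := fun h => hb (by rw [h, Fin.rev_rev])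
    rw [d.sum_R_mul hb (fun k l => d.R x⁻¹ (l, k) (e, c)), d.R_row hb, d.R_row hb']
    by_cases hab : a = b
    · subst hab
      simp only [vp, vs, f, if_true, mul_zero, zero_mul, add_zero, ite_self]
      by_cases hc : e = a ∧ c = a
      · obtain ⟨rfl, rfl⟩ := hc
        simp; ring
      · have h2 : ¬ (a = c ∧ a = e) := fun h => hc ⟨h.2.symm, h.1.symm⟩
        simp [hc, h2]
    · have hba : ¬ b = a := fun h => hab h.symm
      have h1 : (e = b ∧ c = a) ↔ (a = c ∧ b = e) := by grind
      have h3 : (e = a ∧ c = b) ↔ (b = c ∧ a = e) := by grind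
      simp only [h1, h3, vp, vs, f, hab, hba, if_false]
      by_cases hc : a = c ∧ b = e
      · have h2 : ¬ (b = c ∧ a = e) := fun h => hab (by rw [hc.1, h.1])
        obtain ⟨rfl, rfl⟩ := hc
        simp only [h2, and_self, if_true, if_false]
        rcases lt_or_gt_of_ne hab with h | h <;> simp only [h, h.not_gt, if_true, if_false] <;>
          field_simp <;> ring
      · simp only [hc, if_false]
        rcases lt_or_gt_of_ne hab with h | h <;> simp only [h, h.not_gt, if_true, if_false] <;>
          split_ifs <;> field_simp <;> ring

/-- Transposition preserves the diagonal pairing and interchanges exchange with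
annihilation-creation, while `(x - 1)(x - ξ)` is invariant under `x ↦ ξ / x` up to `x ^ 2 / ξ`. The
coefficients `q` at equal indices and `q⁻¹` at mirror indices do not match by themselves; the other
two terms, which meet the diagonal exactly there, make up the difference. -/
theorem R_cross {x : F} (hx : x ≠ 0) (a b c e : Fin N) :
    d.β a / d.β c * d.R x (c.rev, b) (a.rev, e) = x ^ 2 / d.ξ * d.R (d.ξ / x) (b, a) (e, c) := by
  have hq := d.q_ne
  have hξ := d.ξ_ne
  have h1 := d.β_ne a
  have h2 := d.β_ne c
  have hr := d.β_rev a
  have hr' := d.β_rev c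
  have h0 : d.ε ≠ 0 := by rcases d.ε_eq with ⟨h, -⟩ | ⟨h, -⟩ <;> simp [h]
  have i1 : (c.rev = a.rev ∧ b = e) ↔ (a = c ∧ b = e) := by grind [Fin.rev_rev]
  have i1' : (b = e ∧ a = c) ↔ (a = c ∧ b = e) := by grind [Fin.rev_rev]
  have i2 : (c.rev = e ∧ b = a.rev) ↔ (b = a.rev ∧ e = c.rev) := by grind [Fin.rev_rev]
  have i2' : (a = b.rev ∧ c = e.rev) ↔ (b = a.rev ∧ e = c.rev) := by grind [Fin.rev_rev]
  have i3 : (b = c.rev.rev ∧ e = a.rev.rev) ↔ (b = c ∧ e = a) := by grind [Fin.rev_rev]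
  have i3' : (b = c ∧ a = e) ↔ (b = c ∧ e = a) := by grind [Fin.rev_rev]
  rw [R_apply, R_apply, dg, dg, ex, ex, ac, ac]
  simp only [i1, i1', i2, i2', i3, i3']
  by_cases j1 : a = c ∧ b = e <;> by_cases j2 : b = a.rev ∧ e = c.rev <;>
    by_cases j3 : b = c ∧ e = a
  · obtain ⟨rfl, rfl⟩ := j1
    obtain ⟨rfl, -⟩ := j3
    have hb := j2.1
    obtain ⟨hβ, -, -⟩ := d.mid b hb
    simp only [← hb, hβ, lt_irrefl, and_self, if_true, if_false]
    field_simp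
    ring
  · obtain ⟨rfl, rfl⟩ := j1
    obtain ⟨rfl, -⟩ := j2
    have hn : ¬ a.rev = a := fun h => j3 ⟨h, h⟩
    have hn' : ¬ a = a.rev := fun h => hn h.symm
    simp only [Fin.rev_rev, hn, lt_irrefl, and_self, if_true, if_false]
    field_simp
    ring
  · obtain ⟨rfl, rfl⟩ := j1
    obtain ⟨rfl, -⟩ := j3
    have hn' : ¬ b = b.rev := fun h => j2 ⟨h, h⟩
    have hn : ¬ b.rev = b := fun h => hn' h.symm
    simp only [Fin.rev_rev, hn, hn', lt_irrefl, and_self, if_true, if_false]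
    field_simp
    ring
  · obtain ⟨rfl, rfl⟩ := j1
    have hn' : ¬ b = a := fun h => j3 ⟨h, h⟩
    have hn : ¬ b = a.rev := fun h => j2 ⟨h, h⟩
    have hm : ¬ a.rev = b := fun h => hn h.symm
    have hm' : ¬ a = b.rev := fun h => hn (by rw [h, Fin.rev_rev])
    simp only [j2, Fin.rev_rev, hn', hm, hm', and_self, if_true, if_false]
    field_simp
    ring
  · obtain ⟨rfl, rfl⟩ := j3
    obtain ⟨hb, -⟩ := j2
    have hn : ¬ b = e := fun h => j1 ⟨h.symm, h⟩
    subst hb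
    have hn' : ¬ e = e.rev := fun h => hn h.symm
    simp only [j1, Fin.rev_rev, hr, and_self, if_true, if_false]
    rcases lt_or_gt_of_ne hn with h | h <;> simp only [h, h.not_gt, if_true, if_false] <;>
      rcases d.ε_eq with ⟨he, -⟩ | ⟨he, -⟩ <;> rw [he] <;> field_simp <;> ring
  · obtain ⟨rfl, rfl⟩ := j2
    have hn : ¬ a = c := fun h => j1 ⟨h, by rw [h]⟩
    simp only [j1, j3, hr, hr', Fin.rev_lt_rev, and_self, if_true, if_false]
    rcases lt_or_gt_of_ne hn with h | h <;> simp only [h, h.not_gt, if_true, if_false] <;>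
      field_simp <;> ring
  · obtain ⟨rfl, rfl⟩ := j3
    have hn : ¬ e = b := fun h => j1 ⟨h, h.symm⟩
    simp only [j1, j2, and_self, if_true, if_false]
    rcases lt_or_gt_of_ne hn with h | h <;> simp only [h, h.not_gt, if_true, if_false] <;>
      field_simp <;> ring
  · simp [j1, j2, j3]

end Datum

/-! ### Yang–Baxter entries that are verified directly. -/

/-- Matrix entries of `A₁₂ B₁₃ C₂₃`. -/
def tripleL {S : Type*} [CommRing S] {N : ℕ} (A B C : End2 N S) (a b c d e f : Fin N) : S :=
  ∑ k, ∑ l, ∑ m, A (a, b) (k, l) * B (k, c) (d, m) * C (l, m) (e, f)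

/-- Matrix entries of `C₂₃ B₁₃ A₁₂`. -/
def tripleR {S : Type*} [CommRing S] {N : ℕ} (A B C : End2 N S) (a b c d e f : Fin N) : S :=
  ∑ k, ∑ l, ∑ m, C (b, c) (l, m) * B (a, m) (k, f) * A (k, l) (d, e)

namespace Datum
variable {F : Type*} [Field F] {N : ℕ} (d : Datum F N)

theorem R_col' {x : F} {c e : Fin N} (h : e ≠ c.rev) (a b : Fin N) :
    d.R x (a, b) (c, e) =
      (if a = c then 1 else 0) * (if b = e then 1 else 0) * d.vp x c e +
      (if a = e then 1 else 0) * (if b = c then 1 else 0) * d.vs x e c := by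
  rw [d.R_col h]
  simp only [ite_and]
  split_ifs <;> ring

theorem sum_mul_R {x : F} {c e : Fin N} (h : e ≠ c.rev) (G : Fin N → Fin N → F) :
    ∑ k, ∑ l, G k l * d.R x (k, l) (c, e) = G c e * d.vp x c e + G e c * d.vs x e c := by
  simp only [d.R_col h, ite_and, mul_add, mul_ite, mul_zero, Finset.sum_add_distrib,
    Finset.sum_ite_eq', Finset.sum_ite_irrel, Finset.sum_const_zero, Finset.mem_univ, if_true]

theorem sum_mul_R_left {x : F} {c e : Fin N} (h : e ≠ c.rev) (b : Fin N) (G : Fin N → F) :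
    ∑ k, G k * d.R x (k, b) (c, e) =
      (if b = e then 1 else 0) * G c * d.vp x c e + (if b = c then 1 else 0) * G e * d.vs x e c := by
  simp only [d.R_col' h, mul_add, Finset.sum_add_distrib]
  congr 1
  · rw [Finset.sum_eq_single c] <;> simp +contextual [mul_comm]
  · rw [Finset.sum_eq_single e] <;> simp +contextual [mul_comm]

theorem sum_mul_R_right {x : F} {c e : Fin N} (h : e ≠ c.rev) (a : Fin N) (G : Fin N → F) :
    ∑ k, G k * d.R x (a, k) (c, e) =
      (if a = c then 1 else 0) * G e * d.vp x c e + (if a = e then 1 else 0) * G c * d.vs x e c := by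
  simp only [d.R_col' h, mul_add, Finset.sum_add_distrib]
  congr 1
  · rw [Finset.sum_eq_single e] <;> simp +contextual [mul_comm]
  · rw [Finset.sum_eq_single c] <;> simp +contextual [mul_comm]

/-- If the column of the rightmost factor is not a mirror pair, that factor contributes two terms,
which collapses two of the three summations. -/
theorem tripleL_eq {x w y : F} {p s r : Fin N} (h : r ≠ s.rev) (a b c : Fin N) :
    tripleL (d.R x) (d.R w) (d.R y) a b c p s r =
      (∑ k, d.R x (a, b) (k, s) * d.R w (k, c) (p, r)) * d.vp y s r +
      (∑ k, d.R x (a, b) (k, r) * d.R w (k, c) (p, s)) * d.vs y r s := by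
  simp only [tripleL, Finset.sum_mul, ← Finset.sum_add_distrib]
  exact Finset.sum_congr rfl fun k _ =>
    d.sum_mul_R h fun l m => d.R x (a, b) (k, l) * d.R w (k, c) (p, m)

theorem tripleR_eq {x w y : F} {p s r : Fin N} (h : s ≠ p.rev) (a b c : Fin N) :
    tripleR (d.R x) (d.R w) (d.R y) a b c p s r =
      (∑ m, d.R y (b, c) (s, m) * d.R w (a, m) (p, r)) * d.vp x p s +
      (∑ m, d.R y (b, c) (p, m) * d.R w (a, m) (s, r)) * d.vs x s p := by
  simp only [tripleR, Finset.sum_mul, ← Finset.sum_add_distrib]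
  rw [Finset.sum_congr rfl fun k _ => Finset.sum_comm, Finset.sum_comm]
  exact Finset.sum_congr rfl fun m _ =>
    d.sum_mul_R h fun k l => d.R y (b, c) (l, m) * d.R w (a, m) (k, r)

/-- Without mirror pairs among the columns all factors act by permuting them, as in type A up to the
scalar `x - ξ`. The coefficients depend only on the relative order of `p`, `s`, `r`. -/
theorem triple_of_no_pair (x y : F) {p s r : Fin N} (h1 : s ≠ p.rev) (h2 : r ≠ p.rev)
    (h3 : r ≠ s.rev) (a b c : Fin N) :
    tripleL (d.R x) (d.R (x * y)) (d.R y) a b c p s r =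
      tripleR (d.R x) (d.R (x * y)) (d.R y) a b c p s r := by
  have h1' : p ≠ s.rev := fun h => h1 (by rw [h, Fin.rev_rev])
  have h3' : s ≠ r.rev := fun h => h3 (by rw [h, Fin.rev_rev])
  rw [d.tripleL_eq h3, d.tripleR_eq h1, d.sum_mul_R_left h2, d.sum_mul_R_left h1, d.sum_mul_R_right h2,
    d.sum_mul_R_right h3]
  simp only [d.R_col' h1, d.R_col' h2, d.R_col' h3, d.R_col' h1', d.R_col' h3']
  have tri : ∀ u v : Fin N, (u < v ∧ ¬ v < u ∧ ¬ u = v ∧ ¬ v = u) ∨ u = v ∨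
      (v < u ∧ ¬ u < v ∧ ¬ u = v ∧ ¬ v = u) := fun u v => by
    rcases lt_trichotomy u v with h | h | h
    · exact Or.inl ⟨h, h.not_gt, h.ne, h.ne'⟩
    · exact Or.inr (Or.inl h)
    · exact Or.inr (Or.inr ⟨h, h.not_gt, h.ne', h.ne⟩)
  have t1 := tri p s
  have t2 := tri s r
  have t3 := tri p r
  clear tri h1 h2 h3 h1' h3'
  rcases t1 with t1 | rfl | t1 <;> rcases t2 with t2 | rfl | t2 <;>
    rcases t3 with t3 | t3 | t3 <;> (try subst t3) <;> first
    | (exfalso; omega)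
    | (simp only [vp, vs, lt_irrefl, if_true, if_false, *]
       ring)

end Datum

namespace Datum
variable {F : Type*} [Field F] {N : ℕ} (d : Datum F N)

theorem R_col_rev (x : F) (a b c : Fin N) :
    d.R x (a, b) (c, c.rev) = if b = a.rev then d.z x a c else 0 := by
  simp only [z, R_apply]
  grind [Fin.rev_rev]

theorem sum_mul_R_col_rev_left (x : F) (b c : Fin N) (G : Fin N → F) :
    ∑ k, G k * d.R x (k, b) (c, c.rev) = G b.rev * d.z x b.rev c := by
  simp only [R_col_rev]
  rw [Finset.sum_eq_single b.rev]
  · simp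
  · intro k _ hk
    rw [if_neg, mul_zero]
    rintro rfl
    simp at hk
  · simp

theorem sum_mul_R_col_rev_right (x : F) (a c : Fin N) (G : Fin N → F) :
    ∑ k, G k * d.R x (a, k) (c, c.rev) = G a.rev * d.z x a c := by
  simp only [R_col_rev]
  rw [Finset.sum_eq_single a.rev]
  · simp
  · intro k _ hk
    rw [if_neg hk, mul_zero]
  · simp

theorem vp_of_ne (x : F) {a b : Fin N} (h : a ≠ b) :
    d.vp x a b = (x - d.ξ) * (d.q⁻¹ * (x - 1)) := by
  rw [vp, if_neg h]

theorem vs_of_ne (x : F) {a b : Fin N} (h : a ≠ b) :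
    d.vs x a b = (x - d.ξ) * ((1 - d.q⁻¹ ^ 2) * if a < b then x else 1) := by
  rw [vs, if_neg h]

theorem triple_flip_fix_flip (x y : F) {a b : Fin N} (h1 : b ≠ a) (h2 : b ≠ a.rev) :
    tripleL (d.R x) (d.R (x * y)) (d.R y) a.rev b a a b a.rev =
      tripleR (d.R x) (d.R (x * y)) (d.R y) a.rev b a a b a.rev := by
  have h3 : a.rev ≠ b.rev := fun h => h1 (Fin.rev_injective h.symm)
  have h4 : b ≠ a.rev.rev := by simpa using h1
  have h5 : a ≠ b.rev := fun h => h2 (by rw [h, Fin.rev_rev])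
  rw [d.tripleL_eq h3, d.tripleR_eq h2, sum_mul_R_col_rev_left, sum_mul_R_col_rev_right,
    d.sum_mul_R_left h2, d.sum_mul_R_right h3]
  simp only [d.R_row h4, d.R_row h5, Fin.rev_rev]
  simp only [h1, h1.symm, h2, h2.symm, if_true, if_false, and_self, false_and, and_false]
  simp only [d.vp_of_ne _ h2, d.vp_of_ne _ h2.symm, d.vp_of_ne _ h1, d.vp_of_ne _ h1.symm,
    d.vs_of_ne _ h2.symm, d.vs_of_ne _ h1]
  split_ifs <;> ring

/-- The intermediate states on both sides are finitely many even though a mirror pair occurs, so no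
sum over all indices remains. What is left depends on the positions of `b` relative to `a` and
`a.rev`, and of `a` relative to the middle. -/
theorem triple_flip_rotate (x y : F) {a b : Fin N} (h1 : b ≠ a) (h2 : b ≠ a.rev) :
    tripleL (d.R x) (d.R (x * y)) (d.R y) a.rev a b a b a.rev =
      tripleR (d.R x) (d.R (x * y)) (d.R y) a.rev a b a b a.rev := by
  have h3 : a.rev ≠ b.rev := fun h => h1 (Fin.rev_injective h.symm)
  have h4 : b ≠ a.rev.rev := by simpa using h1
  have h5 : a ≠ b.rev := fun h => h2 (by rw [h, Fin.rev_rev])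
  have h2' := h2
  rw [d.tripleL_eq h3, d.tripleR_eq h2, sum_mul_R_col_rev_left, sum_mul_R_col_rev_right,
    d.sum_mul_R_left h2, d.sum_mul_R_right h3, Fin.rev_rev]
  have e1 : d.R x (a.rev, a) (b.rev, b) = d.z x a.rev b.rev := by rw [z]; simp
  have e2 : d.R x (a.rev, a) (a, a.rev) = d.z x a.rev a := by rw [z]; simp
  have e3 : b.rev < a ↔ a.rev < b := by simp only [Fin.lt_def, Fin.val_rev]; omega
  rw [e1, e2, z_rev, z_left, z_left, z_left, z_left]
  simp only [d.R_row h2', Fin.rev_rev]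
  simp only [h1, h1.symm, h2.symm, h5, e3, if_true, if_false, and_self, false_and, and_false]
  simp only [d.vp_of_ne _ h2, d.vp_of_ne _ h1.symm, d.vs_of_ne _ h2.symm, d.vs_of_ne _ h1,
    d.vs_of_ne _ h1.symm, d.β_rev, dg, ex]
  have hq := d.q_ne
  have hξ := d.ξ_ne
  have hβ := d.β_ne a
  have hβ' := d.β_ne b
  rcases lt_or_gt_of_ne h1 with g1 | g1 <;> rcases lt_or_gt_of_ne h2 with g2 | g2 <;>
    rcases lt_trichotomy a a.rev with g3 | g3 | g3 <;> first
    | (exfalso; simp only [Fin.lt_def, Fin.ext_iff, Fin.val_rev] at g1 g2 g3; omega)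
    | (simp only [g1, g2, g3, g1.not_gt, g2.not_gt, g3.not_gt, g3.ne, g3.ne', if_true, if_false]
       rcases d.ε_eq with ⟨he, -⟩ | ⟨he, -⟩ <;> rw [he] <;> field_simp <;> ring)
    | (obtain ⟨hb, he, -⟩ := d.mid a g3
       simp only [← g3, g1, g1.not_gt, lt_irrefl, hb, he, if_true, if_false]
       field_simp
       ring)

/-- Mirroring all indices is the same as transposing. It exchanges the two orders of multiplication
and settles the entry with all six indices in the middle. -/
theorem R_rev (x : F) (a b c e : Fin N) :
    d.R x (a.rev, b.rev) (c.rev, e.rev) = d.R x (c, e) (a, b) := by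
  by_cases h : b = a.rev
  · subst h
    rw [R_row_rev, R_col_rev, z_rev]
    simp only [Fin.rev_inj]
  · have h' : b.rev ≠ a.rev.rev := by simpa using fun h' => h (by rw [← h', Fin.rev_rev])
    rw [d.R_row h', d.R_col h]
    simp only [Fin.rev_inj]
    simp only [vp, vs, Fin.rev_inj, Fin.rev_lt_rev]
    grind

theorem tripleR_eq_tripleL (x w y : F) (a b c p s r : Fin N) :
    tripleR (d.R x) (d.R w) (d.R y) a b c p s r =
      tripleL (d.R x) (d.R w) (d.R y) p.rev s.rev r.rev a.rev b.rev c.rev := by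
  rw [tripleR, tripleL, ← Equiv.sum_comp Fin.revPerm]
  refine Finset.sum_congr rfl fun k _ => ?_
  rw [← Equiv.sum_comp Fin.revPerm]
  refine Finset.sum_congr rfl fun l _ => ?_
  rw [← Equiv.sum_comp Fin.revPerm]
  refine Finset.sum_congr rfl fun m _ => ?_
  simp only [Fin.revPerm_apply]
  have e1 := d.R_rev y b.rev c.rev l m
  have e2 := d.R_rev w a.rev m k r.rev
  have e3 := d.R_rev x k l p.rev s.rev
  simp only [Fin.rev_rev] at e1 e2 e3
  rw [e1, e2, e3]
  ring

end Datum

namespace Datum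
variable {F : Type*} [Field F] {N : ℕ} (d : Datum F N)

theorem sum_ite_ite {b c : Fin N} (h : b ≠ c) (s t : F) (G : Fin N → F) :
    ∑ k, (if k = b then s else if k = c then t else G k) = s - G b + (t - G c) + ∑ k, G k := by
  have : ∀ k, (if k = b then s else if k = c then t else G k) =
      (if k = b then s - G b else 0) + (if k = c then t - G c else 0) + G k := by
    intro k
    by_cases h1 : k = b
    · subst h1; simp [h]
    · by_cases h2 : k = c
      · subst h2; simp [h1]
      · simp [h1, h2]
  simp only [this, Finset.sum_add_distrib, Finset.sum_ite_eq', Finset.mem_univ, if_true]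

theorem tripleR_flip (x w y : F) (b : Fin N) :
    tripleR (d.R x) (d.R w) (d.R y) b b b.rev b.rev b b =
      ∑ k, d.z y b k * d.z x b k * d.R w (b, k.rev) (k.rev, b) := by
  have h1 : ∀ k l, d.R x (k, l) (b.rev, b) = if l = k.rev then d.z x b k.rev else 0 := by
    intro k l
    have := d.R_col_rev x k l b.rev
    rw [Fin.rev_rev] at this
    rw [this, ← d.z_rev x k.rev b, Fin.rev_rev]
  rw [tripleR, ← Equiv.sum_comp Fin.revPerm]
  refine Finset.sum_congr rfl fun k _ => ?_
  simp only [Fin.revPerm_apply, R_row_rev, h1, Fin.rev_rev, mul_ite, mul_zero, ite_mul, zero_mul]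
  simp only [Finset.sum_ite_irrel, Finset.sum_const_zero, Finset.sum_ite_eq', Finset.mem_univ,
    if_true]
  ring

/-- This is the one directly checked family in which a sum over all intermediate indices survives;
the tail sums evaluate it, as for unitarity. -/
theorem sum_z_mul_z_mul_R (x y : F) {b : Fin N} (hb : b ≠ b.rev) :
    ∑ k, d.z y b k * d.z x b k * d.R (x * y) (b, k.rev) (k.rev, b) =
      d.vp x b b * d.vp y b b * d.z (x * y) b b.rev := by
  have hq := d.q_ne
  have hξ := d.ξ_ne
  have h1 := d.β_ne b
  -- Away from `b` and its mirror the summand is `β k ^ 2` times two step functions, with jumps at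
  -- `b` and `b.rev`. The two exceptional values are corrections to that formula.
  have key : ∀ k, d.z y b k * d.z x b k * d.R (x * y) (b, k.rev) (k.rev, b) =
      if k = b then d.z y b b * d.z x b b * d.z (x * y) b b.rev else
      if k = b.rev then d.z y b b.rev * d.z x b b.rev * d.vp (x * y) b b else
      (1 - d.q⁻¹ ^ 2) ^ 3 * (x - 1) * (y - 1) * (x * y - d.ξ) / d.β b ^ 2 *
       (d.β k ^ 2 * (if b < k then x * y else d.ξ ^ 2) * (if b.rev < k then 1 else x * y)) := by
    intro k
    by_cases hk : k = b
    · subst hk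
      simp [z]
    · by_cases hk' : k = b.rev
      · subst hk'
        have h2 := d.R_row (x := x * y) hb b b
        simp only [hk, if_false, if_true, Fin.rev_rev, h2, and_self, vs]
        ring
      · have h3 : k.rev ≠ b.rev := by simpa using hk
        have h4 : ¬ b = k.rev := fun h => hk' (by rw [h, Fin.rev_rev])
        have h5 : (b < k.rev) ↔ ¬ b.rev < k := by
          simp only [Fin.lt_def, Fin.ext_iff, Fin.val_rev] at hk' ⊢; omega
        rw [d.R_row h3, z_left, z_left]
        simp only [hk, hk', h4, Ne.symm h4, if_false, and_self, if_true, vs, h5]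
        split_ifs <;> field_simp <;> ring
  simp only [key]
  rw [sum_ite_ite hb, ← Finset.mul_sum]
  have hs := d.sum_two b b.rev (x * y) (d.ξ ^ 2) 1 (x * y)
  rw [d.sum_all b, d.sum_gt, d.sum_gt, d.sum_gt] at hs
  have hs' : ∀ T : F, (1 - d.q⁻¹ ^ 2) ^ 3 * (x - 1) * (y - 1) * (x * y - d.ξ) / d.β b ^ 2 * T =
      d.q⁻¹ * (1 - d.q⁻¹ ^ 2) ^ 2 * (x - 1) * (y - 1) * (x * y - d.ξ) / d.β b ^ 2 *
        ((d.q - d.q⁻¹) * T) := by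
    intro T; field_simp
  rw [hs' (∑ _, _), hs]
  clear hs hs' key
  simp only [z_left, vp, if_true, Fin.rev_rev, hb, hb.symm, if_false, dg, ex, d.β_rev, lt_irrefl]
  rcases lt_or_gt_of_ne hb with h | h
  · rw [max_eq_right h.le]
    simp only [h, h.not_gt, d.β_rev, Fin.rev_rev, hb.symm, if_true, if_false]
    rcases d.ε_eq with ⟨he, hη⟩ | ⟨he, hη⟩ <;> rw [he, hη] <;> field_simp <;> ring
  · rw [max_eq_left h.le]
    simp only [h, h.not_gt, hb, if_true, if_false]
    rcases d.ε_eq with ⟨he, hη⟩ | ⟨he, hη⟩ <;> rw [he, hη] <;> field_simp <;> ring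

theorem triple_flip_fix_flip_self (x y : F) {b : Fin N} (hb : b ≠ b.rev) :
    tripleL (d.R x) (d.R (x * y)) (d.R y) b b b.rev b.rev b b =
      tripleR (d.R x) (d.R (x * y)) (d.R y) b b b.rev b.rev b b := by
  have h1 := d.sum_mul_R_col_rev_left (x * y) b.rev b.rev fun k => d.R x (b, b) (k, b)
  rw [Fin.rev_rev] at h1
  rw [tripleR_flip, d.sum_z_mul_z_mul_R x y hb, d.tripleL_eq hb, h1, d.R_row hb]
  simp [vs]
  ring

end Datum

/-! ### Matrix entries of `P`, `Q` and `R`. -/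

section Entries
variable {S : Type*} [CommRing S] {N : ℕ}

theorem unit2_apply (i j k l a b c e : Fin N) :
    unit2 S i j k l (a, b) (c, e) = if (i = a ∧ j = c) ∧ (k = b ∧ l = e) then 1 else 0 := by
  simp only [unit2, Matrix.kroneckerMap_apply, Matrix.single_apply]
  split_ifs <;> simp_all

theorem sum_diag (g : Fin N → Fin N → S) (a b c e : Fin N) :
    (∑ i, ∑ j, g i j • unit2 S i i j j) (a, b) (c, e) = if a = c ∧ b = e then g a b else 0 := by
  simp only [Matrix.sum_apply, Matrix.smul_apply, unit2_apply, smul_eq_mul]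
  rw [Finset.sum_eq_single a, Finset.sum_eq_single b]
  · simp
  · intro k _ hk; simp [hk]
  · simp
  · intro k _ hk; simp [hk]
  · simp

theorem sum_exch (g : Fin N → Fin N → S) (a b c e : Fin N) :
    (∑ i, ∑ j, g i j • unit2 S i j j i) (a, b) (c, e) = if a = e ∧ b = c then g a b else 0 := by
  simp only [Matrix.sum_apply, Matrix.smul_apply, unit2_apply, smul_eq_mul]
  rw [Finset.sum_eq_single a, Finset.sum_eq_single b]
  · simp only [true_and, mul_ite, mul_one, mul_zero]
    congr 1
    simp only [and_comm]
  · intro k _ hk; simp [hk]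
  · simp
  · intro k _ hk; simp [hk]
  · simp

theorem sum_annih (g : Fin N → Fin N → S) (a b c e : Fin N) :
    (∑ i, ∑ j, g i j • unit2 S i.rev j.rev i j) (a, b) (c, e) =
      if b = a.rev ∧ e = c.rev then g b e else 0 := by
  simp only [Matrix.sum_apply, Matrix.smul_apply, unit2_apply, smul_eq_mul]
  rw [Finset.sum_eq_single b, Finset.sum_eq_single e]
  · have h : (b.rev = a ∧ e.rev = c) ↔ (b = a.rev ∧ e = c.rev) := by grind [Fin.rev_rev]
    simp [h]
  · intro k _ hk; simp [hk]
  · simp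
  · intro k _ hk; simp [hk]
  · simp

theorem sum_equal (g : Fin N → S) (a b c e : Fin N) :
    (∑ i, g i • unit2 S i i i i) (a, b) (c, e) =
      if a = c ∧ b = e then (if a = b then g a else 0) else 0 := by
  simp only [Matrix.sum_apply, Matrix.smul_apply, unit2_apply, smul_eq_mul]
  rw [Finset.sum_eq_single a]
  · grind
  · intro k _ hk; simp [hk]
  · simp

theorem sum_mirror (g : Fin N → S) (a b c e : Fin N) :
    (∑ i, g i • unit2 S i i i.rev i.rev) (a, b) (c, e) =
      if a = c ∧ b = e then (if b = a.rev then g a else 0) else 0 := by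
  simp only [Matrix.sum_apply, Matrix.smul_apply, unit2_apply, smul_eq_mul]
  rw [Finset.sum_eq_single a]
  · grind
  · intro k _ hk; simp [hk]
  · simp

theorem opP_apply (X : LieType) (n : ℕ) (a b c e : Fin (dim X n)) :
    opP X n S (a, b) (c, e) = if a = e ∧ b = c then 1 else 0 := by
  have := sum_exch (fun _ _ => (1 : S)) a b c e
  simpa only [opP, one_smul] using this

theorem opQ_apply (X : LieType) (n : ℕ) (t : Sˣ) (a b c e : Fin (dim X n)) :
    opQ X n t (a, b) (c, e) = if b = a.rev ∧ e = c.rev then wt X n t b e else 0 :=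
  sum_annih _ a b c e

theorem opR_apply (X : LieType) (n : ℕ) (t : Sˣ) (a b c e : Fin (dim X n)) :
    opR X n t (a, b) (c, e) =
      (if a = c ∧ b = e then
        (if a = b then (if a = a.rev then 1 else ((qOf t : Sˣ) : S)) else
          if b = a.rev then ((qOf t)⁻¹ : Sˣ) else 1) else 0)
      + (if a = e ∧ b = c then
          (if a < b then ((qOf t : Sˣ) : S) - ((qOf t)⁻¹ : Sˣ) else 0) else 0)
      - (if b = a.rev ∧ e = c.rev then
          (if e < b then (((qOf t : Sˣ) : S) - ((qOf t)⁻¹ : Sˣ)) * wt X n t b e else 0) else 0) := by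
  have key : ∀ (p : Prop) [Decidable p] (r : S) (M : End2 (dim X n) S),
      (if p then r • M else 0) = (if p then r else 0) • M := by
    intro p _ r M; split_ifs <;> simp
  have key' : ∀ (p : Prop) [Decidable p] (M : End2 (dim X n) S),
      (if p then M else 0) = (if p then (1 : S) else 0) • M := by
    intro p _ M; split_ifs <;> simp
  simp only [opR]
  simp only [key, key', Matrix.add_apply, Matrix.sub_apply]
  simp only [sum_equal, sum_diag, sum_mirror, sum_exch, sum_annih]
  by_cases h : a = c ∧ b = e
  · obtain ⟨rfl, rfl⟩ := h
    simp only [and_self, if_true]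
    have h1 : (a = b.rev) ↔ (b = a.rev) := by grind [Fin.rev_rev]
    by_cases hab : a = b
    · subst hab
      by_cases hm : a = a.rev
      · simp only [← hm]; simp
      · simp [hm]
    · by_cases hm : b = a.rev
      · have hm' : ¬ a = a.rev := fun h => hab (by rw [hm, ← h])
        simp only [hm, hm']; simp [hm']
      · have hm' : ¬ a = b.rev := by rwa [h1]
        simp [hab, hm, hm']
  · simp [h]

end Entries

/-! ### Types B, C, D as instances of `Datum`. -/

/-- The sign `ε_i ε_{i'}`. -/
def sgn : LieType → ℤ
  | .B => 1
  | .C => -1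
  | .D => 1

theorem eps_rev (X : LieType) (n : ℕ) (i : Fin (dim X n)) : eps X n i.rev = sgn X * eps X n i := by
  cases X
  · simp [eps, sgn]
  · have := i.isLt
    simp only [eps, sgn, Fin.val_rev]
    simp only [dim] at this ⊢
    split_ifs <;> first | rfl | omega
  · simp [eps, sgn]

theorem eps_sq (X : LieType) (n : ℕ) (i : Fin (dim X n)) : eps X n i * eps X n i = 1 := by
  cases X
  · simp [eps]
  · simp only [eps]; split_ifs <;> rfl
  · simp [eps]

theorem twoBar_rev (X : LieType) (n : ℕ) (i : Fin (dim X n)) :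
    twoBar X n i.rev = - twoBar X n i := by
  have := i.isLt
  cases X <;> simp only [twoBar, Fin.val_rev] <;> simp only [dim] at this ⊢ <;>
    split_ifs <;> omega

theorem sgn_eq_one_of_mid (X : LieType) (n : ℕ) (i : Fin (dim X n)) (h : i = i.rev) :
    sgn X = 1 ∧ eps X n i = 1 ∧ twoBar X n i = 0 := by
  have hi := i.isLt
  have ht := twoBar_rev X n i
  rw [← h] at ht
  rw [Fin.ext_iff, Fin.val_rev] at h
  refine ⟨?_, ?_, by omega⟩ <;> cases X <;> simp only [dim] at h hi <;>
    first | rfl | (exfalso; omega)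

section Sums
variable {F : Type*} [Field F]

/-- The value of `(q - q⁻¹) ∑_{k ≥ j} q^{2 k̄}`. -/
def tailSum (X : LieType) (n : ℕ) (q : F) (j : ℕ) : F :=
  match X with
  | .B => if j ≤ n then q ^ (2 * n - 2 * j : ℤ) + (q - q⁻¹) - q ^ (-2 * n : ℤ)
      else q ^ (2 * n - 2 * j + 2 : ℤ) - q ^ (-2 * n : ℤ)
  | .C => if j < n then q ^ (2 * n - 2 * j + 1 : ℤ) - (q - q⁻¹) - q ^ (-2 * n - 1 : ℤ)
      else q ^ (2 * n - 2 * j - 1 : ℤ) - q ^ (-2 * n - 1 : ℤ)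
  | .D => if j < n then q ^ (2 * n - 2 * j - 1 : ℤ) + (q - q⁻¹) - q ^ (-2 * n + 1 : ℤ)
      else q ^ (2 * n - 2 * j + 1 : ℤ) - q ^ (-2 * n + 1 : ℤ)

/-- Since `(q - q⁻¹) q^m = q^{m+1} - q^{m-1}` and `2k̄` drops by 2 inside each half of the tuple,
the sum telescopes. In the middle the drop is 4 in type C, 0 in type D, and twice 1 in type B; this
produces the correction by `q - q⁻¹`. -/
theorem tailSum_step (X : LieType) (n : ℕ) {q : F} (hq : q ≠ 0) (j : Fin (dim X n)) :
    tailSum X n q j = (q - q⁻¹) * q ^ (twoBar X n j) + tailSum X n q (j + 1) := by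
  have hj := j.isLt
  have e1 : ∀ m : ℤ, q ^ (m + 1) = q ^ m * q := fun m => zpow_add_one₀ hq m
  have e2 : ∀ m : ℤ, q ^ (m - 1) = q ^ m * q⁻¹ := fun m => zpow_sub_one₀ hq m
  cases X
  · rcases lt_trichotomy j.val n with h | h | h
    · have h1 : j.val ≤ n := h.le
      have h2 : j.val + 1 ≤ n := h
      simp only [tailSum, twoBar, h, h1, h2, if_true]
      have a1 : (2 * n - 2 * j : ℤ) = (2 * n - 1 - 2 * j) + 1 := by ring
      have a2 : (2 * n - 2 * (j + 1 : ℕ) : ℤ) = (2 * n - 1 - 2 * j) - 1 := by push_cast; ring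
      rw [a1, a2, e1, e2]
      ring
    · have h1 : ¬ (n + 1 ≤ n) := by omega
      simp only [tailSum, twoBar, h, h1, le_refl, lt_irrefl, if_true, if_false]
      push_cast
      ring_nf
      simp only [zpow_zero, one_mul]
    · have h1 : ¬ (j.val ≤ n) := by omega
      have h2 : ¬ (j.val + 1 ≤ n) := by omega
      have h3 : ¬ (j.val < n) := by omega
      have h4 : ¬ (j.val = n) := by omega
      simp only [tailSum, twoBar, h1, h2, h3, h4, if_false]
      have a1 : (2 * n - 2 * j + 2 : ℤ) = (2 * n + 1 - 2 * j) + 1 := by ring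
      have a2 : (2 * n - 2 * (j + 1 : ℕ) + 2 : ℤ) = (2 * n + 1 - 2 * j) - 1 := by push_cast; ring
      rw [a1, a2, e1, e2]
      ring
  · rcases lt_or_ge j.val n with h | h
    · rcases lt_or_eq_of_le (Nat.succ_le_of_lt h) with h1 | h1
      · replace h1 : j.val + 1 < n := h1
        simp only [tailSum, twoBar, h, h1, if_true]
        have a2 : (2 * n - 2 * (j + 1 : ℕ) + 1 : ℤ) = (2 * n - 2 * j) - 1 := by push_cast; ring
        rw [a2, e1, e2 (2 * n - 2 * j)]
        ring
      · replace h1 : j.val + 1 = n := h1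
        have h2 : ¬ (j.val + 1 < n) := by omega
        have a1 : (2 * n - 2 * j : ℤ) = 2 := by omega
        have a2 : (2 * n - 2 * (j + 1 : ℕ) - 1 : ℤ) = -1 := by omega
        simp only [tailSum, twoBar, h, h2, if_true, if_false]
        rw [e1, a1, a2, zpow_neg_one, zpow_ofNat]
        field_simp
        ring
    · have h1 : ¬ (j.val < n) := by omega
      have h2 : ¬ (j.val + 1 < n) := by omega
      simp only [tailSum, twoBar, h1, h2, if_false]
      have a1 : (2 * n - 2 * j - 1 : ℤ) = (2 * n - 2 - 2 * j) + 1 := by ring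
      have a2 : (2 * n - 2 * (j + 1 : ℕ) - 1 : ℤ) = (2 * n - 2 - 2 * j) - 1 := by push_cast; ring
      rw [a1, a2, e1, e2 (2 * n - 2 - 2 * j)]
      ring
  · rcases lt_or_ge j.val n with h | h
    · rcases lt_or_eq_of_le (Nat.succ_le_of_lt h) with h1 | h1
      · replace h1 : j.val + 1 < n := h1
        simp only [tailSum, twoBar, h, h1, if_true]
        have a1 : (2 * n - 2 * j - 1 : ℤ) = (2 * n - 2 - 2 * j) + 1 := by ring
        have a2 : (2 * n - 2 * (j + 1 : ℕ) - 1 : ℤ) = (2 * n - 2 - 2 * j) - 1 := by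
          push_cast; ring
        rw [a1, a2, e1, e2]
        ring
      · replace h1 : j.val + 1 = n := h1
        have h2 : ¬ (j.val + 1 < n) := by omega
        have a1 : (2 * n - 2 * j - 1 : ℤ) = 1 := by omega
        have a2 : (2 * n - 2 * (j + 1 : ℕ) + 1 : ℤ) = 1 := by omega
        have a3 : (2 * n - 2 - 2 * j : ℤ) = 0 := by omega
        simp only [tailSum, twoBar, h, h2, if_true, if_false]
        rw [a1, a2, a3, zpow_zero]
        ring
    · have h1 : ¬ (j.val < n) := by omega
      have h2 : ¬ (j.val + 1 < n) := by omega
      simp only [tailSum, twoBar, h1, h2, if_false]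
      have a2 : (2 * n - 2 * (j + 1 : ℕ) + 1 : ℤ) = (2 * n - 2 * j) - 1 := by push_cast; ring
      rw [a2, e1, e2]
      ring

theorem tailSum_dim (X : LieType) (n : ℕ) (q : F) (hN : 0 < dim X n) :
    tailSum X n q (dim X n) = 0 := by
  cases X <;> simp only [dim] at hN ⊢ <;> simp only [tailSum]
  · rw [if_neg (by omega)]; push_cast; ring_nf
  · rw [if_neg (by omega)]; push_cast; ring_nf
  · rw [if_neg (by omega)]; push_cast; ring_nf

theorem mul_sum_ge (X : LieType) (n : ℕ) {q : F} (hq : q ≠ 0) (hN : 0 < dim X n) (j : ℕ)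
    (hj : j ≤ dim X n) :
    (q - q⁻¹) * ∑ k : Fin (dim X n), (if j ≤ k.val then q ^ twoBar X n k else 0) =
      tailSum X n q j := by
  induction hj using Nat.decreasingInduction with
  | self =>
    rw [tailSum_dim X n q hN, Finset.sum_eq_zero, mul_zero]
    intro k _
    rw [if_neg (by have := k.isLt; omega)]
  | of_succ j hj ih =>
    have h : ∀ k : Fin (dim X n), (if j ≤ k.val then q ^ twoBar X n k else 0) =
        (if k = ⟨j, hj⟩ then q ^ twoBar X n ⟨j, hj⟩ else 0) +
        (if j + 1 ≤ k.val then q ^ twoBar X n k else 0) := by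
      intro k
      by_cases hk : k = ⟨j, hj⟩
      · subst hk; simp
      · have hk' : k.val ≠ j := fun h => hk (Fin.ext h)
        have h1 : (j ≤ k.val) ↔ (j + 1 ≤ k.val) := by omega
        simp [hk, h1]
    simp only [h, Finset.sum_add_distrib, Finset.sum_ite_eq', Finset.mem_univ, if_true, mul_add, ih]
    exact (tailSum_step X n hq ⟨j, hj⟩).symm

theorem tailSum_succ (X : LieType) (n : ℕ) {q : F} (hq : q ≠ 0) (i : Fin (dim X n)) :
    tailSum X n q (i + 1) = q ^ twoBar X n i / q - q ^ xiExp X n * q ^ (-sgn X) +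
      (if i < i.rev then (sgn X : F) * (q - q⁻¹) else 0) + (if i = i.rev then 1 - q⁻¹ else 0) := by
  have hi := i.isLt
  rw [← zpow_add₀ hq, div_eq_mul_inv, ← zpow_sub_one₀ hq]
  obtain ⟨N, hN⟩ : ∃ N, N = dim X n := ⟨_, rfl⟩
  have l1 : (i < i.rev) ↔ i.val + i.val + 1 < N := by
    simp only [Fin.lt_def, Fin.val_rev]; omega
  have l2 : (i = i.rev) ↔ i.val + i.val + 1 = N := by
    simp only [Fin.ext_iff, Fin.val_rev]; omega
  simp only [l1, l2]
  have hz : ∀ a b : ℤ, a = b → q ^ a = q ^ b := fun a b h => by rw [h]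
  clear l1 l2
  cases X <;> simp only [tailSum, twoBar, xiExp, sgn] <;> generalize i.val = i at hi ⊢ <;>
    simp only [dim] at hi hN ⊢
  · rcases lt_trichotomy i n with h | h | h
    · rw [if_pos (by omega), if_pos h, if_pos (by omega), if_neg (by omega)]
      rw [hz (2 * n - 2 * (i + 1 : ℕ)) (2 * n - 1 - 2 * i - 1) (by push_cast; ring),
        hz (-2 * n) (2 - (2 * n + 1 : ℕ) + -1) (by push_cast; ring)]
      push_cast; ring
    · rw [if_neg (by omega), if_neg (by omega), if_pos h, if_neg (by omega), if_pos (by omega)]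
      rw [hz (2 * n - 2 * (i + 1 : ℕ) + 2) 0 (by rw [h]; push_cast; ring),
        hz (-2 * n) (2 - (2 * n + 1 : ℕ) + -1) (by push_cast; ring)]
      simp only [zero_sub, zpow_neg_one, zpow_zero]
      ring
    · rw [if_neg (by omega), if_neg (by omega), if_neg (by omega), if_neg (by omega),
        if_neg (by omega)]
      rw [hz (2 * n - 2 * (i + 1 : ℕ) + 2) (2 * n + 1 - 2 * i - 1) (by push_cast; ring),
        hz (-2 * n) (2 - (2 * n + 1 : ℕ) + -1) (by push_cast; ring)]
      ring
  · rw [hz (-2 * n - 1) (-2 - (2 * n : ℕ) + - -1) (by push_cast; ring)]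
    rcases lt_or_ge i n with h | h
    · rcases lt_or_eq_of_le (Nat.succ_le_of_lt h) with h1 | h1
      · rw [if_pos h1, if_pos h, if_pos (by omega), if_neg (by omega)]
        rw [hz (2 * n - 2 * (i + 1 : ℕ) + 1) (2 * n - 2 * i - 1) (by push_cast; ring)]
        push_cast; ring
      · have h2 : i + 1 = n := h1
        rw [if_neg (by omega), if_pos h, if_pos (by omega), if_neg (by omega)]
        rw [hz (2 * n - 2 * (i + 1 : ℕ) - 1) (-1) (by omega),
          hz (2 * n - 2 * i - 1) 1 (by omega), zpow_neg_one, zpow_one]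
        push_cast; ring
    · rw [if_neg (by omega), if_neg (by omega), if_neg (by omega), if_neg (by omega)]
      rw [hz (2 * n - 2 * (i + 1 : ℕ) - 1) (2 * n - 2 - 2 * i - 1) (by push_cast; ring)]
      ring
  · rw [hz (-2 * n + 1) (2 - (2 * n : ℕ) + -1) (by push_cast; ring)]
    rcases lt_or_ge i n with h | h
    · rcases lt_or_eq_of_le (Nat.succ_le_of_lt h) with h1 | h1
      · rw [if_pos h1, if_pos h, if_pos (by omega), if_neg (by omega)]
        rw [hz (2 * n - 2 * (i + 1 : ℕ) - 1) (2 * n - 2 - 2 * i - 1) (by push_cast; ring)]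
        push_cast; ring
      · have h2 : i + 1 = n := h1
        rw [if_neg (by omega), if_pos h, if_pos (by omega), if_neg (by omega)]
        rw [hz (2 * n - 2 * (i + 1 : ℕ) + 1) 1 (by omega),
          hz (2 * n - 2 - 2 * i - 1) (-1) (by omega), zpow_neg_one, zpow_one]
        push_cast; ring
    · rw [if_neg (by omega), if_neg (by omega), if_neg (by omega), if_neg (by omega)]
      rw [hz (2 * n - 2 * (i + 1 : ℕ) + 1) (2 * n - 2 * i - 1) (by push_cast; ring)]
      ring

theorem tailSum_zero (X : LieType) (n : ℕ) {q : F} (hq : q ≠ 0) (hN : 0 < dim X n) :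
    tailSum X n q 0 = (q ^ xiExp X n * q ^ (-sgn X))⁻¹ - q ^ xiExp X n * q ^ (-sgn X) +
      (sgn X : F) * (q - q⁻¹) := by
  have hz : ∀ a b : ℤ, a = b → q ^ a = q ^ b := fun a b h => by rw [h]
  rw [← zpow_add₀ hq, ← zpow_neg]
  cases X <;> simp only [dim] at hN <;> simp only [tailSum, xiExp, sgn, dim]
  · rw [if_pos (by omega), hz (2 * n - 2 * (0 : ℕ)) (-(2 - (2 * n + 1 : ℕ) + -1))
        (by push_cast; ring), hz (-2 * n) (2 - (2 * n + 1 : ℕ) + -1) (by push_cast; ring)]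
    push_cast; ring
  · rw [if_pos (by omega), hz (2 * n - 2 * (0 : ℕ) + 1) (-(-2 - (2 * n : ℕ) + - -1))
        (by push_cast; ring), hz (-2 * n - 1) (-2 - (2 * n : ℕ) + - -1) (by push_cast; ring)]
    push_cast; ring
  · rw [if_pos (by omega), hz (2 * n - 2 * (0 : ℕ) - 1) (-(2 - (2 * n : ℕ) + -1))
        (by push_cast; ring), hz (-2 * n + 1) (2 - (2 * n : ℕ) + -1) (by push_cast; ring)]
    push_cast; ring

end Sums

theorem weight_sq (X : LieType) (n : ℕ) {F : Type*} [Field F] (t : Fˣ) (i : Fin (dim X n)) :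
    (((t ^ twoBar X n i : Fˣ) : F) * (eps X n i : F)) ^ 2 = ((qOf t : Fˣ) : F) ^ twoBar X n i := by
  have h0 : (eps X n i : F) ^ 2 = 1 := by
    rw [pow_two, ← Int.cast_mul, eps_sq, Int.cast_one]
  rw [mul_pow, h0, mul_one, qOf, Units.val_zpow_eq_zpow_val, Units.val_pow_eq_pow_val,
    ← zpow_natCast, ← zpow_natCast, ← zpow_mul, ← zpow_mul, mul_comm]

/-- The data of types `B`, `C`, `D`. -/
def datum (X : LieType) (n : ℕ) {F : Type*} [Field F] (t : Fˣ) : Datum F (dim X n) where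
  q := (qOf t : Fˣ)
  ξ := (xi X n t : Fˣ)
  ε := (sgn X : F)
  η := ((qOf t : Fˣ) : F) ^ (-sgn X)
  β i := ((t ^ twoBar X n i : Fˣ) : F) * (eps X n i : F)
  q_ne := Units.ne_zero _
  ξ_ne := Units.ne_zero _
  ε_eq := by cases X <;> simp [sgn]
  β_ne i := by
    refine mul_ne_zero (Units.ne_zero _) fun h => ?_
    have := congrArg (Int.cast : ℤ → F) (eps_sq X n i)
    rw [Int.cast_mul, h] at this
    simp at this
  β_rev i := by
    have h0 : (eps X n i : F) * (eps X n i : F) = 1 := by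
      rw [← Int.cast_mul, eps_sq, Int.cast_one]
    have h1 : (eps X n i : F) ≠ 0 := left_ne_zero_of_mul_eq_one h0
    have h2 : ((t ^ twoBar X n i : Fˣ) : F) ≠ 0 := Units.ne_zero _
    rw [twoBar_rev, eps_rev, zpow_neg, Units.val_inv_eq_inv_val]
    push_cast
    field_simp
    linear_combination (sgn X : F) * h0
  mid i hi := by
    obtain ⟨h1, h2, h3⟩ := sgn_eq_one_of_mid X n i hi
    simp [h1, h2, h3]
  sum_gt i := by
    have h := mul_sum_ge X n (q := ((qOf t : Fˣ) : F)) (Units.ne_zero _) (Fin.pos i) (i + 1) i.isLt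
    rw [tailSum_succ X n (Units.ne_zero _)] at h
    simp only [weight_sq]
    simp only [xi, Units.val_zpow_eq_zpow_val]
    exact h
  sum_all i := by
    have h := mul_sum_ge X n (q := ((qOf t : Fˣ) : F)) (Units.ne_zero _) (Fin.pos i) 0 (Nat.zero_le _)
    rw [tailSum_zero X n (Units.ne_zero _) (Fin.pos i)] at h
    simp only [Nat.zero_le, if_true] at h
    simp only [weight_sq]
    simp only [xi, Units.val_zpow_eq_zpow_val]
    exact h

theorem wt_eq_div (X : LieType) (n : ℕ) {F : Type*} [Field F] (t : Fˣ) (b e : Fin (dim X n)) :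
    wt X n t b e = (datum X n t).β b / (datum X n t).β e := by
  have h0 : (eps X n e : F) * (eps X n e : F) = 1 := by
    rw [← Int.cast_mul, eps_sq, Int.cast_one]
  have h1 : (eps X n e : F) ≠ 0 := left_ne_zero_of_mul_eq_one h0
  have h2 : ((t ^ twoBar X n e : Fˣ) : F) ≠ 0 := Units.ne_zero _
  rw [wt, zpow_sub, Units.val_mul, Units.val_inv_eq_inv_val]
  simp only [datum]
  push_cast
  field_simp
  linear_combination (eps X n b : F) * h0

theorem mul_ite_add_ite_sub_ite {F : Type*} [Field F] (p₁ p₂ p₃ : Prop) [Decidable p₁]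
    [Decidable p₂] [Decidable p₃] (A B C u v w r : F) :
    A * ((if p₁ then u else 0) + (if p₂ then v else 0) - (if p₃ then w else 0)) -
      B * (if p₂ then 1 else 0) + C * (if p₃ then r else 0) =
    (if p₁ then A * u else 0) + (if p₂ then A * v - B else 0) -
      (if p₃ then A * w - C * r else 0) := by
  split_ifs <;> ring

theorem Rplus_eq (X : LieType) (n : ℕ) {F : Type*} [Field F] (x : F) (t : Fˣ) :
    Rplus X n x t = (datum X n t).R x := by
  ext ⟨a, b⟩ ⟨c, e⟩
  simp only [Rplus, Matrix.add_apply, Matrix.sub_apply, Matrix.smul_apply, opR_apply, opP_apply,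
    opQ_apply, Datum.R_apply, Datum.dg, Datum.ex, Datum.ac, smul_eq_mul]
  have hq : ((qOf t : Fˣ) : F) ≠ 0 := Units.ne_zero _
  have e1 : (datum X n t).q = ((qOf t : Fˣ) : F) := rfl
  have e2 : (datum X n t).ξ = ((xi X n t : Fˣ) : F) := rfl
  rw [wt_eq_div, e1, e2, Units.val_inv_eq_inv_val]
  generalize (datum X n t).β b / (datum X n t).β e = w
  generalize ((xi X n t : Fˣ) : F) = ξ
  generalize ((qOf t : Fˣ) : F) = q at hq
  -- `P` and `Q` complete the half sums of `R`. The exchange terms give `(x - 1)[a < b] + 1`, hence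
  -- `x` or `1`; the annihilation-creation terms give `(x - ξ)[e < b] + ξ`, hence `x` or `ξ`.
  rw [mul_ite_add_ite_sub_ite]
  congr 1
  · congr 1
    · congr 1
      split_ifs <;> field_simp <;> ring
  · congr 1
    split_ifs <;> field_simp <;> ring

/-! ### Base change, and descent from fraction fields to domains. -/

section Map
variable {S S' : Type*} [CommRing S] [CommRing S']

theorem qOf_map (φ : S →+* S') (t : Sˣ) :
    qOf (Units.map (φ : S →* S') t) = Units.map (φ : S →* S') (qOf t) := by
  simp [qOf]

theorem xi_map (X : LieType) (n : ℕ) (φ : S →+* S') (t : Sˣ) :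
    xi X n (Units.map (φ : S →* S') t) = Units.map (φ : S →* S') (xi X n t) := by
  simp [xi, qOf_map]

theorem wt_map (X : LieType) (n : ℕ) (φ : S →+* S') (t : Sˣ) (i j : Fin (dim X n)) :
    wt X n (Units.map (φ : S →* S') t) i j = φ (wt X n t i j) := by
  rw [wt, wt, ← map_zpow, map_mul, map_intCast]
  rfl

theorem Rplus_apply (X : LieType) (n : ℕ) (x : S) (t : Sˣ) (a b c e : Fin (dim X n)) :
    Rplus X n x t (a, b) (c, e) =
      (((qOf t)⁻¹ : Sˣ) : S) * (x - 1) * (x - (xi X n t : Sˣ)) * opR X n t (a, b) (c, e)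
      - ((((qOf t)⁻¹ : Sˣ) : S) ^ 2 - 1) * (x - (xi X n t : Sˣ)) * opP X n S (a, b) (c, e)
      + (xi X n t : Sˣ) * ((((qOf t)⁻¹ : Sˣ) : S) ^ 2 - 1) * (x - 1) * opQ X n t (a, b) (c, e) :=
  rfl

theorem Rplus_map (X : LieType) (n : ℕ) (φ : S →+* S') (x : S) (t : Sˣ) :
    (Rplus X n x t).map φ = Rplus X n (φ x) (Units.map (φ : S →* S') t) := by
  ext ⟨a, b⟩ ⟨c, e⟩
  have h1 : (((qOf (Units.map (φ : S →* S') t))⁻¹ : S'ˣ) : S') = φ (((qOf t)⁻¹ : Sˣ) : S) := by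
    rw [qOf_map, ← map_inv]; rfl
  have h2 : ((xi X n (Units.map (φ : S →* S') t) : S'ˣ) : S') = φ ((xi X n t : Sˣ) : S) := by
    rw [xi_map]; rfl
  have h3 : ((qOf (Units.map (φ : S →* S') t) : S'ˣ) : S') = φ ((qOf t : Sˣ) : S) := by
    rw [qOf_map]; rfl
  rw [Matrix.map_apply, Rplus_apply, Rplus_apply]
  simp only [opR_apply, opP_apply, opQ_apply, h1, h2, h3, wt_map, map_add, map_sub, map_mul,
    map_pow, map_one, apply_ite φ, map_zero]


theorem tripleL_map {N : ℕ} (φ : S →+* S') (A B C : End2 N S) (a b c d e f : Fin N) :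
    φ (tripleL A B C a b c d e f) = tripleL (A.map φ) (B.map φ) (C.map φ) a b c d e f := by
  simp only [tripleL, map_sum, map_mul, Matrix.map_apply]

theorem tripleR_map {N : ℕ} (φ : S →+* S') (A B C : End2 N S) (a b c d e f : Fin N) :
    φ (tripleR A B C a b c d e f) = tripleR (A.map φ) (B.map φ) (C.map φ) a b c d e f := by
  simp only [tripleR, map_sum, map_mul, Matrix.map_apply]

/-- The scalar in the unitarity relation. -/
def uscal (X : LieType) (n : ℕ) (x x' : S) (t : Sˣ) : S :=
  (x - (((qOf t)⁻¹ : Sˣ) : S) ^ 2) * (x - (xi X n t : Sˣ)) *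
    (x' - (((qOf t)⁻¹ : Sˣ) : S) ^ 2) * (x' - (xi X n t : Sˣ))

end Map

section Domain
variable {S : Type*} [CommRing S] [IsDomain S]

theorem Rplus_mul_swap (X : LieType) (n : ℕ) {x x' : S} (hx : x * x' = 1) (t : Sˣ) :
    Rplus X n x t * (Rplus X n x' t).submatrix Prod.swap Prod.swap = uscal X n x x' t • 1 := by
  set φ := algebraMap S (FractionRing S) with hφ0
  have hφ : φ x * φ x' = 1 := by rw [← map_mul, hx, map_one]
  have hx' : φ x' = (φ x)⁻¹ := eq_inv_of_mul_eq_one_right hφ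
  apply Matrix.map_injective (IsFractionRing.injective S (FractionRing S))
  have h := (datum X n (Units.map (φ : S →* FractionRing S) t)).R_mul_R_swap
    (left_ne_zero_of_mul_eq_one hφ)
  rw [← hx', ← Rplus_eq, ← Rplus_eq, ← Rplus_map, ← Rplus_map, Matrix.submatrix_map,
    ← Matrix.map_mul] at h
  have h1 : (((qOf (Units.map (φ : S →* FractionRing S) t)) : (FractionRing S)ˣ) : FractionRing S)⁻¹
      = φ (((qOf t)⁻¹ : Sˣ) : S) := by
    rw [qOf_map, ← Units.val_inv_eq_inv_val, ← map_inv]; rfl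
  have h2 : ((xi X n (Units.map (φ : S →* FractionRing S) t) : (FractionRing S)ˣ) :
      FractionRing S) = φ ((xi X n t : Sˣ) : S) := by
    rw [xi_map]; rfl
  refine h.trans ?_
  ext i j
  simp only [Matrix.smul_apply, Matrix.map_apply, Matrix.one_apply, smul_eq_mul,
    apply_ite φ, map_zero, mul_ite, mul_one, mul_zero, ← hφ0]
  congr 1
  simp only [uscal, Datum.f, datum, h1, h2, map_mul, map_sub, map_pow]

theorem Rplus_cross (X : LieType) (n : ℕ) {x x' : S} (hx : x * x' = 1) (t : Sˣ)
    (a b c e : Fin (dim X n)) :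
    wt X n t a c * Rplus X n x t (c.rev, b) (a.rev, e) =
      x ^ 2 * ((xi X n t)⁻¹ : Sˣ) * Rplus X n ((xi X n t : Sˣ) * x') t (b, a) (e, c) := by
  set φ := algebraMap S (FractionRing S) with hφ0
  have hφ : φ x * φ x' = 1 := by rw [← map_mul, hx, map_one]
  have hx' : φ x' = (φ x)⁻¹ := eq_inv_of_mul_eq_one_right hφ
  apply IsFractionRing.injective S (FractionRing S)
  have h := (datum X n (Units.map (φ : S →* FractionRing S) t)).R_cross
    (left_ne_zero_of_mul_eq_one hφ) a b c e
  have h2 : (datum X n (Units.map (φ : S →* FractionRing S) t)).ξ = φ ((xi X n t : Sˣ) : S) := by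
    simp only [datum, xi_map]; rfl
  have h3 : φ ((xi X n t : Sˣ) : S) / φ x = φ ((xi X n t : Sˣ) * x') := by
    rw [map_mul, hx', div_eq_mul_inv]
  have h4 : φ (((xi X n t)⁻¹ : Sˣ) : S) = (φ ((xi X n t : Sˣ) : S))⁻¹ := by
    apply eq_inv_of_mul_eq_one_left
    rw [← map_mul, Units.inv_mul, map_one]
  rw [← wt_eq_div, wt_map, h2, h3, ← Rplus_eq, ← Rplus_eq, ← Rplus_map, ← Rplus_map] at h
  simp only [map_mul, map_pow, ← hφ0, h4]
  simp only [Matrix.map_apply] at h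
  rw [h, div_eq_mul_inv]

variable (X : LieType) (n : ℕ) (x y : S) (t : Sˣ)

theorem triple_of_datum {a b c d e f : Fin (dim X n)}
    (h : ∀ x y : FractionRing S, ∀ t : (FractionRing S)ˣ,
      tripleL ((datum X n t).R x) ((datum X n t).R (x * y)) ((datum X n t).R y) a b c d e f =
      tripleR ((datum X n t).R x) ((datum X n t).R (x * y)) ((datum X n t).R y) a b c d e f) :
    tripleL (Rplus X n x t) (Rplus X n (x * y) t) (Rplus X n y t) a b c d e f =
      tripleR (Rplus X n x t) (Rplus X n (x * y) t) (Rplus X n y t) a b c d e f := by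
  apply IsFractionRing.injective S (FractionRing S)
  rw [tripleL_map, tripleR_map, Rplus_map, Rplus_map, Rplus_map, Rplus_eq, Rplus_eq, Rplus_eq,
    map_mul]
  exact h _ _ _

end Domain

theorem Rplus_apply_eq_zero (X : LieType) (n : ℕ) {S : Type*} [CommRing S] (x : S) (t : Sˣ)
    {a b c e : Fin (dim X n)} (h : ¬ (a = c ∧ b = e ∨ a = e ∧ b = c ∨ b = a.rev ∧ e = c.rev)) :
    Rplus X n x t (a, b) (c, e) = 0 := by
  rw [Rplus_apply, opR_apply, opP_apply, opQ_apply]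
  simp only [not_or] at h
  simp [h]

/-! ### Reduction of all entries to the standard ones. -/

/-- A set of matrix entries of operators on three tensor factors, rows and columns being given by
three indices each, which is stable under permutations of the factors and under transposition of
the first factor, and contains some standard entries. -/
structure EntrySet {N : ℕ} (P : Fin N → Fin N → Fin N → Fin N → Fin N → Fin N → Prop) : Prop where
  swap12 : ∀ {a b c d e f}, P a b c d e f → P b a c e d f
  swap13 : ∀ {a b c d e f}, P a b c d e f → P c b a f e d
  flip : ∀ {a b c d e f}, P a b c d e f → P d.rev b c a.rev e f
  no_pair : ∀ {a b c d e f}, e ≠ d.rev → f ≠ d.rev → f ≠ e.rev → P a b c d e f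
  flip_fix_flip : ∀ {a b}, b ≠ a → b ≠ a.rev → P a.rev b a a b a.rev
  flip_rotate : ∀ {a b}, b ≠ a → b ≠ a.rev → P a.rev a b a b a.rev
  flip_fix_flip_self : ∀ {b}, b ≠ b.rev → P b b b.rev b.rev b b
  middle : ∀ {m}, m = m.rev → P m m m m m m

namespace EntrySet
variable {N : ℕ} {P : Fin N → Fin N → Fin N → Fin N → Fin N → Fin N → Prop} (h : EntrySet P)
include h

variable {a b c d e f : Fin N}

theorem swap23 (w : P a b c d e f) : P a c b d f e :=
  h.swap12 (h.swap13 (h.swap12 w))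

theorem flip_second (w : P a b c d e f) : P a e.rev c d b.rev f :=
  h.swap12 (h.flip (h.swap12 w))

theorem flip_third (w : P a b c d e f) : P a b f.rev d e c.rev :=
  h.swap13 (h.flip (h.swap13 w))

theorem of_flip (w : P d.rev b c a.rev e f) : P a b c d e f := by
  simpa using h.flip w

theorem of_flip_second (w : P a e.rev c d b.rev f) : P a b c d e f := by
  simpa using h.flip_second w

theorem of_flip_third (w : P a b f.rev d e c.rev) : P a b c d e f := by
  simpa using h.flip_third w

theorem fix_mirror_mirror (a b : Fin N) : P b a.rev a b a a.rev := by
  by_cases h1 : b = a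
  · subst h1
    by_cases hm : b = b.rev
    · rw [← hm]; exact h.middle hm
    · exact h.swap12 (h.swap13 (h.flip_fix_flip_self hm))
  · by_cases h2 : b = a.rev
    · subst h2
      have := h.swap12 (h.flip_fix_flip_self (b := a.rev) (by rwa [Fin.rev_rev]))
      rwa [Fin.rev_rev] at this
    · exact h.swap12 (h.flip_fix_flip h1 h2)

theorem cycle (w : P a b c d e f) : P b c a e f d :=
  h.swap23 (h.swap12 w)

theorem rotate_mirror (a c : Fin N) : P a.rev c a a a.rev c := by
  by_cases h1 : c = a
  · subst h1
    exact h.swap13 (h.swap23 (h.fix_mirror_mirror c c))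
  · by_cases h2 : c = a.rev
    · subst h2
      exact h.swap12 (h.fix_mirror_mirror a a.rev)
    · exact h.swap23 (h.flip_rotate h1 h2)

theorem rotate (a b c : Fin N) : P b c a a b c := by
  by_cases h1 : b = a.rev
  · subst h1; exact h.rotate_mirror a c
  · by_cases h2 : c = b.rev
    · subst h2; exact h.cycle (h.cycle (h.rotate_mirror b a))
    · by_cases h3 : c = a.rev
      · have : a = c.rev := by rw [h3, Fin.rev_rev]
        subst this
        exact h.cycle (h.rotate_mirror c b)
      · exact h.no_pair h1 h3 h2

/-- If `b` pairs with `c` or `d`, flipping the fixed index replaces it by its mirror and removes the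
pair. This fails only when `b` itself also occurs among `c`, `d`, and then the entry is a rotation.
-/
theorem fix_exchange (b c d : Fin N) : P b d c b c d := by
  by_cases h1 : d = c.rev
  · subst h1; exact h.fix_mirror_mirror c b
  by_cases h2 : c = b.rev ∨ d = b.rev
  · by_cases h3 : c = b.rev.rev ∨ d = b.rev.rev
    · rw [Fin.rev_rev] at h3
      rcases h3 with rfl | rfl
      · exact h.rotate c c d
      · exact h.swap23 (h.rotate d d c)
    · rw [not_or] at h3
      exact h.of_flip (h.no_pair h3.1 h3.2 h1)
  · rw [not_or] at h2
    exact h.no_pair h2.1 h2.2 h1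

/-- Flipping `c` removes its pairs with `a` and `b`, unless `c` is its own mirror; in that case the
entry has the form of `fix_mirror_mirror`. -/
theorem fix_of_ne (hb : b ≠ a.rev) (c : Fin N) : P a b c a b c := by
  by_cases h2 : c = a.rev ∨ c = b.rev
  · by_cases h3 : c.rev = a.rev ∨ c.rev = b.rev
    · rw [Fin.rev_inj, Fin.rev_inj] at h3
      rcases h3 with rfl | rfl
      · have hc : c = c.rev := h2.resolve_right fun h' => hb (by rw [h', Fin.rev_rev])
        have := h.swap12 (h.fix_mirror_mirror c b)
        rwa [← hc] at this
      · have hc : c = c.rev := h2.resolve_left fun h' => hb h'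
        have := h.fix_mirror_mirror c a
        rwa [← hc] at this
    · rw [not_or] at h3
      exact h.of_flip_third (h.no_pair hb h3.1 h3.2)
  · rw [not_or] at h2
    exact h.no_pair hb h2.1 h2.2

theorem fix (a b c : Fin N) : P a b c a b c := by
  by_cases hb : b = a.rev
  · subst hb
    by_cases ha : a = a.rev
    · have := h.cycle (h.fix_mirror_mirror a c)
      rwa [← ha] at this ⊢
    · exact h.of_flip_second (h.fix_of_ne (by rwa [Fin.rev_rev]) c)
  · exact h.fix_of_ne hb c

end EntrySet

/-- The support of the R-matrix. -/
def Supp {N : ℕ} (a b c e : Fin N) : Prop :=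
  a = c ∧ b = e ∨ a = e ∧ b = c ∨ b = a.rev ∧ e = c.rev

namespace EntrySet
variable {N : ℕ} {P : Fin N → Fin N → Fin N → Fin N → Fin N → Fin N → Prop} (h : EntrySet P)
include h
variable {a b c d e f k l m : Fin N}

/-- The hypothesis lists the 15 perfect matchings of the six indices. Under permutations and
transpositions of the factors they form three orbits, of sizes 1, 6 and 8, represented by `fix`,
`fix_exchange` and `rotate`. -/
theorem of_matching
    (w : a = d ∧ b = e ∧ c = f ∨
      a = d ∧ b = f ∧ c = e ∨ a = d ∧ f = e.rev ∧ c = b.rev ∨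
      b = e ∧ a = f ∧ c = d ∨ b = e ∧ f = d.rev ∧ c = a.rev ∨
      c = f ∧ a = e ∧ b = d ∨ c = f ∧ e = d.rev ∧ b = a.rev ∨
      b = d ∧ c = e ∧ a = f ∨ c = d ∧ a = e ∧ b = f ∨
      b = a.rev ∧ c = e ∧ f = d.rev ∨ c = a.rev ∧ e = d.rev ∧ b = f ∨
      e = d.rev ∧ c = b.rev ∧ a = f ∨ c = d ∧ b = a.rev ∧ f = e.rev ∨
      b = d ∧ f = e.rev ∧ c = a.rev ∨ f = d.rev ∧ a = e ∧ c = b.rev) :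
    P a b c d e f := by
  have fe : ∀ {a b c d e f}, a = d → b = f → c = e → P a b c d e f := by
    rintro a b c d e f rfl rfl rfl; exact h.fix_exchange a c b
  have ro' : ∀ {a b c d e f}, c = d → a = e → b = f → P a b c d e f := by
    rintro a b c d e f rfl rfl rfl; exact h.rotate c a b
  have ro : ∀ {a b c d e f}, b = d → c = e → a = f → P a b c d e f :=
    fun h1 h2 h3 => h.swap23 (ro' h1 h3 h2)
  rcases w with ⟨h1, h2, h3⟩ | ⟨h1, h2, h3⟩ | ⟨h1, h2, h3⟩ | ⟨h1, h2, h3⟩ | ⟨h1, h2, h3⟩ |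
    ⟨h1, h2, h3⟩ | ⟨h1, h2, h3⟩ | ⟨h1, h2, h3⟩ | ⟨h1, h2, h3⟩ | ⟨h1, h2, h3⟩ | ⟨h1, h2, h3⟩ |
    ⟨h1, h2, h3⟩ | ⟨h1, h2, h3⟩ | ⟨h1, h2, h3⟩ | ⟨h1, h2, h3⟩
  · subst h1 h2 h3; exact h.fix a b c
  · exact fe h1 h2 h3
  · exact h.of_flip_third (fe h1 (by simp [h3]) (by simp [h2]))
  · exact h.swap12 (fe h1 h2 h3)
  · exact h.of_flip_third (h.swap12 (fe h1 (by simp [h3]) (by simp [h2])))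
  · exact h.swap13 (fe h1 h3 h2)
  · exact h.of_flip_second (h.swap13 (fe h1 (by simp [h2]) (by simp [h3])))
  · exact ro h1 h2 h3
  · exact ro' h1 h2 h3
  · exact h.of_flip (ro h1 h2 h3.symm)
  · exact h.of_flip (ro' h1 h2.symm h3)
  · exact h.of_flip_second (ro (by simp [h1]) h2 h3)
  · exact h.of_flip_second (ro' h1 (by simp [h2]) h3.symm)
  · exact h.of_flip_third (ro h1 (by simp [h2]) (by simp [h3]))
  · exact h.of_flip_third (ro' (by simp [h1]) h2 (by simp [h3]))

/-- Each support condition is a matching of four indices. Composing three of them as Brauer diagrams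
leaves a matching of the outer six. -/
theorem of_supp_left (h1 : Supp a b k l) (h2 : Supp k c d m) (h3 : Supp l m e f) :
    P a b c d e f := by
  apply h.of_matching
  rcases h1 with ⟨rfl, rfl⟩ | ⟨rfl, rfl⟩ | ⟨rfl, rfl⟩ <;>
  rcases h2 with ⟨rfl, rfl⟩ | ⟨rfl, rfl⟩ | ⟨h2, rfl⟩ <;>
  rcases h3 with ⟨h3, h3'⟩ | ⟨h3, h3'⟩ | ⟨h3, h3'⟩ <;> grind [Fin.rev_rev]

theorem of_supp_right (h1 : Supp b c l m) (h2 : Supp a m k f) (h3 : Supp k l d e) :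
    P a b c d e f := by
  apply h.of_matching
  rcases h1 with ⟨rfl, rfl⟩ | ⟨rfl, rfl⟩ | ⟨rfl, rfl⟩ <;>
  rcases h2 with ⟨rfl, rfl⟩ | ⟨rfl, rfl⟩ | ⟨h2, rfl⟩ <;>
  rcases h3 with ⟨h3, h3'⟩ | ⟨h3, h3'⟩ | ⟨h3, h3'⟩ <;> grind [Fin.rev_rev]

end EntrySet

/-! ### Operators acting on chosen tensor factors. -/

section Legs
variable {S : Type*} [CommRing S] {N m : ℕ} {r s : Fin m}

theorem legs_apply (r s : Fin m) (A : End2 N S) (a b : Fin m → Fin N) :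
    legs r s A a b = if ∀ p, p ≠ r → p ≠ s → a p = b p then A (a r, a s) (b r, b s) else 0 :=
  rfl

/-- Only the tuples that agree with `a` outside `r`, `s` contribute; they are parametrized by their
values at `r` and `s`. -/
theorem legs_mul_apply (hrs : r ≠ s) (A : End2 N S) (M : Matrix (Fin m → Fin N) (Fin m → Fin N) S)
    (a b : Fin m → Fin N) :
    (legs r s A * M) a b = ∑ k : Fin N × Fin N,
      A (a r, a s) k * M (Function.update (Function.update a r k.1) s k.2) b := by
  rw [Matrix.mul_apply]
  symm
  apply Fintype.sum_of_injective
    (fun k : Fin N × Fin N => Function.update (Function.update a r k.1) s k.2)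
  · rintro ⟨k, l⟩ ⟨k', l'⟩ h
    have h1 := congrFun h r
    have h2 := congrFun h s
    simp only [Function.update_self, Function.update_of_ne hrs] at h1 h2
    rw [h1, h2]
  · intro γ hγ
    rw [legs_apply, if_neg, zero_mul]
    intro h
    apply hγ
    refine ⟨(γ r, γ s), funext fun p => ?_⟩
    by_cases hs : p = s
    · subst hs; simp
    · by_cases hr : p = r
      · subst hr; simp [hs]
      · simp [hs, hr, h p hr hs]
  · rintro ⟨k, l⟩
    rw [legs_apply, if_pos]
    · simp [Function.update_of_ne hrs]
    · intro p h1 h2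
      simp [h1, h2]

theorem legs_mul (hrs : r ≠ s) (A B : End2 N S) :
    legs r s A * legs r s B = legs r s (A * B) := by
  ext a b
  rw [legs_mul_apply hrs, legs_apply, Matrix.mul_apply]
  by_cases h : ∀ p, p ≠ r → p ≠ s → a p = b p
  · rw [if_pos h]
    refine Finset.sum_congr rfl fun k _ => ?_
    rw [legs_apply, if_pos]
    · simp [Function.update_of_ne hrs]
    · intro p h1 h2
      simp [h1, h2, h p h1 h2]
  · rw [if_neg h]
    refine Finset.sum_eq_zero fun k _ => ?_
    rw [legs_apply, if_neg, mul_zero]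
    intro h'
    apply h
    intro p h1 h2
    have := h' p h1 h2
    simpa [h1, h2] using this

theorem legs_one (r s : Fin m) : legs r s (1 : End2 N S) = 1 := by
  ext a b
  rw [legs_apply, Matrix.one_apply, Matrix.one_apply]
  by_cases h : a = b
  · subst h; simp
  · rw [if_neg h]
    split_ifs with h1 h2
    · exfalso
      apply h
      rw [Prod.mk.injEq] at h2
      funext p
      by_cases hr : p = r
      · rw [hr, h2.1]
      · by_cases hs : p = s
        · rw [hs, h2.2]
        · exact h1 p hr hs
    · rfl
    · rfl

theorem legs_smul (r s : Fin m) (c : S) (A : End2 N S) : legs r s (c • A) = c • legs r s A := by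
  ext a b
  simp only [legs_apply, Matrix.smul_apply, smul_eq_mul, mul_ite, mul_zero]

theorem legs_swap (r s : Fin m) (A : End2 N S) :
    legs r s (A.submatrix Prod.swap Prod.swap) = legs s r A := by
  ext a b
  simp only [legs_apply, Matrix.submatrix_apply, Prod.swap_prod_mk]
  congr 1
  exact propext ⟨fun h p h1 h2 => h p h2 h1, fun h p h1 h2 => h p h2 h1⟩

/-- The permutation of the tensor factors of an operator. -/
def permute (σ : Equiv.Perm (Fin m)) (M : Matrix (Fin m → Fin N) (Fin m → Fin N) S) :
    Matrix (Fin m → Fin N) (Fin m → Fin N) S :=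
  M.submatrix (fun a => a ∘ σ) (fun a => a ∘ σ)

omit [CommRing S] in
theorem permute_apply (σ : Equiv.Perm (Fin m)) (M : Matrix (Fin m → Fin N) (Fin m → Fin N) S)
    (a b : Fin m → Fin N) : permute σ M a b = M (a ∘ σ) (b ∘ σ) := rfl

theorem permute_sub (σ : Equiv.Perm (Fin m)) (M M' : Matrix (Fin m → Fin N) (Fin m → Fin N) S) :
    permute σ (M - M') = permute σ M - permute σ M' := rfl

theorem permute_mul (σ : Equiv.Perm (Fin m)) (M M' : Matrix (Fin m → Fin N) (Fin m → Fin N) S) :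
    permute σ (M * M') = permute σ M * permute σ M' :=
  Matrix.submatrix_mul M M' _ _ _ (σ.arrowCongr (Equiv.refl (Fin N))).symm.bijective

theorem permute_legs (σ : Equiv.Perm (Fin m)) (r s : Fin m) (A : End2 N S) :
    permute σ (legs r s A) = legs (σ r) (σ s) A := by
  ext a b
  rw [permute_apply, legs_apply, legs_apply]
  congr 1
  refine propext ⟨fun h p h1 h2 => ?_, fun h p h1 h2 => h (σ p) (by simpa) (by simpa)⟩
  have := h (σ.symm p) (fun h' => h1 (by rw [← h', Equiv.apply_symm_apply]))
    (fun h' => h2 (by rw [← h', Equiv.apply_symm_apply]))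
  simpa using this

theorem legs_triple_left (A B C : End2 N S) (a b : Fin 3 → Fin N) :
    (legs 0 1 A * legs 0 2 B * legs 1 2 C : Matrix (Fin 3 → Fin N) (Fin 3 → Fin N) S) a b =
      tripleL A B C (a 0) (a 1) (a 2) (b 0) (b 1) (b 2) := by
  rw [Matrix.mul_assoc, legs_mul_apply (by decide), tripleL, Fintype.sum_prod_type]
  refine Finset.sum_congr rfl fun k _ => Finset.sum_congr rfl fun l _ => ?_
  rw [legs_mul_apply (by decide), Fintype.sum_prod_type, Finset.sum_eq_single (b 0)]
  · rw [Finset.mul_sum]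
    refine Finset.sum_congr rfl fun m _ => ?_
    rw [legs_apply, if_pos]
    · simp [mul_assoc]
    · intro p; fin_cases p <;> simp
  · intro p _ hp
    refine Finset.sum_eq_zero fun m _ => ?_
    rw [legs_apply, if_neg, mul_zero]
    intro h
    have := h 0 (by decide) (by decide)
    simp only [ne_eq, Fin.reduceEq, not_false_eq_true, Function.update_of_ne, Function.update_self] at this
    exact hp this
  · simp

theorem legs_triple_right (A B C : End2 N S) (a b : Fin 3 → Fin N) :
    (legs 1 2 C * legs 0 2 B * legs 0 1 A : Matrix (Fin 3 → Fin N) (Fin 3 → Fin N) S) a b =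
      tripleR A B C (a 0) (a 1) (a 2) (b 0) (b 1) (b 2) := by
  rw [Matrix.mul_assoc, legs_mul_apply (by decide), tripleR, Fintype.sum_prod_type]
  conv_rhs => rw [Finset.sum_comm]
  refine Finset.sum_congr rfl fun l _ => ?_
  conv_rhs => rw [Finset.sum_comm]
  refine Finset.sum_congr rfl fun m _ => ?_
  rw [legs_mul_apply (by decide), Fintype.sum_prod_type, Finset.mul_sum]
  refine Finset.sum_congr rfl fun k _ => ?_
  rw [Finset.sum_eq_single (b 2)]
  · rw [legs_apply, if_pos]
    · simp [mul_assoc]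
    · intro p; fin_cases p <;> simp
  · intro p _ hp
    rw [legs_apply, if_neg, mul_zero]
    intro h
    have := h 2 (by decide) (by decide)
    simp only [Function.update_self] at this
    exact hp this
  · simp

end Legs

/-- At `q = 1` the coefficients of `P` and `Q` and the off-diagonal part of `R` vanish. This
degeneration drives the `h`-adic induction. -/
theorem Rplus_one (X : LieType) (n : ℕ) {S : Type*} [CommRing S] (x : S) :
    Rplus X n x 1 = (x - 1) ^ 2 • 1 := by
  ext ⟨a, b⟩ ⟨c, e⟩
  rw [Rplus_apply, opR_apply, Matrix.smul_apply, Matrix.one_apply]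
  simp only [qOf, xi, one_pow, inv_one, Units.val_one, one_zpow, sub_self, zero_mul, ite_self,
    mul_zero, add_zero, sub_zero, one_mul, Prod.mk.injEq, smul_eq_mul]
  split_ifs <;> ring

/-! ### Symmetries of the Yang–Baxter difference. -/

section Unitary
variable {S : Type*} [CommRing S] [IsDomain S] (X : LieType) (n : ℕ) (t : Sˣ)

omit [IsDomain S] in
theorem uscal_comm (x x' : S) : uscal X n x x' t = uscal X n x' x t := by
  unfold uscal; ring

theorem legs_mul_legs {m : ℕ} {r s : Fin m} (hrs : r ≠ s) {x x' : S} (hx : x * x' = 1) :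
    legs r s (Rplus X n x t) * legs s r (Rplus X n x' t) = uscal X n x x' t • 1 := by
  rw [← legs_swap r s, legs_mul hrs, Rplus_mul_swap X n hx, legs_smul, legs_one]

/-- The difference of the two sides of the Yang–Baxter equation. -/
def yb (x y : S) : Matrix (Fin 3 → Fin (dim X n)) (Fin 3 → Fin (dim X n)) S :=
  legs 0 1 (Rplus X n x t) * legs 0 2 (Rplus X n (x * y) t) * legs 1 2 (Rplus X n y t) -
    legs 1 2 (Rplus X n y t) * legs 0 2 (Rplus X n (x * y) t) * legs 0 1 (Rplus X n x t)

/-- After the swap both products contain `R₂₁(x)` at an end, on opposite sides. Multiplying by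
`R₁₂(x⁻¹)` on both sides cancels it where it stands and adds a factor at the other end; the result
is the difference for `(x⁻¹, xy)` with the products interchanged. -/
theorem mul_permute_yb_mul {x x' y : S} (hx : x * x' = 1) :
    legs 0 1 (Rplus X n x' t) * permute (Equiv.swap 0 1) (yb X n t x y) *
      legs 0 1 (Rplus X n x' t) = -uscal X n x x' t • yb X n t x' (x * y) := by
  have h1 := legs_mul_legs X n t (r := (0 : Fin 3)) (s := 1) (by decide) ((mul_comm x' x).trans hx)
  have h2 := legs_mul_legs X n t (r := (1 : Fin 3)) (s := 0) (by decide) hx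
  have h3 : x' * (x * y) = y := by rw [← mul_assoc, mul_comm x', hx, one_mul]
  have e0 : Equiv.swap (0 : Fin 3) 1 0 = 1 := by decide
  have e1 : Equiv.swap (0 : Fin 3) 1 1 = 0 := by decide
  have e2 : Equiv.swap (0 : Fin 3) 1 2 = 2 := by decide
  rw [uscal_comm] at h1
  simp only [yb, permute_sub, permute_mul, permute_legs, e0, e1, e2, h3]
  rw [mul_sub, sub_mul, neg_smul, ← smul_neg, neg_sub, smul_sub]
  congr 1
  · rw [mul_assoc (legs 1 0 _), ← mul_assoc (legs 0 1 _), h1, smul_mul_assoc, one_mul,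
      smul_mul_assoc]
  · rw [mul_assoc, mul_assoc, h2, mul_smul_comm, mul_one, mul_smul_comm, mul_assoc]

omit [IsDomain S] in
-- Multiplying an identity of triple products by the inverses of both sides gives the identity of
-- the inverses; here the inverses are known up to scalars.
theorem sandwich {M : Type*} [Ring M] [Algebra S M] {A B C A' B' C' : M} {α β γ : S}
    (hA : A' * A = α • (1 : M)) (hB : B' * B = β • (1 : M)) (hC : C' * C = γ • (1 : M))
    (hA' : A * A' = α • (1 : M)) (hB' : B * B' = β • (1 : M)) (hC' : C * C' = γ • (1 : M)) :
    A' * B' * C' * (C * B * A - A * B * C) * (C' * B' * A') =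
      (α * β * γ) • (C' * B' * A' - A' * B' * C') := by
  have e1 : A' * B' * C' * (C * B * A) = (α * β * γ) • (1 : M) := by
    calc _ = A' * (B' * (C' * C) * B) * A := by noncomm_ring
      _ = _ := by
        simp only [hC, hB, hA, mul_smul_comm, smul_mul_assoc, mul_one, smul_smul]
        congr 1; ring
  have e2 : A * B * C * (C' * B' * A') = (α * β * γ) • (1 : M) := by
    calc _ = A * (B * (C * C') * B') * A' := by noncomm_ring
      _ = _ := by
        simp only [hC', hB', hA', mul_smul_comm, smul_mul_assoc, mul_one, smul_smul]
        congr 1; ring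
  rw [mul_sub, sub_mul, e1, mul_assoc _ (A * B * C), e2, smul_mul_assoc, one_mul, mul_smul_comm,
    mul_one, smul_sub]

theorem mul_permute_yb_mul' {x x' y y' : S} (hx : x * x' = 1) (hy : y * y' = 1) :
    legs 0 1 (Rplus X n y' t) * legs 0 2 (Rplus X n (y' * x') t) * legs 1 2 (Rplus X n x' t) *
      permute (Equiv.swap 0 2) (yb X n t x y) *
      (legs 1 2 (Rplus X n x' t) * legs 0 2 (Rplus X n (y' * x') t) * legs 0 1 (Rplus X n y' t)) =
      (-(uscal X n y y' t * uscal X n (x * y) (y' * x') t * uscal X n x x' t)) •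
        yb X n t y' x' := by
  have e0 : Equiv.swap (0 : Fin 3) 2 0 = 2 := by decide
  have e1 : Equiv.swap (0 : Fin 3) 2 1 = 1 := by decide
  have e2 : Equiv.swap (0 : Fin 3) 2 2 = 0 := by decide
  have hxy : x * y * (y' * x') = 1 := by linear_combination y * y' * hx + hy
  simp only [yb, permute_sub, permute_mul, permute_legs, e0, e1, e2]
  rw [sandwich (α := uscal X n y y' t) (β := uscal X n (x * y) (y' * x') t)
    (γ := uscal X n x x' t), neg_smul, ← smul_neg, neg_sub]
  · rw [legs_mul_legs X n t (by decide) ((mul_comm _ _).trans hy), uscal_comm]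
  · rw [legs_mul_legs X n t (by decide) ((mul_comm _ _).trans hxy), uscal_comm]
  · rw [legs_mul_legs X n t (by decide) ((mul_comm _ _).trans hx), uscal_comm]
  · rw [legs_mul_legs X n t (by decide) hy]
  · rw [legs_mul_legs X n t (by decide) hxy]
  · rw [legs_mul_legs X n t (by decide) hx]

omit [IsDomain S] in
theorem wt_mul_wt (a b c : Fin (dim X n)) : wt X n t a b * wt X n t b c = wt X n t a c := by
  have h : ((eps X n b : ℤ) : S) * (eps X n b : S) = 1 := by
    rw [← Int.cast_mul, eps_sq, Int.cast_one]
  have h2 : t ^ (twoBar X n a - twoBar X n c) =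
      t ^ (twoBar X n a - twoBar X n b) * t ^ (twoBar X n b - twoBar X n c) := by
    rw [← zpow_add]; congr 1; ring
  simp only [wt, h2]
  push_cast
  linear_combination ((t ^ (twoBar X n a - twoBar X n b) : Sˣ) : S) *
    ((t ^ (twoBar X n b - twoBar X n c) : Sˣ) : S) * (eps X n a : S) * (eps X n c : S) * h

omit [IsDomain S] in
theorem wt_self (a : Fin (dim X n)) : wt X n t a a = 1 := by
  simp [wt, eps_sq]

/-- Transposition of the first tensor factor. -/
theorem wt_mul_yb {x x' y y' : S} (hx : x * x' = 1) (hy : y * y' = 1)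
    (a b c d e f : Fin (dim X n)) :
    wt X n t d.rev a.rev * yb X n t x y ![a, b, c] ![d, e, f] =
      -(x ^ 2 * ((xi X n t)⁻¹ : Sˣ) * ((x * y) ^ 2 * ((xi X n t)⁻¹ : Sˣ))) *
        permute (Equiv.swap 0 2) (yb X n t y ((xi X n t : Sˣ) * (x' * y')))
          ![d.rev, c, b] ![a.rev, f, e] := by
  have e0 : Equiv.swap (0 : Fin 3) 2 0 = 2 := by decide
  have e1 : Equiv.swap (0 : Fin 3) 2 1 = 1 := by decide
  have e2 : Equiv.swap (0 : Fin 3) 2 2 = 0 := by decide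
  have hxy : x * y * (x' * y') = 1 := by linear_combination y * y' * hx + hy
  have hw : y * ((xi X n t : Sˣ) * (x' * y')) = (xi X n t : Sˣ) * x' := by
    linear_combination (xi X n t : Sˣ) * x' * hy
  have key1 := Rplus_cross X n hx t
  have key2 := Rplus_cross X n hxy t
  simp only [yb, permute_sub, permute_mul, permute_legs, e0, e1, e2, hw]
  rw [← legs_swap 0 1, ← legs_swap 0 2, ← legs_swap 1 2, Matrix.sub_apply, Matrix.sub_apply,
    legs_triple_left, legs_triple_right, legs_triple_left, legs_triple_right]
  simp only [Matrix.cons_val]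
  -- Crossing is applied to the two factors acting on the first position. Their order is reversed by
  -- the transposition, so each side of the equation becomes the opposite side of a permuted one,
  -- whence the minus sign. The weights multiply along the summation index by `wt_mul_wt`.
  have hL : wt X n t d.rev a.rev * tripleL (Rplus X n x t) (Rplus X n (x * y) t) (Rplus X n y t)
      a b c d e f = (x ^ 2 * ((xi X n t)⁻¹ : Sˣ) * ((x * y) ^ 2 * ((xi X n t)⁻¹ : Sˣ))) *
      tripleL ((Rplus X n ((xi X n t : Sˣ) * (x' * y')) t).submatrix Prod.swap Prod.swap)
        ((Rplus X n ((xi X n t : Sˣ) * x') t).submatrix Prod.swap Prod.swap)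
        ((Rplus X n y t).submatrix Prod.swap Prod.swap) d.rev c b a.rev f e := by
    rw [tripleL, tripleL, ← Equiv.sum_comp Fin.revPerm, Finset.mul_sum, Finset.mul_sum]
    refine Finset.sum_congr rfl fun k _ => ?_
    conv_rhs => rw [Finset.sum_comm]
    rw [Finset.mul_sum, Finset.mul_sum]
    refine Finset.sum_congr rfl fun l _ => ?_
    rw [Finset.mul_sum, Finset.mul_sum]
    refine Finset.sum_congr rfl fun m _ => ?_
    simp only [Matrix.submatrix_apply, Prod.swap_prod_mk, Fin.revPerm_apply]
    have k1 := key1 k b a.rev l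
    have k2 := key2 d.rev c k m
    rw [Fin.rev_rev] at k1 k2
    rw [← wt_mul_wt X n t d.rev k a.rev]
    linear_combination (wt X n t d.rev k * Rplus X n (x * y) t (k.rev, c) (d, m) *
      Rplus X n y t (l, m) (e, f)) * k1 + (x ^ 2 * ((xi X n t)⁻¹ : Sˣ) *
      Rplus X n ((xi X n t : Sˣ) * x') t (b, k) (l, a.rev) * Rplus X n y t (l, m) (e, f)) * k2
  have hR : wt X n t d.rev a.rev * tripleR (Rplus X n x t) (Rplus X n (x * y) t) (Rplus X n y t)
      a b c d e f = (x ^ 2 * ((xi X n t)⁻¹ : Sˣ) * ((x * y) ^ 2 * ((xi X n t)⁻¹ : Sˣ))) *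
      tripleR ((Rplus X n ((xi X n t : Sˣ) * (x' * y')) t).submatrix Prod.swap Prod.swap)
        ((Rplus X n ((xi X n t : Sˣ) * x') t).submatrix Prod.swap Prod.swap)
        ((Rplus X n y t).submatrix Prod.swap Prod.swap) d.rev c b a.rev f e := by
    rw [tripleR, tripleR, ← Equiv.sum_comp Fin.revPerm, Finset.mul_sum, Finset.mul_sum]
    refine Finset.sum_congr rfl fun k _ => ?_
    conv_rhs => rw [Finset.sum_comm]
    rw [Finset.mul_sum, Finset.mul_sum]
    refine Finset.sum_congr rfl fun l _ => ?_
    rw [Finset.mul_sum, Finset.mul_sum]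
    refine Finset.sum_congr rfl fun m _ => ?_
    simp only [Matrix.submatrix_apply, Prod.swap_prod_mk, Fin.revPerm_apply]
    have k1 := key1 d.rev l k e
    have k2 := key2 k m a.rev f
    rw [Fin.rev_rev] at k1 k2
    rw [← wt_mul_wt X n t d.rev k a.rev]
    linear_combination (wt X n t k a.rev * Rplus X n (x * y) t (a, m) (k.rev, f) *
      Rplus X n y t (b, c) (l, m)) * k1 + (x ^ 2 * ((xi X n t)⁻¹ : Sˣ) *
      Rplus X n ((xi X n t : Sˣ) * x') t (l, d.rev) (e, k) * Rplus X n y t (b, c) (l, m)) * k2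
  rw [mul_sub, hL, hR]
  ring

end Unitary

/-! ### The induction on powers of the variable. -/

section Adic
variable {k : Type*} [Field k] {ι : Type*} [Fintype ι] [DecidableEq ι]

/-- A matrix that reduces to a scalar matrix modulo the variable. -/
def IsScalarMod (A : Matrix ι ι (PowerSeries k)) (u : PowerSeries k) : Prop :=
  ∀ i j, (PowerSeries.X : PowerSeries k) ∣ (A - u • 1) i j

theorem IsScalarMod.mul {A B : Matrix ι ι (PowerSeries k)} {u v : PowerSeries k}
    (hA : IsScalarMod A u) (hB : IsScalarMod B v) : IsScalarMod (A * B) (u * v) := by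
  intro i j
  have : A * B - (u * v) • 1 = (A - u • 1) * B + u • (B - v • 1) := by
    rw [sub_mul, smul_mul_assoc, one_mul, smul_sub, smul_smul]; abel
  rw [this, Matrix.add_apply, Matrix.mul_apply, Matrix.smul_apply]
  exact dvd_add (Finset.dvd_sum fun l _ => (hA i l).mul_right _) ((hB i j).mul_left _)

theorem IsScalarMod.dvd_mul_sub {A Y : Matrix ι ι (PowerSeries k)} {u : PowerSeries k} {m : ℕ}
    (hA : IsScalarMod A u) (hY : ∀ i j, (PowerSeries.X : PowerSeries k) ^ m ∣ Y i j) (i j : ι) :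
    (PowerSeries.X : PowerSeries k) ^ (m + 1) ∣ (A * Y) i j - u * Y i j := by
  have : (A * Y) i j - u * Y i j = ((A - u • 1) * Y) i j := by
    rw [sub_mul, smul_mul_assoc, one_mul]; rfl
  rw [this, Matrix.mul_apply, pow_succ']
  exact Finset.dvd_sum fun l _ => mul_dvd_mul (hA i l) (hY l j)

theorem IsScalarMod.dvd_sub_mul {A Y : Matrix ι ι (PowerSeries k)} {u : PowerSeries k} {m : ℕ}
    (hA : IsScalarMod A u) (hY : ∀ i j, (PowerSeries.X : PowerSeries k) ^ m ∣ Y i j) (i j : ι) :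
    (PowerSeries.X : PowerSeries k) ^ (m + 1) ∣ (Y * A) i j - u * Y i j := by
  have : (Y * A) i j - u * Y i j = (Y * (A - u • 1)) i j := by
    rw [mul_sub, mul_smul_comm, mul_one]; rfl
  rw [this, Matrix.mul_apply, pow_succ]
  exact Finset.dvd_sum fun l _ => mul_dvd_mul (hY i l) (hA l j)

/-- When `Y` is already divisible by `X^m`, the nonscalar parts of `A` and `B` contribute only
multiples of `X^{m+1}`. Modulo that power the sandwich multiplies each entry of `Y` by a unit. -/
theorem dvd_of_sandwich {A B Y : Matrix ι ι (PowerSeries k)} {u v : PowerSeries k} {m : ℕ}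
    (hA : IsScalarMod A u) (hB : IsScalarMod B v) (hu : IsUnit u) (hv : IsUnit v)
    (hY : ∀ i j, (PowerSeries.X : PowerSeries k) ^ m ∣ Y i j) {i j : ι}
    (h : (PowerSeries.X : PowerSeries k) ^ (m + 1) ∣ (A * Y * B) i j) :
    (PowerSeries.X : PowerSeries k) ^ (m + 1) ∣ Y i j := by
  have hAY : ∀ i j, (PowerSeries.X : PowerSeries k) ^ m ∣ (A * Y) i j := fun i j =>
    Matrix.mul_apply (M := A) ▸ Finset.dvd_sum fun l _ => (hY l j).mul_left _
  have h1 := hB.dvd_sub_mul hAY i j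
  have h2 := hA.dvd_mul_sub hY i j
  rw [dvd_sub_right h] at h1
  rw [dvd_sub_right (hv.dvd_mul_left.mp h1)] at h2
  exact hu.dvd_mul_left.mp h2

end Adic

section Generic
variable {k : Type*} [CommRing k]

/-- Values of the two spectral parameters at which all the operators involved are invertible. -/
structure Generic (x y : PowerSeries k) : Prop where
  x_ne : PowerSeries.constantCoeff x ≠ 0
  y_ne : PowerSeries.constantCoeff y ≠ 0
  x_ne_one : PowerSeries.constantCoeff x ≠ 1
  y_ne_one : PowerSeries.constantCoeff y ≠ 1
  xy_ne_one : PowerSeries.constantCoeff x * PowerSeries.constantCoeff y ≠ 1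

end Generic

section Induction
variable {k : Type*} [Field k] (X : LieType) (n : ℕ) {t : (PowerSeries k)ˣ}
  (ht : PowerSeries.constantCoeff (t : PowerSeries k) = 1)

/-- The symmetries change the parameters, so the induction must run over all generic pairs; this and
the next two lemmas show that such pairs are preserved. -/
theorem Generic.inv_mul {x y : PowerSeries k} (g : Generic x y) : Generic x⁻¹ (x * y) := by
  obtain ⟨h1, h2, h3, h4, h5⟩ := g
  constructor <;> simp only [map_mul, PowerSeries.constantCoeff_inv, ne_eq, inv_eq_zero, inv_eq_one,
    mul_eq_zero, not_or, inv_mul_cancel_left₀ h1]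
  exacts [h1, ⟨h1, h2⟩, h3, h5, h4]

theorem Generic.inv_inv {x y : PowerSeries k} (g : Generic x y) : Generic y⁻¹ x⁻¹ := by
  obtain ⟨h1, h2, h3, h4, h5⟩ := g
  constructor <;> simp only [PowerSeries.constantCoeff_inv, ne_eq, inv_eq_zero, inv_eq_one,
    ← mul_inv_rev]
  exacts [h2, h1, h4, h3, h5]

theorem Generic.mirror {x y z : PowerSeries k} (g : Generic x y)
    (hz : PowerSeries.constantCoeff z = 1) : Generic y (z * (x⁻¹ * y⁻¹)) := by
  obtain ⟨h1, h2, h3, h4, h5⟩ := g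
  constructor <;> simp only [map_mul, hz, one_mul, PowerSeries.constantCoeff_inv, ne_eq,
    inv_eq_zero, mul_eq_zero, not_or]
  · exact h2
  · exact ⟨h1, h2⟩
  · exact h4
  · rwa [mul_comm, ← mul_inv_rev, inv_eq_one]
  · rwa [mul_comm, mul_assoc, inv_mul_cancel₀ h2, mul_one, inv_eq_one]

include ht

theorem map_constantCoeff_eq_one :
    Units.map ((PowerSeries.constantCoeff : PowerSeries k →+* k) : PowerSeries k →* k) t = 1 :=
  Units.ext ht

theorem constantCoeff_xi : PowerSeries.constantCoeff ((xi X n t : (PowerSeries k)ˣ) : PowerSeries k)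
    = 1 := by
  have := xi_map X n (PowerSeries.constantCoeff : PowerSeries k →+* k) t
  rw [map_constantCoeff_eq_one ht] at this
  have h1 : xi X n (1 : kˣ) = 1 := by simp [xi, qOf]
  rw [h1] at this
  exact (congrArg Units.val this).symm

theorem isScalarMod_legs {m : ℕ} (r s : Fin m) (x : PowerSeries k) :
    IsScalarMod (legs r s (Rplus X n x t)) ((x - 1) ^ 2) := by
  intro a b
  have h := Rplus_map X n (PowerSeries.constantCoeff : PowerSeries k →+* k) x t
  rw [map_constantCoeff_eq_one ht, Rplus_one] at h
  have h1 : legs r s (Rplus X n x t) - (x - 1) ^ 2 • 1 =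
      legs r s (Rplus X n x t - (x - 1) ^ 2 • 1) := by
    rw [← legs_one (N := dim X n) r s, ← legs_smul]
    ext a b
    simp only [Matrix.sub_apply, legs_apply]
    split_ifs <;> simp
  rw [h1, legs_apply]
  split_ifs
  · rw [PowerSeries.X_dvd_iff, Matrix.sub_apply, map_sub]
    have h2 := congrFun (congrFun h (a r, a s)) (b r, b s)
    rw [Matrix.map_apply] at h2
    rw [h2, Matrix.smul_apply, Matrix.smul_apply, Matrix.one_apply, Matrix.one_apply]
    split_ifs <;> simp
  · exact dvd_zero _

omit ht in
theorem isUnit_sub_one_sq {x : PowerSeries k} (h : PowerSeries.constantCoeff x ≠ 1) :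
    IsUnit ((x - 1) ^ 2) := by
  rw [PowerSeries.isUnit_iff_constantCoeff]
  simpa [sub_eq_zero] using h

variable {m : ℕ} (hm : ∀ x y, Generic x y → ∀ a b, (PowerSeries.X : PowerSeries k) ^ m ∣ yb X n t x y a b)

include hm

theorem dvd_permute_swap01 {x y : PowerSeries k} (g : Generic x y)
    {a b : Fin 3 → Fin (dim X n)}
    (h : ∀ x y, Generic x y → (PowerSeries.X : PowerSeries k) ^ (m + 1) ∣ yb X n t x y a b) :
    (PowerSeries.X : PowerSeries k) ^ (m + 1) ∣ permute (Equiv.swap 0 1) (yb X n t x y) a b := by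
  have s1 := isScalarMod_legs X n ht (m := 3) 0 1 x⁻¹
  refine dvd_of_sandwich (Y := permute (Equiv.swap 0 1) (yb X n t x y)) s1 s1
    (isUnit_sub_one_sq g.inv_mul.x_ne_one) (isUnit_sub_one_sq g.inv_mul.x_ne_one)
    (fun i j => hm x y g _ _) ?_
  rw [mul_permute_yb_mul X n t (PowerSeries.mul_inv_cancel x g.x_ne)]
  exact (h _ _ g.inv_mul).mul_left _

theorem dvd_permute_swap02 {x y : PowerSeries k} (g : Generic x y)
    {a b : Fin 3 → Fin (dim X n)}
    (h : ∀ x y, Generic x y → (PowerSeries.X : PowerSeries k) ^ (m + 1) ∣ yb X n t x y a b) :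
    (PowerSeries.X : PowerSeries k) ^ (m + 1) ∣ permute (Equiv.swap 0 2) (yb X n t x y) a b := by
  have u1 := isUnit_sub_one_sq g.inv_inv.x_ne_one
  have u2 := isUnit_sub_one_sq g.inv_inv.y_ne_one
  have u3 := isUnit_sub_one_sq (x := y⁻¹ * x⁻¹) (by rw [map_mul]; exact g.inv_inv.xy_ne_one)
  have s1 := fun r s => isScalarMod_legs X n ht (m := 3) r s y⁻¹
  have s2 := fun r s => isScalarMod_legs X n ht (m := 3) r s x⁻¹
  have s3 := fun r s => isScalarMod_legs X n ht (m := 3) r s (y⁻¹ * x⁻¹)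
  refine dvd_of_sandwich (Y := permute (Equiv.swap 0 2) (yb X n t x y))
    (((s1 0 1).mul (s3 0 2)).mul (s2 1 2)) (((s2 1 2).mul (s3 0 2)).mul (s1 0 1))
    ((u1.mul u3).mul u2) ((u2.mul u3).mul u1) (fun i j => hm x y g _ _) ?_
  rw [mul_permute_yb_mul' X n t (PowerSeries.mul_inv_cancel x g.x_ne)
    (PowerSeries.mul_inv_cancel y g.y_ne)]
  exact (h _ _ g.inv_inv).mul_left _

/-- The weight in `wt_mul_yb` is a unit, so crossing reduces the entry to one of a permuted
difference, which `dvd_permute_swap02` handles. -/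
theorem dvd_yb_mirror {x y : PowerSeries k} (g : Generic x y) {a b c d e f : Fin (dim X n)}
    (h : ∀ x y, Generic x y → (PowerSeries.X : PowerSeries k) ^ (m + 1) ∣
      yb X n t x y ![d.rev, c, b] ![a.rev, f, e]) :
    (PowerSeries.X : PowerSeries k) ^ (m + 1) ∣ yb X n t x y ![a, b, c] ![d, e, f] := by
  have hu : IsUnit (wt X n t d.rev a.rev) :=
    IsUnit.of_mul_eq_one _ ((wt_mul_wt X n t d.rev a.rev d.rev).trans (wt_self X n t d.rev))
  rw [← hu.dvd_mul_left, wt_mul_yb X n t (PowerSeries.mul_inv_cancel x g.x_ne)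
    (PowerSeries.mul_inv_cancel y g.y_ne)]
  exact (dvd_permute_swap02 X n ht hm (g.mirror (constantCoeff_xi X n ht)) h).mul_left _

omit ht hm in
theorem yb_apply (x y : PowerSeries k) (a b c d e f : Fin (dim X n)) :
    yb X n t x y ![a, b, c] ![d, e, f] =
      tripleL (Rplus X n x t) (Rplus X n (x * y) t) (Rplus X n y t) a b c d e f -
        tripleR (Rplus X n x t) (Rplus X n (x * y) t) (Rplus X n y t) a b c d e f := by
  rw [yb, Matrix.sub_apply, legs_triple_left, legs_triple_right]
  rfl

theorem entrySet_dvd : EntrySet fun a b c d e f : Fin (dim X n) =>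
    ∀ x y, Generic x y →
      (PowerSeries.X : PowerSeries k) ^ (m + 1) ∣ yb X n t x y ![a, b, c] ![d, e, f] := by
  have w01 : ∀ a b c : Fin (dim X n), ![a, b, c] ∘ Equiv.swap (0 : Fin 3) 1 = ![b, a, c] := by
    intro a b c; funext i; fin_cases i <;> rfl
  have w02 : ∀ a b c : Fin (dim X n), ![a, b, c] ∘ Equiv.swap (0 : Fin 3) 2 = ![c, b, a] := by
    intro a b c; funext i; fin_cases i <;> rfl
  have swap12 : ∀ {a b c d e f : Fin (dim X n)}, (∀ x y, Generic x y →
      (PowerSeries.X : PowerSeries k) ^ (m + 1) ∣ yb X n t x y ![a, b, c] ![d, e, f]) →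
      ∀ x y, Generic x y →
      (PowerSeries.X : PowerSeries k) ^ (m + 1) ∣ yb X n t x y ![b, a, c] ![e, d, f] := by
    intro a b c d e f h x y g
    have := dvd_permute_swap01 X n ht hm g h
    rwa [permute_apply, w01, w01] at this
  have swap13 : ∀ {a b c d e f : Fin (dim X n)}, (∀ x y, Generic x y →
      (PowerSeries.X : PowerSeries k) ^ (m + 1) ∣ yb X n t x y ![a, b, c] ![d, e, f]) →
      ∀ x y, Generic x y →
      (PowerSeries.X : PowerSeries k) ^ (m + 1) ∣ yb X n t x y ![c, b, a] ![f, e, d] := by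
    intro a b c d e f h x y g
    have := dvd_permute_swap02 X n ht hm g h
    rwa [permute_apply, w02, w02] at this
  have base : ∀ {a b c d e f : Fin (dim X n)},
      (∀ x y : FractionRing (PowerSeries k), ∀ t : (FractionRing (PowerSeries k))ˣ,
      tripleL ((datum X n t).R x) ((datum X n t).R (x * y)) ((datum X n t).R y) a b c d e f =
      tripleR ((datum X n t).R x) ((datum X n t).R (x * y)) ((datum X n t).R y) a b c d e f) →
      ∀ x y, Generic x y →
      (PowerSeries.X : PowerSeries k) ^ (m + 1) ∣ yb X n t x y ![a, b, c] ![d, e, f] := by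
    intro a b c d e f h x y _
    rw [yb_apply, triple_of_datum X n x y t h, sub_self]
    exact dvd_zero _
  exact {
    swap12 := swap12
    swap13 := swap13
    -- The mirror relation also interchanges the second and third factors; the three swaps undo
    -- this.
    flip := fun h x y g => dvd_yb_mirror X n ht hm g (by
      simpa only [Fin.rev_rev] using swap12 (swap13 (swap12 h)))
    no_pair := fun h1 h2 h3 => base fun x y t => (datum X n t).triple_of_no_pair x y h1 h2 h3 _ _ _
    flip_fix_flip := fun h1 h2 => base fun x y t => (datum X n t).triple_flip_fix_flip x y h1 h2
    flip_rotate := fun h1 h2 => base fun x y t => (datum X n t).triple_flip_rotate x y h1 h2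
    flip_fix_flip_self := fun hb => base fun x y t =>
      (datum X n t).triple_flip_fix_flip_self x y hb
    middle := fun {i} hi => base fun x y t => by
      rw [Datum.tripleR_eq_tripleL, ← hi] }

theorem dvd_yb_succ {x y : PowerSeries k} (g : Generic x y) (a b : Fin 3 → Fin (dim X n)) :
    (PowerSeries.X : PowerSeries k) ^ (m + 1) ∣ yb X n t x y a b := by
  have hv : ∀ a : Fin 3 → Fin (dim X n), a = ![a 0, a 1, a 2] := fun a => by
    funext i; fin_cases i <;> rfl
  have E := entrySet_dvd X n ht hm
  rw [hv a, hv b]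
  -- A nonzero entry has a nonzero summand in one of the two triple sums, and the supports of its
  -- factors provide the matching.
  by_cases h : yb X n t x y ![a 0, a 1, a 2] ![b 0, b 1, b 2] = 0
  · rw [h]; exact dvd_zero _
  rw [yb_apply] at h
  have hs : ∀ z : PowerSeries k, ∀ {a b c e : Fin (dim X n)}, Rplus X n z t (a, b) (c, e) ≠ 0 →
      Supp a b c e := fun z a b c e h => by
    by_contra h'
    exact h (Rplus_apply_eq_zero X n z t h')
  have h : tripleL (Rplus X n x t) (Rplus X n (x * y) t) (Rplus X n y t)
        (a 0) (a 1) (a 2) (b 0) (b 1) (b 2) ≠ 0 ∨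
      tripleR (Rplus X n x t) (Rplus X n (x * y) t) (Rplus X n y t)
        (a 0) (a 1) (a 2) (b 0) (b 1) (b 2) ≠ 0 := by
    by_contra! h'
    exact h (by rw [h'.1, h'.2, sub_zero])
  rcases h with h | h
  · rw [tripleL] at h
    obtain ⟨k, _, h⟩ := Finset.exists_ne_zero_of_sum_ne_zero h
    obtain ⟨l, _, h⟩ := Finset.exists_ne_zero_of_sum_ne_zero h
    obtain ⟨m, _, h⟩ := Finset.exists_ne_zero_of_sum_ne_zero h
    exact E.of_supp_left (hs _ (left_ne_zero_of_mul (left_ne_zero_of_mul h)))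
      (hs _ (right_ne_zero_of_mul (left_ne_zero_of_mul h))) (hs _ (right_ne_zero_of_mul h)) x y g
  · rw [tripleR] at h
    obtain ⟨k, _, h⟩ := Finset.exists_ne_zero_of_sum_ne_zero h
    obtain ⟨l, _, h⟩ := Finset.exists_ne_zero_of_sum_ne_zero h
    obtain ⟨m, _, h⟩ := Finset.exists_ne_zero_of_sum_ne_zero h
    exact E.of_supp_right (hs _ (left_ne_zero_of_mul (left_ne_zero_of_mul h)))
      (hs _ (right_ne_zero_of_mul (left_ne_zero_of_mul h))) (hs _ (right_ne_zero_of_mul h)) x y g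

omit hm in
theorem dvd_yb (m : ℕ) : ∀ x y, Generic x y → ∀ a b,
    (PowerSeries.X : PowerSeries k) ^ m ∣ yb X n t x y a b := by
  induction m with
  | zero => intro x y _ a b; rw [pow_zero]; exact one_dvd _
  | succ m ih => exact fun x y g a b => dvd_yb_succ X n ht ih g a b

omit hm in
theorem yang_baxter {x y : PowerSeries k} (g : Generic x y) :
    legs (m := 3) 0 1 (Rplus X n x t) * legs 0 2 (Rplus X n (x * y) t) * legs 1 2 (Rplus X n y t) =
      legs 1 2 (Rplus X n y t) * legs 0 2 (Rplus X n (x * y) t) * legs 0 1 (Rplus X n x t) := by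
  rw [← sub_eq_zero]
  refine Matrix.ext fun a b => ?_
  have h := fun m => PowerSeries.X_pow_dvd_iff.mp (dvd_yb X n ht m x y g a b)
  exact PowerSeries.ext fun m => (h (m + 1) m (Nat.lt_succ_self m)).trans (map_zero _).symm

end Induction

/-! ### Laurent series, Hasse derivatives and the substitutions in `u`. -/

open Finset.HasAntidiagonal (antidiagonal mem_antidiagonal)

section Laurent
variable {A : Type*} [CommRing A]

theorem exists_coeff_eq_zero_of_lt (f : LaurentSeries A) : ∃ a : ℤ, ∀ p < a, f.coeff p = 0 :=
  ⟨f.order, fun _ hp => HahnSeries.coeff_eq_zero_of_lt_order hp⟩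

theorem coeff_mul_eq_sum {f g : LaurentSeries A} {a b : ℤ} (hf : ∀ p < a, f.coeff p = 0)
    (hg : ∀ p < b, g.coeff p = 0) (m : ℤ) :
    (f * g).coeff m = ∑ p ∈ Finset.Icc a (m - b), f.coeff p * g.coeff (m - p) := by
  rw [HahnSeries.coeff_mul]
  apply Finset.sum_of_injOn Prod.fst
  · rintro ⟨i, j⟩ hi ⟨i', j'⟩ hi' h
    simp only [Finset.mem_coe, Finset.mem_antidiagonal] at hi hi'
    simp only at h
    rw [Prod.mk.injEq]
    omega
  · rintro ⟨i, j⟩ hi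
    simp only [Finset.mem_coe, Finset.mem_antidiagonal, HahnSeries.mem_support] at hi
    rw [Finset.mem_coe, Finset.mem_Icc]
    have h1 : ¬ i < a := fun h => hi.1 (hf i h)
    have h2 : ¬ j < b := fun h => hi.2.1 (hg j h)
    dsimp only
    omega
  · intro i _ hi
    by_contra h
    refine hi ⟨(i, m - i), ?_, rfl⟩
    simp only [Finset.mem_coe, Finset.mem_antidiagonal, HahnSeries.mem_support]
    exact ⟨left_ne_zero_of_mul h, right_ne_zero_of_mul h, by ring⟩
  · rintro ⟨i, j⟩ hi
    simp only [Finset.mem_antidiagonal] at hi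
    rw [← hi.2.2]
    simp

end Laurent

/-- Both sides sum over 2×2 arrays of total `k`, grouped by rows and by columns. -/
theorem sum_antidiagonal_four {M : Type*} [AddCommMonoid M] (k : ℕ) (F : ℕ → ℕ → ℕ → ℕ → M) :
    ∑ p ∈ antidiagonal k, ∑ r ∈ antidiagonal p.1, ∑ i ∈ antidiagonal p.2,
      F r.1 r.2 i.1 i.2 =
    ∑ p ∈ antidiagonal k, ∑ r ∈ antidiagonal p.1, ∑ i ∈ antidiagonal p.2,
      F r.1 i.1 r.2 i.2 := by
  simp only [← Finset.sum_product']
  rw [Finset.sum_sigma', Finset.sum_sigma']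
  refine Finset.sum_nbij'
    (fun x => ⟨(x.2.1.1 + x.2.2.1, x.2.1.2 + x.2.2.2), ((x.2.1.1, x.2.2.1), (x.2.1.2, x.2.2.2))⟩)
    (fun x => ⟨(x.2.1.1 + x.2.2.1, x.2.1.2 + x.2.2.2), ((x.2.1.1, x.2.2.1), (x.2.1.2, x.2.2.2))⟩)
    ?_ ?_ ?_ ?_ ?_
  · rintro ⟨⟨p, q⟩, ⟨r, s⟩, ⟨i, j⟩⟩ h
    simp only [Finset.mem_sigma, Finset.mem_product, mem_antidiagonal, and_self, and_true] at h ⊢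
    omega
  · rintro ⟨⟨p, q⟩, ⟨r, s⟩, ⟨i, j⟩⟩ h
    simp only [Finset.mem_sigma, Finset.mem_product, mem_antidiagonal, and_self, and_true] at h ⊢
    omega
  · rintro ⟨⟨p, q⟩, ⟨r, s⟩, ⟨i, j⟩⟩ h
    simp only [Finset.mem_sigma, Finset.mem_product, mem_antidiagonal] at h
    obtain ⟨_, rfl, rfl⟩ := h
    rfl
  · rintro ⟨⟨p, q⟩, ⟨r, s⟩, ⟨i, j⟩⟩ h
    simp only [Finset.mem_sigma, Finset.mem_product, mem_antidiagonal] at h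
    obtain ⟨_, rfl, rfl⟩ := h
    rfl
  · rintro ⟨⟨p, q⟩, ⟨r, s⟩, ⟨i, j⟩⟩ h
    rfl

theorem sum_antidiagonal_assoc {M : Type*} [AddCommMonoid M] (k : ℕ) (F : ℕ → ℕ → ℕ → M) :
    ∑ p ∈ antidiagonal k, ∑ r ∈ antidiagonal p.2, F p.1 r.1 r.2 =
    ∑ p ∈ antidiagonal k, ∑ r ∈ antidiagonal p.1, F r.1 r.2 p.2 := by
  rw [Finset.sum_sigma', Finset.sum_sigma']
  refine Finset.sum_nbij' (fun x => ⟨(x.1.1 + x.2.1, x.2.2), (x.1.1, x.2.1)⟩)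
    (fun x => ⟨(x.2.1, x.2.2 + x.1.2), (x.2.2, x.1.2)⟩) ?_ ?_ ?_ ?_ ?_
  · rintro ⟨⟨p, q⟩, ⟨r, s⟩⟩ h
    simp only [Finset.mem_sigma, mem_antidiagonal, and_true] at h ⊢
    omega
  · rintro ⟨⟨p, q⟩, ⟨r, s⟩⟩ h
    simp only [Finset.mem_sigma, mem_antidiagonal, and_true] at h ⊢
    omega
  · rintro ⟨⟨p, q⟩, ⟨r, s⟩⟩ h
    simp only [Finset.mem_sigma, mem_antidiagonal] at h
    obtain ⟨_, rfl⟩ := h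
    rfl
  · rintro ⟨⟨p, q⟩, ⟨r, s⟩⟩ h
    simp only [Finset.mem_sigma, mem_antidiagonal] at h
    obtain ⟨_, rfl⟩ := h
    rfl
  · rintro ⟨⟨p, q⟩, ⟨r, s⟩⟩ h
    rfl

/-- Coefficientwise the Leibniz rule is Vandermonde's identity for `Ring.choose`, which also covers
negative exponents. -/
theorem hasseDeriv_mul (k : ℕ) (f g : Lu) :
    LaurentSeries.hasseDeriv ℂ k (f * g) = ∑ p ∈ antidiagonal k,
      LaurentSeries.hasseDeriv ℂ p.1 f * LaurentSeries.hasseDeriv ℂ p.2 g := by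
  obtain ⟨a, ha⟩ := exists_coeff_eq_zero_of_lt f
  obtain ⟨b, hb⟩ := exists_coeff_eq_zero_of_lt g
  ext m
  have h : ∀ p ∈ antidiagonal k,
      (LaurentSeries.hasseDeriv ℂ p.1 f * LaurentSeries.hasseDeriv ℂ p.2 g).coeff m =
      ∑ i ∈ Finset.Icc a (m + k - b), (Ring.choose i p.1 * Ring.choose (m + k - i) p.2) •
        (f.coeff i * g.coeff (m + k - i)) := by
    rintro ⟨i, j⟩ h
    rw [mem_antidiagonal] at h
    subst h
    rw [coeff_mul_eq_sum (a := a - i) (b := b - j)]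
    · symm
      refine Finset.sum_nbij' (fun p => p - i) (fun p => p + i) ?_ ?_ ?_ ?_ ?_
      · intro p hp; rw [Finset.mem_Icc] at hp ⊢; push_cast at hp; omega
      · intro p hp; rw [Finset.mem_Icc] at hp ⊢; push_cast; omega
      · intro p _; ring
      · intro p _; ring
      · intro p _
        rw [LaurentSeries.hasseDeriv_coeff, LaurentSeries.hasseDeriv_coeff, smul_mul_smul_comm]
        have e1 : p - (i : ℤ) + i = p := by ring
        have e2 : m - (p - (i : ℤ)) + j = m + (i + j : ℕ) - p := by push_cast; ring
        rw [e1, e2]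
    · intro p hp
      rw [LaurentSeries.hasseDeriv_coeff, ha _ (by omega), smul_zero]
    · intro p hp
      rw [LaurentSeries.hasseDeriv_coeff, hb _ (by omega), smul_zero]
  rw [HahnSeries.coeff_sum, Finset.sum_congr rfl h, Finset.sum_comm,
    LaurentSeries.hasseDeriv_coeff, coeff_mul_eq_sum ha hb, Finset.smul_sum]
  refine Finset.sum_congr rfl fun i _ => ?_
  rw [← Finset.sum_smul, ← Ring.add_choose_eq k (Commute.all _ _)]
  congr 2
  ring

theorem hasseDeriv_C (k : ℕ) (z : ℂ) :
    LaurentSeries.hasseDeriv ℂ k (HahnSeries.C z : Lu) = if k = 0 then HahnSeries.C z else 0 := by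
  rw [HahnSeries.C_apply, LaurentSeries.hasseDeriv_single]
  rcases k with _ | k
  · simp
  · rw [Ring.choose_zero_succ]; simp

theorem coeff_shiftH (c : ℂ) (a : Luh) (k : ℕ) : PowerSeries.coeff k (shiftH c a) =
    ∑ p ∈ antidiagonal k, c ^ p.1 • LaurentSeries.hasseDeriv ℂ p.1 (PowerSeries.coeff p.2 a) := by
  rw [shiftH, PowerSeries.coeff_mk]

theorem shiftH_map_C (c : ℂ) (s : PowerSeries ℂ) :
    shiftH c (PowerSeries.map (HahnSeries.C : ℂ →+* Lu) s) =
      PowerSeries.map (HahnSeries.C : ℂ →+* Lu) s := by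
  refine PowerSeries.ext fun k => ?_
  rw [coeff_shiftH, Finset.sum_eq_single (0, k)]
  · simp
  · rintro ⟨p, q⟩ h1 h2
    rw [mem_antidiagonal] at h1
    have : p ≠ 0 := by
      rintro rfl
      exact h2 (by rw [← h1, zero_add])
    rw [PowerSeries.coeff_map, hasseDeriv_C, if_neg this, smul_zero]
  · intro h; exact absurd (mem_antidiagonal.mpr (zero_add k)) h

theorem smul_mul_smul_eq (c d : ℂ) (f g : Lu) : (c • f) * (d • g) = (c * d) • (f * g) := by
  rw [← HahnSeries.C_mul_eq_smul, ← HahnSeries.C_mul_eq_smul, ← HahnSeries.C_mul_eq_smul, map_mul]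
  ring

theorem shiftH_mul (c : ℂ) (a b : Luh) : shiftH c (a * b) = shiftH c a * shiftH c b := by
  refine PowerSeries.ext fun k => ?_
  rw [coeff_shiftH, PowerSeries.coeff_mul]
  have := sum_antidiagonal_four k fun r s i j =>
    (c ^ r • LaurentSeries.hasseDeriv ℂ r (PowerSeries.coeff i a)) *
      (c ^ s • LaurentSeries.hasseDeriv ℂ s (PowerSeries.coeff j b))
  simp only [coeff_shiftH, Finset.sum_mul_sum]
  rw [← this]
  refine Finset.sum_congr rfl fun p _ => ?_
  rw [PowerSeries.coeff_mul, map_sum, Finset.smul_sum, Finset.sum_comm]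
  refine Finset.sum_congr rfl fun i _ => ?_
  rw [hasseDeriv_mul, Finset.smul_sum]
  refine Finset.sum_congr rfl fun r hr => ?_
  rw [smul_mul_smul_eq, ← pow_add, mem_antidiagonal.mp hr]

/-- `shiftH` as a ring homomorphism. -/
def shiftHom (c : ℂ) : Luh →+* Luh where
  toFun := shiftH c
  map_one' := by simpa using shiftH_map_C c 1
  map_mul' := shiftH_mul c
  map_zero' := by simpa using shiftH_map_C c 0
  map_add' a b := by
    refine PowerSeries.ext fun k => ?_
    simp only [coeff_shiftH, map_add, smul_add, Finset.sum_add_distrib]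

/-- Composing Hasse derivatives produces binomial coefficients, which the binomial theorem for `(c +
d)^p` collects. -/
theorem shiftH_shiftH (c d : ℂ) (a : Luh) : shiftH c (shiftH d a) = shiftH (c + d) a := by
  refine PowerSeries.ext fun k => ?_
  simp only [coeff_shiftH, map_sum, Finset.smul_sum]
  rw [sum_antidiagonal_assoc k fun p r l => c ^ p • LaurentSeries.hasseDeriv ℂ p
    (d ^ r • LaurentSeries.hasseDeriv ℂ r (PowerSeries.coeff l a))]
  refine Finset.sum_congr rfl fun p _ => ?_
  rw [(Commute.all c d).add_pow', Finset.sum_smul]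
  refine Finset.sum_congr rfl fun r hr => ?_
  rw [LinearMap.map_smul, LaurentSeries.hasseDeriv_comp, mem_antidiagonal.mp hr, smul_smul]
  rw [smul_comm, smul_assoc]

theorem shiftH_zero (a : Luh) : shiftH 0 a = a := by
  refine PowerSeries.ext fun k => ?_
  rw [coeff_shiftH, Finset.sum_eq_single (0, k)]
  · simp
  · rintro ⟨p, q⟩ h1 h2
    rw [mem_antidiagonal] at h1
    have : p ≠ 0 := by
      rintro rfl
      exact h2 (by rw [← h1, zero_add])
    simp [this]
  · intro h; exact absurd (mem_antidiagonal.mpr (zero_add k)) h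

theorem constantCoeff_shiftH (c : ℂ) (a : Luh) :
    PowerSeries.constantCoeff (shiftH c a) = PowerSeries.constantCoeff a := by
  rw [← PowerSeries.coeff_zero_eq_constantCoeff_apply, coeff_shiftH]
  simp

theorem shiftH_X (c : ℂ) : shiftH c PowerSeries.X = PowerSeries.X := by
  simpa using shiftH_map_C c PowerSeries.X

/-- `atUV` as a ring homomorphism. -/
def atUVHom : Lu →+* Luv where
  toFun := atUV
  map_one' := by
    rw [atUV, ← map_one (HahnSeries.ofPowerSeries ℤ Lu)]
    congr 1
    refine PowerSeries.ext fun k => ?_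
    have := hasseDeriv_C k 1
    rw [map_one] at this
    rw [PowerSeries.coeff_mk, this, PowerSeries.coeff_one]
  map_mul' f g := by
    rw [atUV, atUV, atUV, ← map_mul]
    congr 1
    refine PowerSeries.ext fun k => ?_
    rw [PowerSeries.coeff_mul, PowerSeries.coeff_mk, hasseDeriv_mul]
    simp only [PowerSeries.coeff_mk]
  map_zero' := by
    rw [atUV, ← map_zero (HahnSeries.ofPowerSeries ℤ Lu)]
    congr 1
    refine PowerSeries.ext fun k => ?_
    simp
  map_add' f g := by
    rw [atUV, atUV, atUV, ← map_add]
    congr 1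
    refine PowerSeries.ext fun k => ?_
    simp

/-- `atV` as a ring homomorphism. -/
def atVHom : Lu →+* Luv where
  toFun := atV
  map_one' := by
    refine HahnSeries.ext (funext fun m => ?_)
    simp only [atV, HahnSeries.map_coeff, HahnSeries.coeff_one]
    split_ifs <;> simp
  map_mul' f g := by
    obtain ⟨a, ha⟩ := exists_coeff_eq_zero_of_lt f
    obtain ⟨b, hb⟩ := exists_coeff_eq_zero_of_lt g
    refine HahnSeries.ext (funext fun m => ?_)
    rw [coeff_mul_eq_sum (f := atV f) (g := atV g) (a := a) (b := b)]
    · simp only [atV, HahnSeries.map_coeff, coeff_mul_eq_sum ha hb, map_sum, map_mul]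
    · intro p hp; simp [atV, ha p hp]
    · intro p hp; simp [atV, hb p hp]
  map_zero' := by refine HahnSeries.ext (funext fun m => ?_); simp [atV]
  map_add' f g := by refine HahnSeries.ext (funext fun m => ?_); simp [atV]

/-- `negU` as a ring homomorphism. -/
def negUHom : Lu →+* Lu where
  toFun := negU
  map_one' := by
    refine HahnSeries.ext (funext fun m => ?_)
    simp only [negU, HahnSeries.coeff_one]
    split_ifs with h <;> simp [h]
  map_mul' f g := by
    obtain ⟨a, ha⟩ := exists_coeff_eq_zero_of_lt f
    obtain ⟨b, hb⟩ := exists_coeff_eq_zero_of_lt g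
    refine HahnSeries.ext (funext fun m => ?_)
    rw [coeff_mul_eq_sum (f := negU f) (g := negU g) (a := a) (b := b)]
    · simp only [negU, coeff_mul_eq_sum ha hb, Finset.mul_sum]
      refine Finset.sum_congr rfl fun i _ => ?_
      have : (-1 : ℂ) ^ m = (-1) ^ i * (-1) ^ (m - i) := by
        rw [← zpow_add₀ (by norm_num)]; congr 1; ring
      rw [this]; ring
    · intro p hp; simp [negU, ha p hp]
    · intro p hp; simp [negU, hb p hp]
  map_zero' := by refine HahnSeries.ext (funext fun m => ?_); simp [negU]
  map_add' f g := by refine HahnSeries.ext (funext fun m => ?_); simp [negU, mul_add]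

theorem mapCoeff_eq_map {A B : Type*} [Semiring A] [Semiring B] (φ : A →+* B) (a : PowerSeries A) :
    mapCoeff φ a = PowerSeries.map φ a := by
  refine PowerSeries.ext fun k => ?_
  rw [mapCoeff, PowerSeries.coeff_mk, PowerSeries.coeff_map]

theorem negU_hasseDeriv (k : ℕ) (f : Lu) :
    negU (LaurentSeries.hasseDeriv ℂ k f) = (-1 : ℂ) ^ k • LaurentSeries.hasseDeriv ℂ k (negU f) := by
  refine HahnSeries.ext (funext fun m => ?_)
  simp only [negU, LaurentSeries.hasseDeriv_coeff, HahnSeries.coeff_smul, smul_eq_mul,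
    zsmul_eq_mul]
  have : (-1 : ℂ) ^ k * (-1) ^ (m + k) = (-1) ^ m := by
    rw [zpow_add₀ (by norm_num), zpow_natCast, mul_left_comm, ← mul_pow]; simp
  rw [← this]; ring

theorem negU_shiftH (c : ℂ) (a : Luh) :
    PowerSeries.map negUHom (shiftH c a) = shiftH (-c) (PowerSeries.map negUHom a) := by
  refine PowerSeries.ext fun k => ?_
  simp only [PowerSeries.coeff_map, coeff_shiftH, map_sum]
  refine Finset.sum_congr rfl fun p _ => ?_
  have h : ∀ (z : ℂ) (f : Lu), negUHom (z • f) = z • negUHom f := by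
    intro z f
    refine HahnSeries.ext (funext fun m => ?_)
    simp only [negUHom, negU, RingHom.coe_mk, MonoidHom.coe_mk, OneHom.coe_mk,
      HahnSeries.coeff_smul, smul_eq_mul]
    ring
  rw [h, neg_pow, mul_comm, ← smul_smul]
  congr 1
  exact negU_hasseDeriv _ _

theorem expH_add (a b : ℂ) : expH (a + b) = expH a * expH b := by
  rw [expH, expH, expH, ← map_mul, PowerSeries.exp_mul_exp_eq_exp_add]

theorem expH_zero : expH 0 = 1 := by
  rw [expH, PowerSeries.rescale_zero]; simp

theorem coeff_expH (c : ℂ) (k : ℕ) :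
    PowerSeries.coeff k (expH c) = HahnSeries.C (c ^ k * (k.factorial : ℂ)⁻¹) := by
  rw [expH, PowerSeries.coeff_map, PowerSeries.coeff_rescale, PowerSeries.coeff_exp]
  simp

theorem constantCoeff_expH (c : ℂ) : PowerSeries.constantCoeff (expH c) = 1 := by
  rw [← PowerSeries.coeff_zero_eq_constantCoeff_apply, coeff_expH]; simp

theorem shiftH_expH (c d : ℂ) : shiftH c (expH d) = expH d :=
  shiftH_map_C c _

theorem coeff_expNegU (m : ℤ) : expNegU.coeff m =
    if m < 0 then 0 else (-1) ^ m.natAbs * (m.natAbs.factorial : ℂ)⁻¹ := by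
  rw [expNegU, PowerSeries.coeff_coe, PowerSeries.coeff_rescale, PowerSeries.coeff_exp]
  simp

theorem hasseDeriv_one_expNegU : LaurentSeries.hasseDeriv ℂ 1 expNegU = -expNegU := by
  refine HahnSeries.ext (funext fun m => ?_)
  rw [LaurentSeries.hasseDeriv_coeff, HahnSeries.coeff_neg, coeff_expNegU, coeff_expNegU]
  rw [Ring.choose_one_right]
  rcases lt_trichotomy m (-1) with h | rfl | h
  · rw [if_pos (by push_cast; omega), if_pos (by omega)]; simp
  · simp
  · obtain ⟨k, rfl⟩ : ∃ k : ℕ, m = k := ⟨m.toNat, by omega⟩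
    have e : ((k : ℤ) + (1 : ℕ)).natAbs = k + 1 := by omega
    rw [if_neg (by omega), if_neg (by omega), e, Int.natAbs_natCast, Nat.factorial_succ]
    have h1 : (k.factorial : ℂ) ≠ 0 := Nat.cast_ne_zero.mpr (Nat.factorial_ne_zero k)
    have h2 : ((k : ℂ) + 1) ≠ 0 := Nat.cast_add_one_ne_zero k
    rw [zsmul_eq_mul]
    push_cast
    field_simp
    ring

theorem hasseDeriv_expNegU (k : ℕ) : LaurentSeries.hasseDeriv ℂ k expNegU =
    ((-1) ^ k * (k.factorial : ℂ)⁻¹) • expNegU := by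
  induction k with
  | zero => simp
  | succ k ih =>
    have h := LaurentSeries.hasseDeriv_comp (R := ℂ) 1 k expNegU
    rw [ih, LinearMap.map_smul, hasseDeriv_one_expNegU, Nat.choose_one_right, add_comm 1 k,
      ← Nat.cast_smul_eq_nsmul ℂ] at h
    have h2 : ((k + 1 : ℕ) : ℂ) ≠ 0 := Nat.cast_ne_zero.mpr (Nat.succ_ne_zero k)
    have h3 := congrArg (fun f => ((k + 1 : ℕ) : ℂ)⁻¹ • f) h
    simp only [smul_smul, inv_mul_cancel₀ h2, one_smul] at h3
    rw [← h3, smul_neg, ← neg_smul, Nat.factorial_succ]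
    congr 1
    rw [pow_succ, Nat.cast_mul, mul_inv]
    ring

theorem shiftH_expNegU (c : ℂ) : shiftH c expNegU' = expNegU' * expH (-c) := by
  refine PowerSeries.ext fun k => ?_
  rw [coeff_shiftH, Finset.sum_eq_single (k, 0)]
  · rw [expNegU', PowerSeries.coeff_C_mul, coeff_expH, PowerSeries.coeff_zero_C,
      hasseDeriv_expNegU, mul_comm expNegU, HahnSeries.C_mul_eq_smul, smul_smul, neg_pow]
    congr 1
    ring
  · rintro ⟨p, q⟩ h1 h2
    rw [mem_antidiagonal] at h1
    have : q ≠ 0 := by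
      rintro rfl
      exact h2 (by rw [← h1, add_zero])
    rw [expNegU', PowerSeries.coeff_C, if_neg this, map_zero, smul_zero]
  · intro h; exact absurd (mem_antidiagonal.mpr (add_zero k)) h

theorem expNegU_ne_zero : expNegU ≠ 0 := by
  intro h
  have := coeff_expNegU 0
  rw [h] at this
  simp at this

theorem expNegU_ne_one : expNegU ≠ 1 := by
  intro h
  have := coeff_expNegU 1
  rw [h, HahnSeries.coeff_one] at this
  simp at this

theorem one_sub_expNegU_ne_zero : 1 - expNegU ≠ 0 :=
  sub_ne_zero.mpr expNegU_ne_one.symm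

theorem negU_expNegU_mul : negU expNegU * expNegU = 1 := by
  have h : negU expNegU =
      HahnSeries.ofPowerSeries ℤ ℂ (PowerSeries.rescale (1 : ℂ) (PowerSeries.exp ℂ)) := by
    refine HahnSeries.ext (funext fun m => ?_)
    rw [PowerSeries.coeff_coe, PowerSeries.coeff_rescale, PowerSeries.coeff_exp]
    simp only [negU, coeff_expNegU]
    split_ifs with hm
    · simp
    · obtain ⟨k, rfl⟩ : ∃ k : ℕ, m = k := ⟨m.toNat, by omega⟩
      rw [Int.natAbs_natCast, zpow_natCast, ← mul_assoc, ← mul_pow]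
      simp
  rw [h, expNegU, ← map_mul, PowerSeries.exp_mul_exp_eq_exp_add, add_neg_cancel,
    PowerSeries.rescale_zero]
  simp

theorem map_expH {A : Type*} [CommRing A] (φ : Lu →+* A) (c : ℂ) :
    PowerSeries.map φ (expH c) =
      PowerSeries.map (φ.comp HahnSeries.C) (PowerSeries.rescale c (PowerSeries.exp ℂ)) := by
  rw [expH, PowerSeries.map_comp]; rfl

theorem negUHom_comp_C : negUHom.comp HahnSeries.C = (HahnSeries.C : ℂ →+* Lu) := by
  refine RingHom.ext fun z => HahnSeries.ext (funext fun m => ?_)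
  simp only [negUHom, negU, RingHom.comp_apply, RingHom.coe_mk, MonoidHom.coe_mk, OneHom.coe_mk,
    HahnSeries.C_apply, HahnSeries.coeff_single]
  split_ifs with h <;> simp [h]

theorem atVHom_comp_C :
    atVHom.comp HahnSeries.C = (HahnSeries.C : Lu →+* Luv).comp (HahnSeries.C : ℂ →+* Lu) := by
  refine RingHom.ext fun z => HahnSeries.ext (funext fun m => ?_)
  simp only [atVHom, atV, RingHom.comp_apply, RingHom.coe_mk, MonoidHom.coe_mk, OneHom.coe_mk,
    HahnSeries.C_apply, HahnSeries.coeff_single, HahnSeries.map_coeff]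
  split_ifs with h <;> simp

theorem atUVHom_comp_C :
    atUVHom.comp HahnSeries.C = (HahnSeries.C : Lu →+* Luv).comp (HahnSeries.C : ℂ →+* Lu) := by
  refine RingHom.ext fun z => ?_
  change atUV (HahnSeries.C z) = HahnSeries.C (HahnSeries.C z)
  rw [atUV, ← HahnSeries.ofPowerSeries_C (HahnSeries.C z : Lu)]
  refine congrArg (HahnSeries.ofPowerSeries ℤ Lu) (PowerSeries.ext fun k => ?_)
  rw [PowerSeries.coeff_mk, hasseDeriv_C, PowerSeries.coeff_C]

theorem atUV_expNegU : atUV expNegU = atU expNegU * atV expNegU := by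
  refine HahnSeries.ext (funext fun m => ?_)
  rw [atU, HahnSeries.C_mul_eq_smul, HahnSeries.coeff_smul, atV, HahnSeries.map_coeff, atUV,
    PowerSeries.coeff_coe, coeff_expNegU]
  split_ifs with h
  · simp
  · rw [PowerSeries.coeff_mk, hasseDeriv_expNegU, smul_eq_mul, mul_comm expNegU,
      HahnSeries.C_mul_eq_smul]

theorem expQuarter_zpow (m : ℤ) : ((expQuarter ^ m : Luhˣ) : Luh) = expH (m / 4) := by
  have h4 : (expQuarter : Luh) = expH (1 / 4) := rfl
  have h4' : ((expQuarter⁻¹ : Luhˣ) : Luh) = expH (-(1 / 4)) := rfl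
  induction m using Int.induction_on with
  | zero => simp [expH_zero]
  | succ k ih =>
    rw [zpow_add_one, Units.val_mul, ih, h4, ← expH_add]
    congr 1; push_cast; ring
  | pred k ih =>
    rw [zpow_sub_one, Units.val_mul, ih, h4', ← expH_add]
    congr 1; push_cast; ring

theorem qOf_expQuarter_inv_sq : (((qOf expQuarter)⁻¹ : Luhˣ) : Luh) ^ 2 = expH (-1) := by
  have : ((qOf expQuarter)⁻¹ : Luhˣ) ^ 2 = expQuarter ^ (-4 : ℤ) := by
    rw [qOf, ← zpow_natCast, ← zpow_natCast, ← zpow_neg, ← zpow_mul]; rfl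
  rw [← Units.val_pow_eq_pow_val, this, expQuarter_zpow]
  congr 1; norm_num

theorem xi_expQuarter (X : LieType) (n : ℕ) :
    ((xi X n expQuarter : Luhˣ) : Luh) = expH (-kappa X n) := by
  have : xi X n expQuarter = expQuarter ^ (2 * xiExp X n) := by
    rw [xi, qOf, ← zpow_natCast, ← zpow_mul]; rfl
  rw [this, expQuarter_zpow]
  congr 1
  cases X <;> simp only [xiExp, kappa] <;> push_cast <;> ring

/-! ### Existence and uniqueness of the normalizing series. -/

theorem shiftH_dvd {c : ℂ} {a : Luh} {m : ℕ} (h : (PowerSeries.X : Luh) ^ m ∣ a) :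
    (PowerSeries.X : Luh) ^ m ∣ shiftH c a := by
  have := map_dvd (shiftHom c) h
  rwa [map_pow, show shiftHom c PowerSeries.X = PowerSeries.X from shiftH_X c] at this

theorem dvd_shiftH_sub {c : ℂ} {a : Luh} {m : ℕ} (h : (PowerSeries.X : Luh) ^ m ∣ a) :
    (PowerSeries.X : Luh) ^ (m + 1) ∣ shiftH c a - a := by
  obtain ⟨b, rfl⟩ := h
  have e : shiftH c (PowerSeries.X ^ m) = PowerSeries.X ^ m := by
    have := map_pow (shiftHom c) PowerSeries.X m
    rwa [show shiftHom c PowerSeries.X = PowerSeries.X from shiftH_X c] at this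
  rw [shiftH_mul, e, ← mul_sub, pow_succ]
  refine mul_dvd_mul_left _ ?_
  rw [PowerSeries.X_dvd_iff, map_sub, constantCoeff_shiftH, sub_self]

theorem eq_zero_of_forall_X_pow_dvd {a : Luh} (h : ∀ m, (PowerSeries.X : Luh) ^ m ∣ a) : a = 0 :=
  PowerSeries.ext fun m =>
    (PowerSeries.X_pow_dvd_iff.mp (h (m + 1)) m (Nat.lt_succ_self m)).trans (map_zero _).symm

theorem two_mul_ne_zero {z : Lu} (hz : z ≠ 0) : 2 * z ≠ 0 := by
  intro h
  have h2 : (2 : Lu) = HahnSeries.C (2 : ℂ) := (map_ofNat HahnSeries.C 2).symm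
  rw [h2, HahnSeries.C_mul_eq_smul] at h
  exact hz ((smul_eq_zero.mp h).resolve_left two_ne_zero)

/-- A shift changes a series only in higher order. If `g - g'` has order `m`, the equation reads `2
g₀ (g - g') = 0` modulo `h^{m+1}`, and `2 g₀` is invertible. -/
theorem mul_shiftH_injective {c : ℂ} {g g' : Luh}
    (h0 : PowerSeries.constantCoeff g = PowerSeries.constantCoeff g')
    (hne : PowerSeries.constantCoeff g ≠ 0) (h : g * shiftH c g = g' * shiftH c g') : g = g' := by
  rw [← sub_eq_zero]
  refine eq_zero_of_forall_X_pow_dvd fun m => ?_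
  induction m with
  | zero => rw [pow_zero]; exact one_dvd _
  | succ m ih =>
    have hs : shiftH c (g - g') = shiftH c g - shiftH c g' := map_sub (shiftHom c) g g'
    have e : (g - g') * (shiftH c g + g') = - (g' * (shiftH c (g - g') - (g - g'))) := by
      rw [hs]; linear_combination h
    have hu : IsUnit (shiftH c g + g') := by
      rw [PowerSeries.isUnit_iff_constantCoeff, map_add, constantCoeff_shiftH, ← h0, ← two_mul]
      exact (two_mul_ne_zero hne).isUnit
    rw [← hu.dvd_mul_right, e]
    exact ((dvd_shiftH_sub ih).mul_left _).neg_right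

/-- Successive approximations to a solution of `g(u) g(u + c h) = F(u)`. -/
def approx (c : ℂ) (F : Luh) (z : Lu) : ℕ → Luh
  | 0 => PowerSeries.C z
  | m + 1 => approx c F z m +
      PowerSeries.C (2 * z)⁻¹ * (F - approx c F z m * shiftH c (approx c F z m))

theorem constantCoeff_approx {c : ℂ} {F : Luh} {z : Lu}
    (hF : PowerSeries.constantCoeff F = z ^ 2) (m : ℕ) :
    PowerSeries.constantCoeff (approx c F z m) = z := by
  induction m with
  | zero => rw [approx, PowerSeries.constantCoeff_C]
  | succ m ih =>
    rw [approx, map_add, map_mul, map_sub, map_mul, constantCoeff_shiftH, ih, hF]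
    ring

theorem dvd_sub_approx {c : ℂ} {F : Luh} {z : Lu} (hz : z ≠ 0)
    (hF : PowerSeries.constantCoeff F = z ^ 2) (m : ℕ) :
    (PowerSeries.X : Luh) ^ (m + 1) ∣ F - approx c F z m * shiftH c (approx c F z m) := by
  induction m with
  | zero =>
    rw [zero_add, pow_one, PowerSeries.X_dvd_iff, map_sub, map_mul, constantCoeff_shiftH, hF,
      constantCoeff_approx hF]
    ring
  | succ m ih =>
    have hG := constantCoeff_approx (c := c) hF m
    rw [approx]
    set G := approx c F z m
    set r := F - G * shiftH c G with hr
    set w : Luh := PowerSeries.C (2 * z)⁻¹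
    have hw : w * PowerSeries.C (2 * z) = 1 := by
      rw [← map_mul, inv_mul_cancel₀ (two_mul_ne_zero hz), map_one]
    have hd : (PowerSeries.X : Luh) ^ (m + 1) ∣ w * r := ih.mul_left w
    have hs : shiftH c (G + w * r) = shiftH c G + shiftH c (w * r) :=
      map_add (shiftHom c) G (w * r)
    -- The correction `r / (2z)` solves the linearized equation, since `G` and its shift both start
    -- with `z`. Each of the three remaining terms has higher order.
    have e : F - (G + w * r) * shiftH c (G + w * r) =
        w * r * (PowerSeries.C (2 * z) - (shiftH c G + G)) -
          G * (shiftH c (w * r) - w * r) - w * r * shiftH c (w * r) := by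
      rw [hs]
      linear_combination (-r) * hw - hr
    rw [e]
    refine dvd_sub (dvd_sub ?_ ((dvd_shiftH_sub hd).mul_left _)) ?_
    · rw [pow_succ]
      refine mul_dvd_mul hd ?_
      rw [PowerSeries.X_dvd_iff, map_sub, map_add, constantCoeff_shiftH, hG,
        PowerSeries.constantCoeff_C]
      ring
    · rw [pow_succ]
      refine mul_dvd_mul hd ((dvd_pow_self _ (Nat.succ_ne_zero m)).trans (shiftH_dvd hd))

theorem dvd_approx_succ_sub {c : ℂ} {F : Luh} {z : Lu} (hz : z ≠ 0)
    (hF : PowerSeries.constantCoeff F = z ^ 2) (m : ℕ) :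
    (PowerSeries.X : Luh) ^ (m + 1) ∣ approx c F z (m + 1) - approx c F z m := by
  rw [approx, add_sub_cancel_left]
  exact (dvd_sub_approx hz hF m).mul_left _

theorem exists_mul_shiftH_eq (c : ℂ) {F : Luh} {z : Lu} (hz : z ≠ 0)
    (hF : PowerSeries.constantCoeff F = z ^ 2) :
    ∃ g : Luh, PowerSeries.constantCoeff g = z ∧ g * shiftH c g = F := by
  -- The coefficient of `h^k` no longer changes after step `k`, so the limit is read off along the
  -- diagonal.
  have hst : ∀ k j, PowerSeries.coeff k (approx c F z (k + j)) =
      PowerSeries.coeff k (approx c F z k) := by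
    intro k j
    induction j with
    | zero => rfl
    | succ j ih =>
      have := PowerSeries.X_pow_dvd_iff.mp (dvd_approx_succ_sub (c := c) hz hF (k + j)) k (by omega)
      rw [map_sub, sub_eq_zero] at this
      rw [← add_assoc, this, ih]
  set g : Luh := PowerSeries.mk fun k => PowerSeries.coeff k (approx c F z k) with hg
  have hga : ∀ m, (PowerSeries.X : Luh) ^ (m + 1) ∣ g - approx c F z m := by
    intro m
    rw [PowerSeries.X_pow_dvd_iff]
    intro k hk
    obtain ⟨j, rfl⟩ := Nat.exists_eq_add_of_le (Nat.lt_succ_iff.mp hk)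
    rw [map_sub, hg, PowerSeries.coeff_mk, hst, sub_self]
  refine ⟨g, ?_, ?_⟩
  · have := PowerSeries.X_dvd_iff.mp ((dvd_of_eq (pow_one _).symm).trans (hga 0))
    rw [map_sub, constantCoeff_approx hF, sub_eq_zero] at this
    exact this
  · rw [← sub_eq_zero]
    refine eq_zero_of_forall_X_pow_dvd fun m => (pow_dvd_pow _ (Nat.le_succ m)).trans ?_
    have hs : shiftH c (g - approx c F z m) = shiftH c g - shiftH c (approx c F z m) :=
      map_sub (shiftHom c) _ _
    have e : g * shiftH c g - F = (g - approx c F z m) * shiftH c g +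
        approx c F z m * shiftH c (g - approx c F z m) -
        (F - approx c F z m * shiftH c (approx c F z m)) := by
      rw [hs]; ring
    rw [e]
    exact dvd_sub (dvd_add ((hga m).mul_right _) ((shiftH_dvd (hga m)).mul_left _))
      (dvd_sub_approx hz hF m)

/-- The product whose inverse is the right-hand side of the normalization condition. -/
def normProd (κ : ℂ) : Luh :=
  (1 - expNegU' * expH (-1)) * (1 - expNegU' * expH 1) *
    (1 - expNegU' * expH (-κ)) * (1 - expNegU' * expH κ)

theorem constantCoeff_normProd (κ : ℂ) :
    PowerSeries.constantCoeff (normProd κ) = (1 - expNegU) ^ 4 := by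
  simp only [normProd, map_mul, map_sub, map_one, constantCoeff_expH, expNegU',
    PowerSeries.constantCoeff_C]
  ring

theorem constantCoeff_normProd_ne (κ : ℂ) : PowerSeries.constantCoeff (normProd κ) ≠ 0 := by
  rw [constantCoeff_normProd]
  exact pow_ne_zero 4 one_sub_expNegU_ne_zero

theorem existsUnique_isNormalizing (κ : ℂ) : ∃! g : Luh, IsNormalizing κ g := by
  have hz : ((1 - expNegU) ^ 2)⁻¹ ≠ 0 := inv_ne_zero (pow_ne_zero 2 one_sub_expNegU_ne_zero)
  have hF : PowerSeries.constantCoeff (normProd κ)⁻¹ = (((1 - expNegU) ^ 2)⁻¹) ^ 2 := by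
    rw [PowerSeries.constantCoeff_inv, constantCoeff_normProd, inv_pow, ← pow_mul]
  obtain ⟨g, h1, h2⟩ := exists_mul_shiftH_eq κ hz hF
  refine ⟨g, ⟨h1, h2⟩, fun g' h' => ?_⟩
  exact mul_shiftH_injective (h'.1.trans h1.symm) (by rw [h'.1]; exact hz) (h'.2.trans h2.symm)

/-! ### Unitarity and crossing symmetry of the normalized matrix. -/

/-- `e^u` in `ℂ((u))[[h]]`. -/
def expU' : Luh := PowerSeries.C (negU expNegU)

theorem expNegU_mul_expU : expNegU' * expU' = 1 := by
  rw [expNegU', expU', ← map_mul, mul_comm, negU_expNegU_mul, map_one]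

theorem map_negU_expNegU : PowerSeries.map negUHom expNegU' = expU' := by
  rw [expNegU', PowerSeries.map_C]; rfl

theorem map_negU_expH (c : ℂ) : PowerSeries.map negUHom (expH c) = expH c := by
  rw [map_expH, negUHom_comp_C]; rfl

theorem map_negU_normProd (κ : ℂ) :
    PowerSeries.map negUHom (normProd κ) = expU' ^ 4 * normProd κ := by
  have h1 := expH_mul_expH_neg 1
  have h2 := expH_mul_expH_neg κ
  have h3 := expNegU_mul_expU
  simp only [normProd, map_mul, map_sub, map_one, map_negU_expH, map_negU_expNegU]
  have key : ∀ p p' : Luh, p * p' = 1 → (1 - expU' * p') * (1 - expU' * p) =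
      expU' ^ 2 * ((1 - expNegU' * p') * (1 - expNegU' * p)) := by
    intro p p' h
    linear_combination (expU' ^ 2 - 1) * h + (expU' * (p + p') - p * p' *
      (expNegU' * expU' + 1)) * h3
  rw [mul_assoc, key _ _ h1, key _ _ h2]
  ring

/-- Both sides have the same constant term and the same product with their shift by `κ`, so
`mul_shiftH_injective` identifies them. For the left side the product follows from the equation of
`g` at `u` and at `-u - κh`. -/
theorem mul_map_negU {κ : ℂ} {g : Luh} (hg : IsNormalizing κ g) :
    g * PowerSeries.map negUHom g = expH (-κ) * expNegU' ^ 2 * (normProd κ)⁻¹ := by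
  have hK := PowerSeries.mul_inv_cancel (normProd κ) (constantCoeff_normProd_ne κ)
  have hgK : g * shiftH κ g * normProd κ = 1 := by
    rw [hg.2]; exact PowerSeries.inv_mul_cancel _ (constantCoeff_normProd_ne κ)
  have he := expNegU_mul_expU
  have hse : expNegU' * expH (-κ) * shiftH κ expU' = 1 := by
    rw [← shiftH_expNegU, ← shiftH_mul, he]; exact map_one (shiftHom κ)
  have h1 : shiftH κ (PowerSeries.map negUHom g) * PowerSeries.map negUHom g *
      (shiftH κ expU' ^ 4 * shiftH κ (normProd κ)) = 1 := by
    have := congrArg (fun a => shiftHom κ (PowerSeries.map negUHom a)) hgK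
    simp only [map_mul, map_one, negU_shiftH, map_negU_normProd, map_pow] at this
    have e : shiftHom κ (shiftH (-κ) (PowerSeries.map negUHom g)) = PowerSeries.map negUHom g := by
      change shiftH κ _ = _
      rw [shiftH_shiftH, add_neg_cancel, shiftH_zero]
    rw [e] at this
    exact this
  have hsK : shiftH κ (normProd κ) * shiftH κ (normProd κ)⁻¹ = 1 := by
    rw [← shiftH_mul, hK]; exact map_one (shiftHom κ)
  apply mul_shiftH_injective (c := κ)
  · have hne := one_sub_expNegU_ne_zero
    have hne' := expNegU_ne_zero
    have h0 : negUHom expNegU = expNegU⁻¹ := eq_inv_of_mul_eq_one_left negU_expNegU_mul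
    simp only [map_mul, map_pow, constantCoeff_expH, PowerSeries.constantCoeff_inv,
      constantCoeff_normProd, expNegU', PowerSeries.constantCoeff_C, one_mul]
    have h3 : PowerSeries.constantCoeff (PowerSeries.map negUHom g) =
        ((1 - expNegU⁻¹) ^ 2)⁻¹ := by
      rw [← PowerSeries.coeff_zero_eq_constantCoeff_apply, PowerSeries.coeff_map,
        PowerSeries.coeff_zero_eq_constantCoeff_apply, hg.1, map_inv₀, map_pow, map_sub, map_one,
        h0]
    have h4 : (1 - expNegU⁻¹ : Lu) = -((1 - expNegU) * expNegU⁻¹) := by field_simp; ring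
    rw [h3, hg.1, h4]
    field_simp
  · have hz : negUHom (PowerSeries.constantCoeff g) ≠ 0 := by
      rw [hg.1, map_ne_zero]
      exact inv_ne_zero (pow_ne_zero 2 one_sub_expNegU_ne_zero)
    rw [map_mul]
    refine mul_ne_zero ?_ ?_
    · rw [hg.1]; exact inv_ne_zero (pow_ne_zero 2 one_sub_expNegU_ne_zero)
    · rwa [← PowerSeries.coeff_zero_eq_constantCoeff_apply, PowerSeries.coeff_map,
        PowerSeries.coeff_zero_eq_constantCoeff_apply]
  · have hp : shiftH κ (expNegU' ^ 2) = (expNegU' * expH (-κ)) ^ 2 := by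
      rw [← shiftH_expNegU]; exact map_pow (shiftHom κ) _ 2
    simp only [shiftH_mul, shiftH_expH, hp]
    -- Multiplication by this unit clears the inverses and makes both sides equal to 1.
    have hu : IsUnit (normProd κ * shiftH κ (normProd κ) * shiftH κ expU' ^ 4) := by
      refine IsUnit.mul (IsUnit.mul (IsUnit.of_mul_eq_one _ hK) (IsUnit.of_mul_eq_one _ hsK)) ?_
      exact (IsUnit.of_mul_eq_one (expNegU' * expH (-κ)) (by rw [mul_comm]; exact hse)).pow 4
    refine hu.mul_right_cancel ?_
    generalize shiftH κ (normProd κ)⁻¹ = sK' at *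
    generalize shiftH κ (normProd κ) = sK at *
    generalize (normProd κ)⁻¹ = K' at *
    generalize normProd κ = K at *
    generalize shiftH κ (PowerSeries.map negUHom g) = sg' at *
    generalize PowerSeries.map negUHom g = g' at *
    generalize shiftH κ g = sg at *
    generalize shiftH κ expU' = y at *
    generalize expH (-κ) = ξ at *
    generalize expNegU' = x at *
    calc g * g' * (sg * sg') * (K * sK * y ^ 4)
        = (g * sg * K) * (sg' * g' * (y ^ 4 * sK)) := by ring
      _ = 1 := by rw [hgK, h1, mul_one]
      _ = (x * ξ * y) ^ 4 * (K * K') * (sK * sK') := by rw [hse, hK, hsK]; ring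
      _ = _ := by ring

theorem uscal_mul (X : LieType) (n : ℕ) :
    expNegU' ^ 2 * uscal X n expNegU' expU' expQuarter =
      expH (-1) * expH (-kappa X n) * normProd (kappa X n) := by
  have h1 := expH_mul_expH_neg 1
  have h2 := expH_mul_expH_neg (kappa X n)
  have h3 := expNegU_mul_expU
  rw [uscal, qOf_expQuarter_inv_sq, xi_expQuarter, normProd]
  have key : ∀ p p' : Luh, p' * p = 1 → expNegU' * ((expNegU' - p) * (expU' - p)) =
      - p * ((1 - expNegU' * p) * (1 - expNegU' * p')) := by
    intro p p' h
    linear_combination (expNegU' - p) * h3 + expNegU' * (expNegU' * p - 1) * h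
  linear_combination (expNegU' * ((expNegU' - expH (-kappa X n)) * (expU' - expH (-kappa X n)))) *
    key _ _ h1 - expH (-1) * ((1 - expNegU' * expH (-1)) * (1 - expNegU' * expH 1)) * key _ _ h2

/-- The prefactor `e^{(1 + 2κ)h/2}` enters twice and cancels the powers `e^{-h}` and `e^{-2κh}` left
by `uscal_mul` and by `g`. The same scalar occurs in unitarity and in crossing. -/
theorem normalization_eq_one (X : LieType) (n : ℕ) :
    expH (1 + 2 * kappa X n) * (normProd (kappa X n))⁻¹ * (expNegU' ^ 2 * expH (-kappa X n)) *
      uscal X n expNegU' expU' expQuarter = 1 := by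
  have hK := PowerSeries.mul_inv_cancel _ (constantCoeff_normProd_ne (kappa X n))
  have h : expH (1 + 2 * kappa X n) * (expH (-kappa X n) * (expH (-1) * expH (-kappa X n))) = 1 := by
    rw [← expH_add, ← expH_add, ← expH_add, ← expH_zero]
    congr 1; ring
  linear_combination (expH (1 + 2 * kappa X n) * (normProd (kappa X n))⁻¹ * expH (-kappa X n)) *
    uscal_mul X n + (expH (1 + 2 * kappa X n) * (expH (-kappa X n) * (expH (-1) *
      expH (-kappa X n)))) * hK + h

theorem Rhat_map {S : Type*} [CommRing S] (X : LieType) (n : ℕ) (φ : Luh →+* S) (g : Luh) :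
    (Rhat X n g).map φ = φ (expH ((1 + 2 * kappa X n) / 2) * g) •
      Rplus X n (φ expNegU') (Units.map (φ : Luh →* S) expQuarter) := by
  rw [← Rplus_map]
  ext i j
  simp [Rhat]

theorem smul_mul_smul_matrix {S ι : Type*} [CommRing S] [Fintype ι] (c d : S) (A B : Matrix ι ι S) :
    (c • A) * (d • B) = (c * d) • (A * B) := by
  rw [Matrix.smul_mul, Matrix.mul_smul, smul_smul]

theorem legs_Rhat_mul (X : LieType) (n : ℕ) {g : Luh} (hg : IsNormalizing (kappa X n) g) :
    legs (m := 2) 0 1 (Rhat X n g) * legs 1 0 ((Rhat X n g).map (mapCoeff negU)) = 1 := by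
  have e : mapCoeff negU = PowerSeries.map negUHom := funext fun a => mapCoeff_eq_map negUHom a
  have ht : Units.map ((PowerSeries.map negUHom : Luh →+* Luh) : Luh →* Luh) expQuarter =
      expQuarter := Units.ext (map_negU_expH _)
  rw [e, Rhat_map, ht, map_negU_expNegU, Rhat, legs_smul, legs_smul, smul_mul_smul_matrix,
    legs_mul_legs X n expQuarter (by decide) expNegU_mul_expU, smul_smul, map_mul, map_negU_expH]
  have h1 : expH (1 + 2 * kappa X n) =
      expH ((1 + 2 * kappa X n) / 2) * expH ((1 + 2 * kappa X n) / 2) := by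
    rw [← expH_add]; congr 1; ring
  have h2 := normalization_eq_one X n
  rw [h1] at h2
  have h3 : ∀ c : Luh, c = 1 → c • (1 : Matrix (Fin 2 → Fin (dim X n)) (Fin 2 → Fin (dim X n)) Luh)
      = 1 := fun c hc => by rw [hc, one_smul]
  apply h3
  linear_combination (expH ((1 + 2 * kappa X n) / 2) * expH ((1 + 2 * kappa X n) / 2) *
    uscal X n expNegU' expU' expQuarter) * mul_map_negU hg + h2

section Crossing
variable {S : Type*} [CommRing S] (X : LieType) (n : ℕ) (t : Sˣ)

theorem diagD1_eq : diagD1 X n t =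
    Matrix.diagonal fun a : Fin (dim X n) × Fin (dim X n) => ((t ^ twoBar X n a.1 : Sˣ) : S) := by
  rw [diagD1, ← Matrix.diagonal_one, Matrix.diagonal_kronecker_diagonal]
  simp

theorem diagD1_inv : (diagD1 X n t)⁻¹ =
    Matrix.diagonal fun a : Fin (dim X n) × Fin (dim X n) => ((t ^ (-twoBar X n a.1) : Sˣ) : S) := by
  apply Matrix.inv_eq_right_inv
  rw [diagD1_eq, Matrix.diagonal_mul_diagonal, ← Matrix.diagonal_one]
  congr 1
  funext a
  rw [← Units.val_mul, ← zpow_add, add_neg_cancel, zpow_zero, Units.val_one]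

theorem diagD1_mul_transpose1 (A : End2 (dim X n) S) (a b c e : Fin (dim X n)) :
    (diagD1 X n t * transpose1 X n A * (diagD1 X n t)⁻¹) (a, b) (c, e) =
      wt X n t a c * A (c.rev, b) (a.rev, e) := by
  rw [diagD1_inv, diagD1_eq, Matrix.mul_diagonal, Matrix.diagonal_mul, transpose1, Matrix.of_apply,
    wt, sub_eq_add_neg, zpow_add, Units.val_mul]
  have h : eps X n a.rev * eps X n c.rev = eps X n a * eps X n c := by
    have : sgn X * sgn X = 1 := by cases X <;> rfl
    rw [eps_rev, eps_rev]
    linear_combination eps X n a * eps X n c * this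
  dsimp only
  rw [h]
  ring

end Crossing

theorem Rhat_crossing (X : LieType) (n : ℕ) {g : Luh} (hg : IsNormalizing (kappa X n) g) :
    Rhat X n g * diagD1 X n expQuarter *
      transpose1 X n ((Rhat X n g).map (shiftH (kappa X n))) * (diagD1 X n expQuarter)⁻¹ = 1 := by
  have ht : Units.map (shiftHom (kappa X n) : Luh →* Luh) expQuarter = expQuarter :=
    Units.ext (shiftH_expH _ _)
  have hm : (Rhat X n g).map (shiftH (kappa X n)) =
      (expH ((1 + 2 * kappa X n) / 2) * shiftH (kappa X n) g) •
        Rplus X n (expNegU' * expH (-kappa X n)) expQuarter := by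
    have := Rhat_map X n (shiftHom (kappa X n)) g
    rw [ht, map_mul] at this
    refine this.trans ?_
    change (shiftH _ (expH _) * shiftH _ g) • Rplus X n (shiftH _ expNegU') expQuarter = _
    rw [shiftH_expH, shiftH_expNegU]
  have hx : expNegU' * expH (-kappa X n) * (expU' * expH (kappa X n)) = 1 := by
    linear_combination expH (kappa X n) * expH (-kappa X n) * expNegU_mul_expU +
      expH_mul_expH_neg (kappa X n)
  have hξ := xi_expQuarter X n
  have hξ' : (((xi X n expQuarter)⁻¹ : Luhˣ) : Luh) = expH (kappa X n) := by
    apply Units.inv_eq_of_mul_eq_one_left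
    rw [hξ]; exact expH_mul_expH_neg _
  -- At `x = e^{-u-κh}` the crossed parameter `ξ / x` is `e^u`, so crossing turns the shifted matrix
  -- into a multiple of `R₂₁(-u)`, and unitarity applies.
  have key : diagD1 X n expQuarter * transpose1 X n ((Rhat X n g).map (shiftH (kappa X n))) *
      (diagD1 X n expQuarter)⁻¹ =
      (expH ((1 + 2 * kappa X n) / 2) * shiftH (kappa X n) g *
        (expNegU' ^ 2 * expH (-kappa X n))) •
        (Rplus X n expU' expQuarter).submatrix Prod.swap Prod.swap := by
    ext1 ⟨a, b⟩ ⟨c, e⟩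
    rw [diagD1_mul_transpose1, hm, Matrix.smul_apply, Matrix.smul_apply, Matrix.submatrix_apply,
      smul_eq_mul, smul_eq_mul, Prod.swap_prod_mk, Prod.swap_prod_mk]
    have h := Rplus_cross X n hx expQuarter a b c e
    have hy : ((xi X n expQuarter : Luhˣ) : Luh) * (expU' * expH (kappa X n)) = expU' := by
      rw [hξ]; linear_combination expU' * expH_mul_expH_neg (kappa X n)
    rw [hy, hξ'] at h
    linear_combination (expH ((1 + 2 * kappa X n) / 2) * shiftH (kappa X n) g) * h +
      (expH ((1 + 2 * kappa X n) / 2) * shiftH (kappa X n) g * expNegU' ^ 2 * expH (-kappa X n) *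
        Rplus X n expU' expQuarter (b, a) (e, c)) * expH_mul_expH_neg (kappa X n)
  rw [mul_assoc (Rhat X n g), mul_assoc (Rhat X n g), key, Rhat, smul_mul_smul_matrix,
    Rplus_mul_swap X n expNegU_mul_expU, smul_smul]
  have h1 : expH (1 + 2 * kappa X n) =
      expH ((1 + 2 * kappa X n) / 2) * expH ((1 + 2 * kappa X n) / 2) := by
    rw [← expH_add]; congr 1; ring
  have h2 := normalization_eq_one X n
  rw [h1] at h2
  have h3 : ∀ c : Luh, c = 1 → c • (1 : End2 (dim X n) Luh) = 1 := fun c hc => by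
    rw [hc, one_smul]
  apply h3
  have h4 : g * shiftH (kappa X n) g = (normProd (kappa X n))⁻¹ := hg.2
  linear_combination (expH ((1 + 2 * kappa X n) / 2) * expH ((1 + 2 * kappa X n) / 2) *
    (expNegU' ^ 2 * expH (-kappa X n)) * uscal X n expNegU' expU' expQuarter) * h4 + h2

/-! ### The Yang–Baxter equation over `ℂ((u))((v))[[h]]`. -/

/-- Application of a ring homomorphism `ℂ((u)) → ℂ((u))((v))` to the coefficients. -/
def coeffHom (φ : Lu →+* Luv) : Luh →+* Luvh := PowerSeries.map φ

theorem coeffHom_apply (φ : Lu →+* Luv) (a : Luh) : coeffHom φ a = mapCoeff φ a := by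
  refine PowerSeries.ext fun k => ?_
  rw [mapCoeff, PowerSeries.coeff_mk]
  exact PowerSeries.coeff_map (R := Lu) (S := Luv) φ k a

theorem coeff_coeffHom (φ : Lu →+* Luv) (a : Luh) (k : ℕ) :
    PowerSeries.coeff k (coeffHom φ a) = φ (PowerSeries.coeff k a) := by
  rw [coeffHom_apply, mapCoeff, PowerSeries.coeff_mk]

theorem coeffHom_expNegU (φ : Lu →+* Luv) :
    coeffHom φ expNegU' = PowerSeries.C (φ expNegU) := by
  refine PowerSeries.ext fun k => ?_
  rw [coeff_coeffHom, expNegU', PowerSeries.coeff_C, PowerSeries.coeff_C, apply_ite φ, map_zero]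

theorem constantCoeff_coeffHom_expH (φ : Lu →+* Luv) (c : ℂ) :
    PowerSeries.constantCoeff (coeffHom φ (expH c)) = 1 := by
  rw [← PowerSeries.coeff_zero_eq_constantCoeff_apply, coeff_coeffHom,
    PowerSeries.coeff_zero_eq_constantCoeff_apply, constantCoeff_expH, map_one]

/-- The coefficients of `e^{h/4}` are constants, so all three substitutions yield the same `t`. -/
theorem map_coeffHom_expQuarter {φ ψ : Lu →+* Luv}
    (h : φ.comp (HahnSeries.C : ℂ →+* Lu) = ψ.comp (HahnSeries.C : ℂ →+* Lu)) :
    Units.map (coeffHom φ : Luh →* Luvh) expQuarter =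
      Units.map (coeffHom ψ : Luh →* Luvh) expQuarter := by
  refine Units.ext (PowerSeries.ext fun k => ?_)
  change PowerSeries.coeff k (coeffHom φ (expH _)) = PowerSeries.coeff k (coeffHom ψ (expH _))
  rw [coeff_coeffHom, coeff_coeffHom, coeff_expH]
  exact RingHom.congr_fun h _

/-- `atU` as a ring homomorphism. -/
def atUHom : Lu →+* Luv := HahnSeries.C

/-- The series `e^{-u}`, `e^{-v}` and `e^{-u-v}` are images of `e^{-u}`, which is neither 0 nor 1,
under injective ring homomorphisms. -/
theorem generic_expNegU :
    Generic (PowerSeries.C (atU expNegU)) (PowerSeries.C (atV expNegU)) := by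
  have hu : atU expNegU ≠ 1 := fun h =>
    expNegU_ne_one (atUHom.injective (h.trans (map_one atUHom).symm))
  have hv : atV expNegU ≠ 1 := fun h =>
    expNegU_ne_one (atVHom.injective (h.trans (map_one atVHom).symm))
  have huv : atU expNegU * atV expNegU ≠ 1 := fun h =>
    expNegU_ne_one (atUVHom.injective ((atUV_expNegU.trans h).trans (map_one atUVHom).symm))
  have hu0 : atU expNegU ≠ 0 := fun h =>
    expNegU_ne_zero (atUHom.injective (h.trans (map_zero atUHom).symm))
  have hv0 : atV expNegU ≠ 0 := fun h =>
    expNegU_ne_zero (atVHom.injective (h.trans (map_zero atVHom).symm))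
  constructor <;> simp only [PowerSeries.constantCoeff_C] <;> assumption

theorem legs_map {S S' : Type*} [CommRing S] [CommRing S'] {N m : ℕ} (φ : S →+* S') (r s : Fin m)
    (A : End2 N S) : (legs r s A).map φ = legs r s (A.map φ) := by
  ext a b
  simp only [Matrix.map_apply, legs_apply]
  split_ifs <;> simp

/-- The Yang–Baxter equation over a ring that embeds into power series over a field. -/
theorem yang_baxter_smul {k : Type*} [Field k] {S : Type*} [CommRing S] (φ : S →+* PowerSeries k)
    (hφ : Function.Injective φ) (X : LieType) (n : ℕ) {t : Sˣ}
    (ht : PowerSeries.constantCoeff (φ t) = 1) {x y : S} (hxy : Generic (φ x) (φ y)) (a b c : S) :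
    legs (m := 3) 0 1 (a • Rplus X n x t) * legs 0 2 (b • Rplus X n (x * y) t) *
        legs 1 2 (c • Rplus X n y t) =
      legs 1 2 (c • Rplus X n y t) * legs 0 2 (b • Rplus X n (x * y) t) *
        legs 0 1 (a • Rplus X n x t) := by
  simp only [legs_smul, smul_mul_smul_matrix]
  have h : legs (m := 3) 0 1 (Rplus X n x t) * legs 0 2 (Rplus X n (x * y) t) *
        legs 1 2 (Rplus X n y t) =
      legs 1 2 (Rplus X n y t) * legs 0 2 (Rplus X n (x * y) t) * legs 0 1 (Rplus X n x t) := by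
    refine Matrix.map_injective hφ ?_
    simp only [Matrix.map_mul, legs_map, Rplus_map, map_mul]
    exact yang_baxter X n ht hxy
  rw [h]
  congr 1
  ring

theorem Rhat_yang_baxter (X : LieType) (n : ℕ) (g : Luh) :
    legs (m := 3) 0 1 ((Rhat X n g).map (mapCoeff atU)) *
        legs 0 2 ((Rhat X n g).map (mapCoeff atUV)) * legs 1 2 ((Rhat X n g).map (mapCoeff atV)) =
      legs 1 2 ((Rhat X n g).map (mapCoeff atV)) * legs 0 2 ((Rhat X n g).map (mapCoeff atUV)) *
        legs 0 1 ((Rhat X n g).map (mapCoeff atU)) := by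
  have e1 : mapCoeff atU = coeffHom atUHom := funext fun a => (coeffHom_apply atUHom a).symm
  have e2 : mapCoeff atV = coeffHom atVHom := funext fun a => (coeffHom_apply atVHom a).symm
  have e3 : mapCoeff atUV = coeffHom atUVHom := funext fun a => (coeffHom_apply atUVHom a).symm
  have t2 := map_coeffHom_expQuarter (φ := atVHom) (ψ := atUHom) atVHom_comp_C
  have t3 := map_coeffHom_expQuarter (φ := atUVHom) (ψ := atUHom) atUVHom_comp_C
  have x1 : coeffHom atUHom expNegU' = PowerSeries.C (atU expNegU) := coeffHom_expNegU _
  have x2 : coeffHom atVHom expNegU' = PowerSeries.C (atV expNegU) := coeffHom_expNegU _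
  have x3 : coeffHom atUVHom expNegU' =
      PowerSeries.C (atU expNegU) * PowerSeries.C (atV expNegU) := by
    rw [coeffHom_expNegU, ← map_mul, ← atUV_expNegU]; rfl
  set t := Units.map (coeffHom atUHom : Luh →* Luvh) expQuarter with ht
  set s := expH ((1 + 2 * kappa X n) / 2) * g
  have m1 : (Rhat X n g).map (mapCoeff atU) =
      coeffHom atUHom s • Rplus X n (PowerSeries.C (atU expNegU)) t := by
    rw [e1, ← x1]; exact Rhat_map (S := Luvh) X n (coeffHom atUHom) g
  have m2 : (Rhat X n g).map (mapCoeff atV) =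
      coeffHom atVHom s • Rplus X n (PowerSeries.C (atV expNegU)) t := by
    rw [e2, ← x2, ← t2]; exact Rhat_map (S := Luvh) X n (coeffHom atVHom) g
  have m3 : (Rhat X n g).map (mapCoeff atUV) =
      coeffHom atUVHom s •
        Rplus X n (PowerSeries.C (atU expNegU) * PowerSeries.C (atV expNegU)) t := by
    rw [e3, ← x3, ← t3]; exact Rhat_map (S := Luvh) X n (coeffHom atUVHom) g
  rw [m1, m2, m3]
  have h1 : PowerSeries.constantCoeff (t : Luvh) = 1 :=
    constantCoeff_coeffHom_expH atUHom (1 / 4)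
  have hid : Function.Injective (RingHom.id Luvh) := Function.injective_id
  have key := @yang_baxter_smul Luv _ Luvh _ (RingHom.id Luvh) hid X n t
    (by with_reducible_and_instances exact h1) (PowerSeries.C (atU expNegU))
    (PowerSeries.C (atV expNegU)) (by with_reducible_and_instances exact generic_expNegU)
  with_reducible_and_instances exact key _ _ _

end TrigR

end

open TrigR in
theorem mainTheorem3 (X : LieType) (n : ℕ) :
    (∃! g : Luh, IsNormalizing (kappa X n) g) ∧
    ∀ g : Luh, IsNormalizing (kappa X n) g →
      -- Yang–Baxter equation, in `End(ℂ^N)^{⊗ 3}((u))((v))[[h]]`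
      (let Ru : End2 (dim X n) Luvh := (Rhat X n g).map (mapCoeff atU)
       let Rv : End2 (dim X n) Luvh := (Rhat X n g).map (mapCoeff atV)
       let Ruv : End2 (dim X n) Luvh := (Rhat X n g).map (mapCoeff atUV)
       legs (m := 3) 0 1 Ru * legs 0 2 Ruv * legs 1 2 Rv =
         legs 1 2 Rv * legs 0 2 Ruv * legs 0 1 Ru) ∧
      -- crossing symmetry
      Rhat X n g * diagD1 X n expQuarter *
        transpose1 X n ((Rhat X n g).map (shiftH (kappa X n))) * (diagD1 X n expQuarter)⁻¹ = 1 ∧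
      -- unitarity
      legs (m := 2) 0 1 (Rhat X n g) * legs 1 0 ((Rhat X n g).map (mapCoeff negU)) = 1 :=
  ⟨existsUnique_isNormalizing _, fun g hg =>
    ⟨Rhat_yang_baxter X n g, Rhat_crossing X n hg, legs_Rhat_mul X n hg⟩⟩
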